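/- Let $\kappa\le 0$ and let $\mathbb{M}^n(\kappa)$ be the $n$-dimensional space form of constant curvature $\kappa$ (Euclidean space if $\kappa=0$, hyperbolic space if $\kappa<0$). Let $M$ be a complete connected Riemannian $m$-manifold and $\varphi:M\to\mathbb{M}^n(\kappa)$ a smooth isometric immersion with second fundamental form $\alpha$ and $\|\alpha\|=\big(\sum_{i,j}|\alpha(e_i,e_j)|^2\big)^{1/2}$, $(e_i)$ an orthonormal basis of the tangent space. Put $S_\kappa(t)=\sinh(\sqrt{-\kappa}\,t)/\sqrt{-\kappa}$ if $\kappa<0$, $S_0(t)=t$, and $C_\kappa=S_\kappa'$. Fix $x_0\in M$ and let $$a(M)=\lim_{i\to\infty}\ \sup_{x\in M\setminus C_i}\ \frac{S_\kappa}{C_\kappa}\big(\operatorname{dist}_M(x_0,x)\big)\,\|\alpha(x)\|\in[0,\infty]$$ for an exhaustion $(C_i)$ of $M$ by compact sets. Fix $o\in\mathbb{M}^n(\kappa)$, let $r=\operatorname{dist}_{\mathbb{M}^n(\kappa)}(o,\varphi(\cdot))$ and $D_t=\{x\in M: r(x)<t\}$, let $\nabla^M r$ be the gradient of $r$ on $M$,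 and let $\nabla^\perp r$ be the component normal to $M$ of the gradient in $\mathbb{M}^n(\kappa)$ of the distance to $o$. For a compact set $K\subset M$, an end of $M$ with respect to $K$ is an unbounded connected component of $M\setminus K$. Assume $a(M)<1$. Then there is $t_0>0$ such that for every compact $K\subset M$, every end $V$ of $M$ with respect to $K$, every $t>t_0$ and every $p\in\partial V(t):=\partial D_t\cap V$, one has $\nabla^M r(p)\neq0$, and the sectional curvature, in the metric induced from $M$, of every plane $\pi\subset T_p\partial V(t)$ satisfies, with $\|\alpha\|,\nabla^\perp r,\nabla^M r$ evaluated at $p$, $$K_{\partial V(t)}(\pi)\le\kappa+\|\alpha\|^2+\frac{\Big(\frac{C_\kappa}{S_\kappa}(t)+|\nabla^\perp r|\,\|\alpha\|\Big)^2}{|\nabla^M r|^2},$$ $$K_{\partial V(t)}(\pi)\ge\kappa-2\|\alpha\|^2+\frac{\Big(\frac{C_\kappa}{S_\kappa}(t)\Big)^2-2|\nabla^\perp r|\,\|\alpha\|\,\frac{C_\kappa}{S_\kappa}(t)}{|\nabla^M r|^2}.$$ -/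

import Mathlib

open Set Filter Topology Manifold Bundle
open scoped ContDiff ENNReal

noncomputable section

/-! ### Riemannian geometry of a metric in coordinates

A Riemannian metric on an open subset of a finite-dimensional normed space `E` is given by a field
`G : E → E →L[ℝ] E →L[ℝ] ℝ` of symmetric positive definite bilinear forms. -/

section Coordinates

variable {E : Type*} [NormedAddCommGroup E] [NormedSpace ℝ E]

/-- The vector representing the linear form `L` with respect to the inner product `B`:
the unique `v` with `B v w = L w` for all `w`. -/
def rieszVector (B : E →L[ℝ] E →L[ℝ] ℝ) (L : E →L[ℝ] ℝ) : E :=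
  B.inverse L

/-- Christoffel symbols of the first kind:
`w ↦ ½ (∂_u G(v, w) + ∂_v G(u, w) - ∂_w G(u, v))` at the point `y`. -/
def christoffelFirst (G : E → E →L[ℝ] E →L[ℝ] ℝ) (y u v : E) : E →L[ℝ] ℝ :=
  (1 / 2 : ℝ) • (fderiv ℝ G y u v + fderiv ℝ G y v u - ((fderiv ℝ G y).flip u).flip v)

/-- Christoffel symbols of the second kind: `Γ_y(u, v) = (∇_u v)(y)` for the Levi-Civita connection
`∇` of `G` and the constant vector fields `u`, `v`. -/
def christoffel (G : E → E →L[ℝ] E →L[ℝ] ℝ) (y u v : E) : E :=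
  rieszVector (G y) (christoffelFirst G y u v)

/-- The curvature tensor `R(u, v) w = ∇_u ∇_v w - ∇_v ∇_u w` of `G` at `y`, for constant vector
fields `u`, `v`, `w`. -/
def riemannCurvature (G : E → E →L[ℝ] E →L[ℝ] ℝ) (y u v w : E) : E :=
  fderiv ℝ (fun z => christoffel G z v w) y u - fderiv ℝ (fun z => christoffel G z u w) y v
    + christoffel G y u (christoffel G y v w) - christoffel G y v (christoffel G y u w)

/-- The sectional curvature of `G` at `y` of the plane spanned by `u` and `v`. -/
def sectionalCurvature (G : E → E →L[ℝ] E →L[ℝ] ℝ) (y u v : E) : ℝ :=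
  G y (riemannCurvature G y u v v) u / (G y u u * G y v v - G y u v ^ 2)

end Coordinates

/-! ### The space form of constant curvature `κ ≤ 0` -/

/-- The functions `S_κ` for `κ ≤ 0`. -/
def sinK (κ t : ℝ) : ℝ :=
  if κ < 0 then Real.sinh (√(-κ) * t) / √(-κ) else t

/-- `C_κ = S_κ'`. -/
def cosK (κ t : ℝ) : ℝ := deriv (sinK κ) t

/-- The underlying manifold `ℝⁿ` of the `n`-dimensional space form. For `κ < 0` a point `x ∈ ℝⁿ`
stands for the point `(x, √(1 - κ‖x‖²))` of the hyperboloid `s² + κ‖x‖² = 1`, `s > 0`, in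
`ℝⁿ × ℝ` with the Lorentz form `‖dx‖² + ds² / κ`. -/
abbrev SpaceForm (n : ℕ) : Type := EuclideanSpace ℝ (Fin n)

/-- The Euclidean inner product of `ℝⁿ` as a bilinear form. -/
def euclideanForm (n : ℕ) : SpaceForm n →L[ℝ] SpaceForm n →L[ℝ] ℝ := innerSL ℝ

/-- The Riemannian metric of the space form of curvature `κ`: for `κ = 0` the Euclidean metric, and
for `κ < 0` the metric of the hyperboloid in the global chart `(x, √(1 - κ‖x‖²)) ↦ x`, i.e.
`g_x(u, v) = ⟪u, v⟫ + κ ⟪x, u⟫ ⟪x, v⟫ / (1 - κ‖x‖²)`. -/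
def spaceFormMetric {n : ℕ} (κ : ℝ) (x : SpaceForm n) :
    SpaceForm n →L[ℝ] SpaceForm n →L[ℝ] ℝ :=
  euclideanForm n + (κ / (1 - κ * ‖x‖ ^ 2)) • (euclideanForm n x).smulRight (euclideanForm n x)

/-- The geodesic distance of the space form of curvature `κ`: for `κ = 0` the Euclidean distance,
and for `κ < 0` the hyperbolic distance, given on the hyperboloid by
`cosh (√(-κ) d) = s_x s_y + κ ⟪x, y⟫`. -/
def spaceFormDist {n : ℕ} (κ : ℝ) (x y : SpaceForm n) : ℝ :=
  if κ < 0 then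
    Real.arcosh (√(1 - κ * ‖x‖ ^ 2) * √(1 - κ * ‖y‖ ^ 2) + κ * inner ℝ x y) / √(-κ)
  else ‖x - y‖

/-- The norm of a tangent vector `w` of the space form at `x`. -/
def spaceFormNorm {n : ℕ} (κ : ℝ) (x w : SpaceForm n) : ℝ :=
  √(spaceFormMetric κ x w w)

/-! ### Submanifolds of the space form -/

section Submanifold

variable (m : ℕ) {n : ℕ} {M : Type*} [MetricSpace M] [ChartedSpace (EuclideanSpace ℝ (Fin m)) M]

/-- The differential `φ_* : T_p M → T_{φ(p)} 𝕄ⁿ(κ) = ℝⁿ`. -/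
def pushforward (φ : M → SpaceForm n) (p : M) :
    TangentSpace (𝓡 m) p →L[ℝ] SpaceForm n :=
  mfderiv (𝓡 m) 𝓘(ℝ, SpaceForm n) φ p

variable [RiemannianBundle (fun x : M => TangentSpace (𝓡 m) x)]

/-- The inner product of the Riemannian manifold `M` on `T_p M`, as a bilinear form. -/
def tangentMetric (p : M) :
    TangentSpace (𝓡 m) p →L[ℝ] TangentSpace (𝓡 m) p →L[ℝ] ℝ :=
  innerSL ℝ

/-- `φ : M → 𝕄ⁿ(κ)` is a smooth isometric immersion. -/
structure IsIsometricImmersion (κ : ℝ) (φ : M → SpaceForm n) : Prop where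
  contMDiff : ContMDiff (𝓡 m) 𝓘(ℝ, SpaceForm n) ∞ φ
  isometric : ∀ (p : M) (u v : TangentSpace (𝓡 m) p),
    spaceFormMetric κ (φ p) (pushforward m φ p u) (pushforward m φ p v) = inner ℝ u v

/-- The vector of `T_p M` representing the linear form `L` in the Riemannian metric of `M`. -/
def tangentRiesz (p : M) (L : TangentSpace (𝓡 m) p →L[ℝ] ℝ) : TangentSpace (𝓡 m) p :=
  rieszVector (tangentMetric m p) L

/-- The component `w^⊥` normal to `φ_* (T_p M)` of a vector `w` tangent to the space form
at `φ(p)`. -/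
def normalPart (κ : ℝ) (φ : M → SpaceForm n) (p : M) (w : SpaceForm n) : SpaceForm n :=
  w - pushforward m φ p
    (tangentRiesz m p ((spaceFormMetric κ (φ p) w).comp (pushforward m φ p)))

/-- The second fundamental form `α_p(u, v) = (∇̄_u (φ_* v))^⊥` of `φ` at `p`, where `∇̄` is the
Levi-Civita connection of the space form and `v` is extended to be constant in the preferred chart
at `p` (whose differential at `p` is the identity of `T_p M`). -/
def secondFundamentalForm (κ : ℝ) (φ : M → SpaceForm n) (p : M)
    (u v : TangentSpace (𝓡 m) p) : SpaceForm n :=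
  normalPart m κ φ p
    (fderiv ℝ (fderiv ℝ (φ ∘ (extChartAt (𝓡 m) p).symm)) (extChartAt (𝓡 m) p p) u v
      + christoffel (spaceFormMetric κ) (φ p) (pushforward m φ p u) (pushforward m φ p v))

/-- The (Hilbert–Schmidt) norm `‖α‖ = (∑ᵢⱼ |α(eᵢ, eⱼ)|²)^{1/2}` of the second fundamental form at
`p`, for an orthonormal basis `(eᵢ)` of `T_p M`. -/
def alphaNorm (κ : ℝ) (φ : M → SpaceForm n) (p : M) : ℝ :=
  haveI : FiniteDimensional ℝ (TangentSpace (𝓡 m) p) :=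
    inferInstanceAs (FiniteDimensional ℝ (EuclideanSpace ℝ (Fin m)))
  let e := stdOrthonormalBasis ℝ (TangentSpace (𝓡 m) p)
  √(∑ i, ∑ j, spaceFormNorm κ (φ p) (secondFundamentalForm m κ φ p (e i) (e j)) ^ 2)

/-- The invariant `a(M) ∈ [0, ∞]`: the limit, along an exhaustion of `M` by compact sets `C`, of the
suprema of `(S_κ / C_κ)(ρ_M(x)) ‖α(x)‖` over `M ∖ C`, where `ρ_M = dist(x₀, ·)`. -/
def tamedInvariant (κ : ℝ) (φ : M → SpaceForm n) (x₀ : M) : ℝ≥0∞ :=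
  limsup (fun x => ENNReal.ofReal
    (sinK κ (dist x₀ x) / cosK κ (dist x₀ x) * alphaNorm m κ φ x)) (cocompact M)

/-- The extrinsic distance function `r = dist(o, φ(·))` on `M`. -/
def extrinsicDist (κ : ℝ) (φ : M → SpaceForm n) (o : SpaceForm n) (p : M) : ℝ :=
  spaceFormDist κ o (φ p)

/-- The extrinsic ball `D_t(o) = {r < t}`. -/
def extrinsicBall (κ : ℝ) (φ : M → SpaceForm n) (o : SpaceForm n) (t : ℝ) : Set M :=
  {p | extrinsicDist κ φ o p < t}

/-- The gradient `∇^M r` at `p` of the extrinsic distance function. -/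
def gradExtrinsicDist (κ : ℝ) (φ : M → SpaceForm n) (o : SpaceForm n) (p : M) :
    TangentSpace (𝓡 m) p :=
  tangentRiesz m p (mfderiv (𝓡 m) 𝓘(ℝ, ℝ) (extrinsicDist κ φ o) p)

/-- `∇^⊥ r` at `p`: the component normal to `M` of the gradient, in the space form, of the distance
to `o`. -/
def normalGradDist (κ : ℝ) (φ : M → SpaceForm n) (o : SpaceForm n) (p : M) : SpaceForm n :=
  normalPart m κ φ p
    (rieszVector (spaceFormMetric κ (φ p)) (fderiv ℝ (spaceFormDist κ o) (φ p)))

/-- `V` is an end of `M` with respect to `K`: an unbounded connected component of `M ∖ K`. -/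
def IsEnd (K V : Set M) : Prop :=
  (∃ x ∈ Kᶜ, V = connectedComponentIn Kᶜ x) ∧ ¬ Bornology.IsBounded V

/-- `ψ : U → M` is a local parametrization of the hypersurface `S` of `M`: `U` is open in `ℝ^{m-1}`
and `ψ` is a smooth immersion of `U` into `M` with image in `S`. -/
structure IsHypersurfaceParam (S : Set M) (U : Set (EuclideanSpace ℝ (Fin (m - 1))))
    (ψ : EuclideanSpace ℝ (Fin (m - 1)) → M) : Prop where
  isOpen : IsOpen U
  contMDiffOn : ContMDiffOn (𝓡 (m - 1)) (𝓡 m) ∞ ψ U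
  immersion : ∀ y ∈ U, Function.Injective (mfderiv (𝓡 (m - 1)) (𝓡 m) ψ y)
  mapsTo : MapsTo ψ U S

/-- The metric induced by `M` in the coordinates given by `ψ`:
`G_y(u, v) = ⟪ψ_* u, ψ_* v⟫` at `ψ(y)`. -/
def inducedMetric (ψ : EuclideanSpace ℝ (Fin (m - 1)) → M) (y : EuclideanSpace ℝ (Fin (m - 1))) :
    EuclideanSpace ℝ (Fin (m - 1)) →L[ℝ] EuclideanSpace ℝ (Fin (m - 1)) →L[ℝ] ℝ :=
  (tangentMetric m (ψ y)).bilinearComp (mfderiv (𝓡 (m - 1)) (𝓡 m) ψ y)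
    (mfderiv (𝓡 (m - 1)) (𝓡 m) ψ y)

end Submanifold

end

/-!
The argument compares the extrinsic distance `r` with the function `potential κ o`, a primitive of
`S_κ` in the variable `r` (for `κ < 0` it is `(C_κ(r) - 1) / (-κ)`, for `κ = 0` it is `r² / 2`). It
is smooth on the whole space form, and its Hessian there is `C_κ(r)` times the metric
(`fderiv_fderiv_potential_comp`). Along `φ`, the Hessian of the restricted potential is therefore
`C_κ(r) g + ⟨grad, α⟩`, which is bounded below by `C_κ(r) - S_κ(r) ‖α‖`.

*Convexity at infinity.* If `a(M) < 1`, then `S_κ(r) ‖α‖ < C_κ(r)` outside a ball about `x₀`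
(`exists_sinK_mul_alphaNorm_lt`): for `κ < 0` because `S_κ / C_κ` increases to `1 / √(-κ)`, for
`κ = 0` because `φ` does not increase distances. So the potential is strictly convex on `M` outside
a ball, and `t₀` is chosen at least the maximum of `r` on that ball.

*No critical points.* Suppose `p` is a critical point of `r` with `r(p) > t₀`. Then `p` lies outside
the ball and is a strict local minimum of the potential, which along minimal segments towards `x₀`
is strictly convex until the ball is reached, where it is below its value at `p`. This is impossible
(`HasApproxBetween.false_of_strict_local_min`). Geodesics are not needed as solutions of a
differential equation: the metric form of the Hopf–Rinow theorem gives points on minimal segments,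
and convexity is used in the form of a strict midpoint inequality
(`exists_potential_midpoint_lt`). That inequality follows from a one-sided first variation estimate
with quadratic error (`exists_dist_flow_le`): moving `z` for time `τ` along the negative gradient
of the potential changes the distances to `x` and to `y` in a controlled way, and if `z` is a midpoint
of `x` and `y` and the potential at `z` were not below the average, their sum would drop below the
distance of `x` and `y` for small `τ`.

*Curvature.* Let `ψ` parametrize the level set `r = t`. The Gauss equation for the composite
`φ ∘ ψ` into the space form (`pullbackMetric_riemannCurvature`) expresses the sectional curvature
through the second fundamental form of `φ ∘ ψ`. Its component normal to `M` is the restriction of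
`α`. Its component along `∇^M r` is found by differentiating twice the potential along `φ ∘ ψ`, which
is constant: on unit vectors `a` it is `-(C_κ/S_κ(t) + ⟨α(a, a), ∇^⊥ r⟩) / |∇^M r|`
(`exists_sectionalCurvature_level`). The two bounds are then elementary inequalities
(`gauss_upper_bound`, `gauss_lower_bound`) between the coefficients, using the Cauchy–Schwarz
inequality, `|∇^⊥ r| ≤ 1`, `|α(a, a)|² + |α(b, b)|² + 2 |α(a, b)|² ≤ ‖α‖²` for orthonormal `a`, `b`,
and, for the lower one, `‖α‖ ≤ C_κ/S_κ(t)`.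
-/

/-! ### Positive definite forms and the musical isomorphism -/

section PositiveDefinite

variable {E : Type*} [NormedAddCommGroup E] [NormedSpace ℝ E] [FiniteDimensional ℝ E]

lemma isInvertible_of_pos {B : E →L[ℝ] E →L[ℝ] ℝ} (hB : ∀ v, v ≠ 0 → 0 < B v v) :
    B.IsInvertible := by
  have hinj : Function.Injective B := by
    refine (injective_iff_map_eq_zero B).2 fun v hv => ?_
    by_contra h
    have := hB v h
    simp [hv] at this
  have hdim : Module.finrank ℝ E = Module.finrank ℝ (E →L[ℝ] ℝ) := by
    rw [← (LinearMap.toContinuousLinearMap (𝕜 := ℝ) (E := E) (F' := ℝ)).finrank_eq]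
    exact (Subspace.dual_finrank_eq (K := ℝ) (V := E)).symm
  let e := (LinearEquiv.ofInjectiveOfFinrankEq (B : E →ₗ[ℝ] E →L[ℝ] ℝ) hinj hdim)
  exact ⟨e.toContinuousLinearEquiv, by ext; rfl⟩

lemma apply_rieszVector {B : E →L[ℝ] E →L[ℝ] ℝ} (hB : ∀ v, v ≠ 0 → 0 < B v v)
    (L : E →L[ℝ] ℝ) (w : E) : B (rieszVector B L) w = L w := by
  obtain ⟨e, rfl⟩ := isInvertible_of_pos hB
  simp [rieszVector]

lemma eq_rieszVector {B : E →L[ℝ] E →L[ℝ] ℝ} (hB : ∀ v, v ≠ 0 → 0 < B v v)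
    {L : E →L[ℝ] ℝ} {v : E} (h : ∀ w, B v w = L w) : rieszVector B L = v := by
  have h' : B v = L := by ext w; exact h w
  obtain ⟨e, rfl⟩ := isInvertible_of_pos hB
  simp [rieszVector, ← h']

/-- The Cauchy–Schwarz inequality for a nonnegative symmetric bilinear form. -/
lemma sq_apply_le_of_nonneg {E : Type*} [NormedAddCommGroup E] [NormedSpace ℝ E]
    {B : E →L[ℝ] E →L[ℝ] ℝ} (hs : ∀ u v, B u v = B v u)
    (hB : ∀ v, 0 ≤ B v v) (u v : E) : B u v ^ 2 ≤ B u u * B v v := by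
  have key : ∀ t : ℝ, 0 ≤ B u u * (t * t) + 2 * B u v * t + B v v := fun t => by
    have := hB (t • u + v)
    simp only [map_add, map_smul, add_apply, smul_apply,
      smul_eq_mul, hs v u] at this
    linarith
  have := discrim_le_zero key
  unfold discrim at this
  nlinarith

end PositiveDefinite

/-! ### The metric of the space form -/

section SpaceFormMetric

variable {n : ℕ} {κ : ℝ}

lemma euclideanForm_apply (x y : SpaceForm n) : euclideanForm n x y = inner ℝ x y := rfl

lemma spaceFormMetric_apply (κ : ℝ) (x u v : SpaceForm n) :
    spaceFormMetric κ x u v =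
      inner ℝ u v + κ / (1 - κ * ‖x‖ ^ 2) * (inner ℝ x u * inner ℝ x v) := by
  simp [spaceFormMetric, euclideanForm_apply]

lemma spaceFormMetric_symm (κ : ℝ) (x u v : SpaceForm n) :
    spaceFormMetric κ x u v = spaceFormMetric κ x v u := by
  rw [spaceFormMetric_apply, spaceFormMetric_apply, real_inner_comm]; ring

lemma one_le_one_sub_mul_sq (hκ : κ ≤ 0) (x : SpaceForm n) : 1 ≤ 1 - κ * ‖x‖ ^ 2 := by
  nlinarith [sq_nonneg ‖x‖]

lemma norm_sq_div_le_spaceFormMetric (hκ : κ ≤ 0) (x u : SpaceForm n) :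
    ‖u‖ ^ 2 / (1 - κ * ‖x‖ ^ 2) ≤ spaceFormMetric κ x u u := by
  have h1 := one_le_one_sub_mul_sq hκ x
  have hw : 0 < 1 - κ * ‖x‖ ^ 2 := by linarith
  have h2 : inner ℝ x u * inner ℝ x u ≤ ‖x‖ ^ 2 * ‖u‖ ^ 2 := by
    have := real_inner_mul_inner_self_le x u
    rw [real_inner_self_eq_norm_sq, real_inner_self_eq_norm_sq] at this
    exact this
  rw [spaceFormMetric_apply, real_inner_self_eq_norm_sq, div_le_iff₀ hw, add_mul]
  have : κ / (1 - κ * ‖x‖ ^ 2) * (inner ℝ x u * inner ℝ x u) * (1 - κ * ‖x‖ ^ 2)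
      = κ * (inner ℝ x u * inner ℝ x u) := by field_simp
  rw [this]
  nlinarith

lemma spaceFormMetric_pos (hκ : κ ≤ 0) (x u : SpaceForm n) (hu : u ≠ 0) :
    0 < spaceFormMetric κ x u u := by
  refine lt_of_lt_of_le ?_ (norm_sq_div_le_spaceFormMetric hκ x u)
  have := one_le_one_sub_mul_sq hκ x
  have := norm_pos_iff.2 hu
  positivity

lemma spaceFormMetric_nonneg (hκ : κ ≤ 0) (x u : SpaceForm n) :
    0 ≤ spaceFormMetric κ x u u := by
  rcases eq_or_ne u 0 with rfl | hu
  · simp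
  · exact (spaceFormMetric_pos hκ x u hu).le

lemma spaceFormNorm_sq (hκ : κ ≤ 0) (x u : SpaceForm n) :
    spaceFormNorm κ x u ^ 2 = spaceFormMetric κ x u u :=
  Real.sq_sqrt (spaceFormMetric_nonneg hκ x u)

lemma abs_spaceFormMetric_le (hκ : κ ≤ 0) (x u v : SpaceForm n) :
    |spaceFormMetric κ x u v| ≤ spaceFormNorm κ x u * spaceFormNorm κ x v := by
  refine abs_le_of_sq_le_sq ?_ (mul_nonneg (Real.sqrt_nonneg _) (Real.sqrt_nonneg _))
  rw [mul_pow, spaceFormNorm_sq hκ, spaceFormNorm_sq hκ]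
  exact sq_apply_le_of_nonneg (spaceFormMetric_symm κ x) (spaceFormMetric_nonneg hκ x) u v

set_option maxSynthPendingDepth 3 in
lemma contDiff_spaceFormMetric (hκ : κ ≤ 0) :
    ContDiff ℝ ∞ (spaceFormMetric (n := n) κ) := by
  unfold spaceFormMetric
  have hw : ∀ x : SpaceForm n, 1 - κ * ‖x‖ ^ 2 ≠ 0 := fun x => by
    linarith [one_le_one_sub_mul_sq hκ x]
  have h1 : ContDiff ℝ ∞ fun x : SpaceForm n => κ / (1 - κ * ‖x‖ ^ 2) :=
    contDiff_const.div (contDiff_const.sub (contDiff_const.mul (contDiff_norm_sq ℝ))) hw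
  have h2 : ContDiff ℝ ∞ fun x : SpaceForm n =>
      (euclideanForm n x).smulRight (euclideanForm n x) :=
    ((euclideanForm n).contDiff).smulRight ((euclideanForm n).contDiff)
  have h3 := h1.smul h2
  exact contDiff_const.add h3

variable {E : Type*} [NormedAddCommGroup E] [NormedSpace ℝ E]

/-- The Levi-Civita connection `∇_X U = dU(X) + κ g(X, U) x` of the space form is compatible with
its metric: this is the product rule for the inner product of vector fields `u`, `v` along a
map `x`. -/
lemma hasFDerivAt_spaceFormMetric (hκ : κ ≤ 0) {x u v : E → SpaceForm n} {y : E}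
    {x' u' v' : E →L[ℝ] SpaceForm n} (hx : HasFDerivAt x x' y) (hu : HasFDerivAt u u' y)
    (hv : HasFDerivAt v v' y) :
    HasFDerivAt (fun z => spaceFormMetric κ (x z) (u z) (v z))
      ((spaceFormMetric κ (x y)).flip (v y) ∘L
          (u' + (κ • ((spaceFormMetric κ (x y)).flip (u y) ∘L x')).smulRight (x y)) +
        spaceFormMetric κ (x y) (u y) ∘L
          (v' + (κ • ((spaceFormMetric κ (x y)).flip (v y) ∘L x')).smulRight (x y))) y := by
  have hw : 1 - κ * ‖x y‖ ^ 2 ≠ 0 := by linarith [one_le_one_sub_mul_sq hκ (x y)]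
  have h1 := ((hasDerivAt_inv hw).comp_hasFDerivAt y
    ((hx.norm_sq.const_mul κ).const_sub 1)).const_mul κ
  have h2 := (hu.inner ℝ hv).add (h1.mul ((hx.inner ℝ hu).mul (hx.inner ℝ hv)))
  simp only [spaceFormMetric_apply, div_eq_mul_inv]
  refine h2.congr_fderiv ?_
  ext e
  simp only [add_apply, ContinuousLinearMap.comp_apply,
    smul_apply, ContinuousLinearMap.prod_apply, fderivInnerCLM_apply,
    ContinuousLinearMap.flip_apply, ContinuousLinearMap.smulRight_apply, spaceFormMetric_apply,
    neg_apply, smul_eq_mul, inner_add_left, inner_add_right,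
    real_inner_smul_left, real_inner_smul_right, innerSL_apply_apply, nsmul_eq_mul]
  rw [real_inner_self_eq_norm_sq, real_inner_comm (x y) (u y)]
  simp only [Pi.mul_apply, Function.comp_apply, Nat.cast_ofNat]
  field_simp
  ring

lemma fderiv_spaceFormMetric (hκ : κ ≤ 0) {x u v : E → SpaceForm n} {y : E}
    (hx : DifferentiableAt ℝ x y) (hu : DifferentiableAt ℝ u y)
    (hv : DifferentiableAt ℝ v y) (e : E) :
    fderiv ℝ (fun z => spaceFormMetric κ (x z) (u z) (v z)) y e =
      spaceFormMetric κ (x y)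
          (fderiv ℝ u y e + (κ * spaceFormMetric κ (x y) (fderiv ℝ x y e) (u y)) • x y) (v y) +
        spaceFormMetric κ (x y) (u y)
          (fderiv ℝ v y e + (κ * spaceFormMetric κ (x y) (fderiv ℝ x y e) (v y)) • x y) := by
  rw [(hasFDerivAt_spaceFormMetric hκ hx.hasFDerivAt hu.hasFDerivAt hv.hasFDerivAt).fderiv]
  simp

lemma christoffel_spaceFormMetric (hκ : κ ≤ 0) (x u v : SpaceForm n) :
    christoffel (spaceFormMetric κ) x u v = (κ * spaceFormMetric κ x u v) • x := by
  refine eq_rieszVector (spaceFormMetric_pos hκ x) fun w => ?_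
  have hd : DifferentiableAt ℝ (spaceFormMetric (n := n) κ) x :=
    (contDiff_spaceFormMetric hκ).differentiable (by simp) x
  have key : ∀ a b c : SpaceForm n, fderiv ℝ (spaceFormMetric κ) x a b c =
      κ * spaceFormMetric κ x a b * spaceFormMetric κ x x c +
        κ * spaceFormMetric κ x a c * spaceFormMetric κ x x b := fun a b c => by
    have h1 : fderiv ℝ (fun z => spaceFormMetric κ z b c) x a =
        fderiv ℝ (spaceFormMetric κ) x a b c := by
      have := ((hd.hasFDerivAt.clm_apply (hasFDerivAt_const b x)).clm_apply
        (hasFDerivAt_const c x)).fderiv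
      rw [this]; simp
    rw [← h1, fderiv_spaceFormMetric hκ (x := fun z => z) differentiableAt_fun_id
      (differentiableAt_const b) (differentiableAt_const c)]
    simp [spaceFormMetric_symm κ x b x]
  simp only [christoffelFirst, smul_apply, add_apply,
    sub_apply, ContinuousLinearMap.flip_apply, key, smul_eq_mul, map_smul,
    spaceFormMetric_symm κ x v u, spaceFormMetric_symm κ x w u, spaceFormMetric_symm κ x w v]
  ring

end SpaceFormMetric

/-! ### The distance function of the space form -/

section Trigonometry

variable {κ t : ℝ}

lemma hasDerivAt_sinK (κ t : ℝ) :
    HasDerivAt (sinK κ) (if κ < 0 then Real.cosh (√(-κ) * t) else 1) t := by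
  unfold sinK
  split_ifs with h
  · have hs : √(-κ) ≠ 0 := (Real.sqrt_pos.2 (by linarith)).ne'
    have := (((hasDerivAt_id t).const_mul (√(-κ))).sinh).div_const (√(-κ))
    refine this.congr_deriv ?_
    simp only [id]
    field_simp
  · exact hasDerivAt_id t

lemma cosK_eq (κ t : ℝ) : cosK κ t = if κ < 0 then Real.cosh (√(-κ) * t) else 1 :=
  (hasDerivAt_sinK κ t).deriv

lemma one_le_cosK (κ t : ℝ) : 1 ≤ cosK κ t := by
  rw [cosK_eq]; split_ifs
  · exact Real.one_le_cosh _
  · exact le_rfl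

lemma cosK_pos (κ t : ℝ) : 0 < cosK κ t := lt_of_lt_of_le one_pos (one_le_cosK κ t)

lemma strictMono_sinK (κ : ℝ) : StrictMono (sinK κ) := by
  refine strictMono_of_deriv_pos fun t => ?_
  exact cosK_pos κ t

lemma sinK_zero (κ : ℝ) : sinK κ 0 = 0 := by simp [sinK]

lemma sinK_pos (ht : 0 < t) : 0 < sinK κ t := by
  simpa [sinK_zero] using strictMono_sinK κ ht

lemma sinK_nonneg (ht : 0 ≤ t) : 0 ≤ sinK κ t := by
  simpa [sinK_zero] using (strictMono_sinK κ).monotone ht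

end Trigonometry

section Potential

variable {n : ℕ} {κ : ℝ}

/-- The smooth function `(C_κ(r) - 1) / (-κ)` (for `κ < 0`), respectively `r² / 2` (for `κ = 0`),
of the distance `r` to `o` in the space form: the primitive of `S_κ` evaluated at `r`.
It is smooth also at `o`, and its Hessian is `C_κ(r)` times the metric. -/
noncomputable def potential (κ : ℝ) (o x : SpaceForm n) : ℝ :=
  if κ < 0 then
    (√(1 - κ * ‖o‖ ^ 2) * √(1 - κ * ‖x‖ ^ 2) + κ * inner ℝ o x - 1) / (-κ)
  else ‖x - o‖ ^ 2 / 2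

/-- The gradient of `potential κ o` at `x`. -/
noncomputable def gradPotential (κ : ℝ) (o x : SpaceForm n) : SpaceForm n :=
  (1 - κ * potential κ o x) • x - o

lemma one_sub_mul_potential_of_neg (h : κ < 0) (o x : SpaceForm n) :
    1 - κ * potential κ o x = √(1 - κ * ‖o‖ ^ 2) * √(1 - κ * ‖x‖ ^ 2) + κ * inner ℝ o x := by
  have := h.ne
  rw [potential, if_pos h]
  field_simp
  ring

lemma one_sub_mul_sq_pos (hκ : κ ≤ 0) (x : SpaceForm n) : 0 < 1 - κ * ‖x‖ ^ 2 := by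
  linarith [one_le_one_sub_mul_sq hκ x]

lemma contDiff_potential (hκ : κ ≤ 0) (o : SpaceForm n) : ContDiff ℝ ∞ (potential κ o) := by
  unfold potential
  split_ifs with h
  · have h1 : ContDiff ℝ ∞ fun x : SpaceForm n => √(1 - κ * ‖x‖ ^ 2) :=
      (contDiff_const.sub (contDiff_const.mul (contDiff_norm_sq ℝ))).sqrt
        fun x => (one_sub_mul_sq_pos hκ x).ne'
    have h2 : ContDiff ℝ ∞ fun x : SpaceForm n => inner ℝ o x := contDiff_const.inner ℝ contDiff_id
    exact (((contDiff_const.mul h1).add (contDiff_const.mul h2)).sub contDiff_const).div_const _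
  · exact ((contDiff_id.sub contDiff_const).norm_sq ℝ).div_const 2

lemma potential_nonneg (hκ : κ ≤ 0) (o x : SpaceForm n) : 0 ≤ potential κ o x := by
  unfold potential
  split_ifs with h
  · refine div_nonneg ?_ (by linarith)
    have h1 := one_sub_mul_sq_pos hκ o
    have h2 := one_sub_mul_sq_pos hκ x
    have h3 : 1 - κ * inner ℝ o x ≤ √(1 - κ * ‖o‖ ^ 2) * √(1 - κ * ‖x‖ ^ 2) := by
      rw [← Real.sqrt_mul h1.le]
      refine Real.le_sqrt_of_sq_le ?_
      have h4 := real_inner_mul_inner_self_le o x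
      rw [real_inner_self_eq_norm_sq, real_inner_self_eq_norm_sq] at h4
      have h5 : 0 ≤ ‖o - x‖ ^ 2 := sq_nonneg _
      rw [norm_sub_sq_real] at h5
      nlinarith [mul_nonneg (neg_nonneg.2 hκ) h5,
        mul_nonneg (mul_self_nonneg κ) (sub_nonneg.2 h4)]
    linarith
  · positivity

lemma one_le_one_sub_mul_potential (hκ : κ ≤ 0) (o x : SpaceForm n) :
    1 ≤ 1 - κ * potential κ o x := by
  nlinarith [potential_nonneg hκ o x]

lemma fderiv_potential (hκ : κ ≤ 0) (o x u : SpaceForm n) :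
    fderiv ℝ (potential κ o) x u = spaceFormMetric κ x (gradPotential κ o x) u := by
  rw [spaceFormMetric_apply]
  unfold gradPotential
  rcases hκ.lt_or_eq with h | h
  · rw [one_sub_mul_potential_of_neg h]
    have hx := one_sub_mul_sq_pos hκ x
    have hw : 0 < √(1 - κ * ‖x‖ ^ 2) := Real.sqrt_pos.2 hx
    have h1 := ((((((hasFDerivAt_id x).norm_sq.const_mul κ).const_sub 1).sqrt hx.ne').const_mul
      (√(1 - κ * ‖o‖ ^ 2))).add
      (((hasFDerivAt_const o x).inner ℝ (hasFDerivAt_id x)).const_mul κ)).sub_const 1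
    have h2 := h1.const_mul (-κ)⁻¹
    have h3 : potential κ o = fun x => (-κ)⁻¹ *
        (√(1 - κ * ‖o‖ ^ 2) * √(1 - κ * ‖x‖ ^ 2) + κ * inner ℝ o x - 1) := by
      ext x; rw [potential, if_pos h, div_eq_inv_mul]
    rw [h3, (show HasFDerivAt (fun x => (-κ)⁻¹ *
        (√(1 - κ * ‖o‖ ^ 2) * √(1 - κ * ‖x‖ ^ 2) + κ * inner ℝ o x - 1)) _ x from h2).fderiv]
    simp only [add_apply, ContinuousLinearMap.comp_apply, smul_apply, neg_apply,
      ContinuousLinearMap.prod_apply, fderivInnerCLM_apply, zero_apply,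
      inner_zero_left, add_zero, smul_eq_mul, inner_sub_left, inner_sub_right, id,
      real_inner_smul_left, real_inner_smul_right, innerSL_apply_apply, nsmul_eq_mul,
      ContinuousLinearMap.id_apply, Nat.cast_ofNat]
    rw [real_inner_self_eq_norm_sq, real_inner_comm x o]
    set w := √(1 - κ * ‖x‖ ^ 2) with hwdef
    have hw2 : κ * ‖x‖ ^ 2 = 1 - w ^ 2 := by rw [hwdef, Real.sq_sqrt hx.le]; ring
    have := h.ne
    have hw3 : ‖x‖ ^ 2 = (1 - w ^ 2) / κ := by rw [← hw2]; field_simp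
    rw [hw3]
    have e : 1 - κ * ((1 - w ^ 2) / κ) = w ^ 2 := by field_simp; ring
    rw [e]
    field_simp
    ring
  · subst h
    have h1 := ((hasFDerivAt_id x).sub_const o).norm_sq.const_mul (2⁻¹ : ℝ)
    have h3 : potential 0 o = fun x => 2⁻¹ * ‖x - o‖ ^ 2 := by
      ext x; simp [potential, div_eq_inv_mul]
    rw [h3, (show HasFDerivAt (fun x => (2⁻¹ : ℝ) * ‖x - o‖ ^ 2) _ x from h1).fderiv]
    simp [innerSL_apply_apply, inner_sub_left]

lemma spaceFormMetric_gradPotential_self (hκ : κ ≤ 0) (o x : SpaceForm n) :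
    spaceFormMetric κ x (gradPotential κ o x) (gradPotential κ o x) =
      potential κ o x * (2 - κ * potential κ o x) := by
  rw [spaceFormMetric_apply]
  rcases hκ.lt_or_eq with h | h
  · have h1 : potential κ o x * (2 - κ * potential κ o x) =
        ((1 - κ * potential κ o x) ^ 2 - 1) / (-κ) := by
      have := h.ne; field_simp; ring
    rw [h1]
    unfold gradPotential
    rw [one_sub_mul_potential_of_neg h]
    have hx := one_sub_mul_sq_pos hκ x
    have ho := one_sub_mul_sq_pos hκ o
    have hw : 0 < √(1 - κ * ‖x‖ ^ 2) := Real.sqrt_pos.2 hx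
    simp only [inner_sub_left, inner_sub_right, real_inner_smul_left, real_inner_smul_right]
    rw [real_inner_self_eq_norm_sq, real_inner_self_eq_norm_sq, real_inner_comm x o]
    set w := √(1 - κ * ‖x‖ ^ 2) with hwdef
    set v := √(1 - κ * ‖o‖ ^ 2) with hvdef
    have := h.ne
    have hw3 : ‖x‖ ^ 2 = (1 - w ^ 2) / κ := by
      rw [hwdef, Real.sq_sqrt hx.le]; field_simp; ring
    have hv3 : ‖o‖ ^ 2 = (1 - v ^ 2) / κ := by
      rw [hvdef, Real.sq_sqrt ho.le]; field_simp; ring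
    rw [hw3, hv3]
    have e : 1 - κ * ((1 - w ^ 2) / κ) = w ^ 2 := by field_simp; ring
    rw [e]
    field_simp
    ring
  · subst h
    simp only [gradPotential, potential, lt_irrefl, if_false, zero_mul, sub_zero, one_smul,
      zero_div, add_zero, real_inner_self_eq_norm_sq]
    ring

lemma spaceFormDist_nonneg (hκ : κ ≤ 0) (o x : SpaceForm n) : 0 ≤ spaceFormDist κ o x := by
  unfold spaceFormDist
  split_ifs with h
  · rw [← one_sub_mul_potential_of_neg h]
    exact div_nonneg (Real.arcosh_nonneg (one_le_one_sub_mul_potential hκ o x)) (Real.sqrt_nonneg _)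
  · exact norm_nonneg _

lemma spaceFormDist_of_neg (h : κ < 0) (o x : SpaceForm n) :
    spaceFormDist κ o x = Real.arcosh (1 - κ * potential κ o x) / √(-κ) := by
  rw [spaceFormDist, if_pos h, one_sub_mul_potential_of_neg h]

lemma cosK_spaceFormDist (hκ : κ ≤ 0) (o x : SpaceForm n) :
    cosK κ (spaceFormDist κ o x) = 1 - κ * potential κ o x := by
  rw [cosK_eq]
  split_ifs with h
  · have hs : √(-κ) ≠ 0 := (Real.sqrt_pos.2 (by linarith)).ne'
    rw [spaceFormDist_of_neg h, mul_div_cancel₀ _ hs,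
      Real.cosh_arcosh (one_le_one_sub_mul_potential hκ o x)]
  · have : κ = 0 := le_antisymm hκ (not_lt.1 h)
    simp [this]

/-- The identity `C_κ² - 1 = -κ S_κ²`, divided by `-κ`, which extends it to `κ = 0`. -/
lemma sinK_spaceFormDist_sq (hκ : κ ≤ 0) (o x : SpaceForm n) :
    sinK κ (spaceFormDist κ o x) ^ 2 = potential κ o x * (2 - κ * potential κ o x) := by
  rcases hκ.lt_or_eq with h | h
  · have hs : √(-κ) ≠ 0 := (Real.sqrt_pos.2 (by linarith)).ne'
    have h0 := h.ne
    have h1 := one_le_one_sub_mul_potential hκ o x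
    rw [sinK, if_pos h, spaceFormDist_of_neg h, mul_div_cancel₀ _ hs, Real.sinh_arcosh h1, div_pow,
      Real.sq_sqrt (by nlinarith), Real.sq_sqrt (by linarith)]
    field_simp
    ring
  · subst h
    simp only [sinK, spaceFormDist, potential, lt_irrefl, if_false, zero_mul, sub_zero,
      norm_sub_rev o x]
    ring

lemma potential_lt_of_spaceFormDist_lt (hκ : κ ≤ 0) {o x y : SpaceForm n}
    (h : spaceFormDist κ o x < spaceFormDist κ o y) : potential κ o x < potential κ o y := by
  have h1 := strictMono_sinK κ h
  have h0 := sinK_nonneg (κ := κ) (spaceFormDist_nonneg hκ o x)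
  have h2 : sinK κ (spaceFormDist κ o x) ^ 2 < sinK κ (spaceFormDist κ o y) ^ 2 := by gcongr
  rw [sinK_spaceFormDist_sq hκ, sinK_spaceFormDist_sq hκ] at h2
  by_contra! h3
  have h4 := potential_nonneg hκ o y
  have h5 : 2 - κ * potential κ o y ≤ 2 - κ * potential κ o x := by nlinarith
  have h6 : 0 ≤ 2 - κ * potential κ o y := by nlinarith
  nlinarith [mul_le_mul h3 h5 h6 (h4.trans h3)]

lemma continuous_spaceFormDist (hκ : κ ≤ 0) (o : SpaceForm n) :
    Continuous (spaceFormDist κ o) := by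
  rcases hκ.lt_or_eq with h | h
  · have : spaceFormDist κ o = fun x => Real.arcosh (1 - κ * potential κ o x) / √(-κ) :=
      funext fun x => spaceFormDist_of_neg h o x
    rw [this]
    refine Continuous.div_const ?_ _
    refine Real.continuousOn_arcosh.comp_continuous ?_ fun x =>
      one_le_one_sub_mul_potential hκ o x
    exact continuous_const.sub (continuous_const.mul (contDiff_potential hκ o).continuous)
  · subst h
    have e : spaceFormDist 0 o = fun x => ‖o - x‖ := by ext x; simp [spaceFormDist]
    rw [e]
    fun_prop

/-- Away from `o`, the differential of the distance is that of the potential divided by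
`S_κ`. -/
lemma hasFDerivAt_spaceFormDist (hκ : κ ≤ 0) {o x : SpaceForm n}
    (hx : 0 < spaceFormDist κ o x) :
    HasFDerivAt (spaceFormDist κ o)
      ((sinK κ (spaceFormDist κ o x))⁻¹ • fderiv ℝ (potential κ o) x) x := by
  have hF : HasFDerivAt (potential κ o) (fderiv ℝ (potential κ o) x) x :=
    ((contDiff_potential hκ o).differentiable (by simp) x).hasFDerivAt
  have hS := sinK_pos (κ := κ) hx
  rcases hκ.lt_or_eq with h | h
  · have hs : 0 < √(-κ) := Real.sqrt_pos.2 (by linarith)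
    have hs2 : √(-κ) ^ 2 = -κ := Real.sq_sqrt (by linarith)
    have e : spaceFormDist κ o =
        fun x => (√(-κ))⁻¹ * Real.arcosh (1 - κ * potential κ o x) :=
      funext fun x => by rw [spaceFormDist_of_neg h o x, div_eq_inv_mul]
    have hsin := sinK_spaceFormDist_sq hκ o x
    have h1 : (1 - κ * potential κ o x) ^ 2 - 1 =
        (√(-κ) * sinK κ (spaceFormDist κ o x)) ^ 2 := by
      rw [mul_pow, hs2, hsin]; ring
    have h2 : 1 < 1 - κ * potential κ o x := by
      have h3 := one_le_one_sub_mul_potential hκ o x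
      have h4 : 0 < (√(-κ) * sinK κ (spaceFormDist κ o x)) ^ 2 := by positivity
      nlinarith
    have h5 := ((Real.hasDerivAt_arcosh h2).comp_hasFDerivAt x
      ((hF.const_mul κ).const_sub 1)).const_mul (√(-κ))⁻¹
    rw [h1, Real.sqrt_sq (by positivity)] at h5
    rw [e] at hS ⊢
    rw [← e] at hS ⊢
    rw [e]
    refine h5.congr_fderiv ?_
    rw [← e]
    ext u
    simp only [smul_apply, neg_apply, smul_eq_mul]
    have : κ = -√(-κ) ^ 2 := by rw [hs2]; ring
    field_simp
    rw [hs2]; ring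
  · subst h
    have e : spaceFormDist 0 o = fun x => √(2 * potential 0 o x) := by
      ext z
      simp only [spaceFormDist, potential, lt_irrefl, if_false, norm_sub_rev o z]
      rw [mul_div_cancel₀ _ two_ne_zero, Real.sqrt_sq (norm_nonneg _)]
    have h0 : 2 * potential 0 o x ≠ 0 := by
      intro h0
      rw [e] at hx
      simp [h0] at hx
    have h5 := (hF.const_mul 2).sqrt h0
    have hsin : sinK 0 (spaceFormDist 0 o x) = √(2 * potential 0 o x) := by
      rw [e]; simp [sinK]
    rw [hsin, e]
    refine h5.congr_fderiv ?_
    ext u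
    have : √(2 * potential 0 o x) ≠ 0 := by rw [← hsin]; exact hS.ne'
    simp only [smul_apply, smul_eq_mul]
    field_simp

end Potential

/-! ### Immersions into the space form and the Gauss equation -/

section Pullback

set_option maxSynthPendingDepth 3 in
lemma ContDiffAt.clm_flip {X E F G : Type*} [NormedAddCommGroup X] [NormedSpace ℝ X]
    [NormedAddCommGroup E] [NormedSpace ℝ E] [NormedAddCommGroup F] [NormedSpace ℝ F]
    [NormedAddCommGroup G] [NormedSpace ℝ G] {k : WithTop ℕ∞} {f : X → E →L[ℝ] F →L[ℝ] G} {x : X}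
    (hf : ContDiffAt ℝ k f x) : ContDiffAt ℝ k (fun z => (f z).flip) x :=
  (ContinuousLinearMap.flipₗᵢ ℝ E F G).contDiff.contDiffAt.comp x hf

variable {n : ℕ} {κ : ℝ} {E : Type*} [NormedAddCommGroup E] [NormedSpace ℝ E]

/-- The symmetric bilinear form induced at `y` by `Φ : E → 𝕄ⁿ(κ)`. -/
noncomputable def pullbackMetric (κ : ℝ) (Φ : E → SpaceForm n) (y : E) : E →L[ℝ] E →L[ℝ] ℝ :=
  (spaceFormMetric κ (Φ y)).bilinearComp (fderiv ℝ Φ y) (fderiv ℝ Φ y)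

/-- The covariant derivative `∇̄_u (Φ_* v)` in the space form, for constant vector fields
`u`, `v`. -/
noncomputable def covariantHessian (κ : ℝ) (Φ : E → SpaceForm n) (y u v : E) : SpaceForm n :=
  fderiv ℝ (fderiv ℝ Φ) y u v + (κ * pullbackMetric κ Φ y u v) • Φ y

/-- The second fundamental form of `Φ`, as the difference `∇̄_u (Φ_* v) - Φ_* (∇_u v)` with the
Levi-Civita connection `∇` of the induced metric. -/
noncomputable def secondForm (κ : ℝ) (Φ : E → SpaceForm n) (y u v : E) : SpaceForm n :=
  covariantHessian κ Φ y u v - fderiv ℝ Φ y (christoffel (pullbackMetric κ Φ) y u v)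

lemma pullbackMetric_apply (κ : ℝ) (Φ : E → SpaceForm n) (y u v : E) :
    pullbackMetric κ Φ y u v = spaceFormMetric κ (Φ y) (fderiv ℝ Φ y u) (fderiv ℝ Φ y v) := rfl

lemma pullbackMetric_symm (κ : ℝ) (Φ : E → SpaceForm n) (y u v : E) :
    pullbackMetric κ Φ y u v = pullbackMetric κ Φ y v u :=
  spaceFormMetric_symm _ _ _ _

lemma pullbackMetric_pos (hκ : κ ≤ 0) {Φ : E → SpaceForm n} {y : E}
    (hi : Function.Injective (fderiv ℝ Φ y)) (u : E) (hu : u ≠ 0) :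
    0 < pullbackMetric κ Φ y u u :=
  spaceFormMetric_pos hκ _ _ fun h => hu (hi (by rw [map_zero]; exact h))

lemma pullbackMetric_nonneg (hκ : κ ≤ 0) {Φ : E → SpaceForm n} {y : E} (u : E) :
    0 ≤ pullbackMetric κ Φ y u u :=
  spaceFormMetric_nonneg hκ _ _

lemma ContDiffAt.pullbackMetric (hκ : κ ≤ 0) {Φ : E → SpaceForm n} {y : E}
    (hΦ : ContDiffAt ℝ ∞ Φ y) : ContDiffAt ℝ ∞ (pullbackMetric κ Φ) y := by
  have h1 : ContDiffAt ℝ ∞ (fderiv ℝ Φ) y := hΦ.fderiv_right (by simp)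
  have h2 : ContDiffAt ℝ ∞ (fun z => spaceFormMetric κ (Φ z)) y :=
    (contDiff_spaceFormMetric hκ).contDiffAt.comp y hΦ
  have h3 := h2.clm_comp h1
  exact (h3.clm_flip.clm_comp h1).clm_flip

variable {Φ : E → SpaceForm n} {y : E}

lemma ContDiffAt.differentiableAt_fderiv (hΦ : ContDiffAt ℝ ∞ Φ y) :
    DifferentiableAt ℝ (fderiv ℝ Φ) y :=
  (hΦ.fderiv_right (m := ∞) (by simp)).differentiableAt (by simp)

lemma fderiv_fderiv_apply (hΦ : ContDiffAt ℝ ∞ Φ y) (u v : E) :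
    fderiv ℝ (fun z => fderiv ℝ Φ z v) y u = fderiv ℝ (fderiv ℝ Φ) y u v := by
  have := (hΦ.differentiableAt_fderiv.hasFDerivAt.clm_apply (hasFDerivAt_const v y)).fderiv
  rw [this]; simp

lemma fderiv_fderiv_symm (hΦ : ContDiffAt ℝ ∞ Φ y) (u v : E) :
    fderiv ℝ (fderiv ℝ Φ) y u v = fderiv ℝ (fderiv ℝ Φ) y v u :=
  (hΦ.isSymmSndFDerivAt (by simp [ENat.LEInfty.out])) u v

lemma covariantHessian_symm (hΦ : ContDiffAt ℝ ∞ Φ y) (u v : E) :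
    covariantHessian κ Φ y u v = covariantHessian κ Φ y v u := by
  rw [covariantHessian, covariantHessian, fderiv_fderiv_symm hΦ, pullbackMetric_symm]

lemma fderiv_pullbackMetric_apply (hκ : κ ≤ 0) (hΦ : ContDiffAt ℝ ∞ Φ y) (u v w : E) :
    fderiv ℝ (fun z => pullbackMetric κ Φ z v w) y u =
      spaceFormMetric κ (Φ y) (covariantHessian κ Φ y u v) (fderiv ℝ Φ y w) +
        spaceFormMetric κ (Φ y) (fderiv ℝ Φ y v) (covariantHessian κ Φ y u w) := by
  have hd := hΦ.differentiableAt_fderiv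
  have := fderiv_spaceFormMetric hκ (hΦ.differentiableAt (by simp))
    (u := fun z => fderiv ℝ Φ z v) (v := fun z => fderiv ℝ Φ z w)
    (hd.clm_apply (differentiableAt_const v)) (hd.clm_apply (differentiableAt_const w)) u
  rw [fderiv_fderiv_apply hΦ, fderiv_fderiv_apply hΦ] at this
  exact this

lemma fderiv_pullbackMetric (hκ : κ ≤ 0) (hΦ : ContDiffAt ℝ ∞ Φ y) (u v w : E) :
    fderiv ℝ (pullbackMetric κ Φ) y u v w =
      spaceFormMetric κ (Φ y) (covariantHessian κ Φ y u v) (fderiv ℝ Φ y w) +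
        spaceFormMetric κ (Φ y) (fderiv ℝ Φ y v) (covariantHessian κ Φ y u w) := by
  rw [← fderiv_pullbackMetric_apply hκ hΦ]
  have hd : DifferentiableAt ℝ (pullbackMetric κ Φ) y :=
    (hΦ.pullbackMetric hκ).differentiableAt (by simp)
  have := ((hd.hasFDerivAt.clm_apply (hasFDerivAt_const v y)).clm_apply
    (hasFDerivAt_const w y)).fderiv
  rw [this]; simp

/-- The Koszul formula for an induced metric. -/
lemma christoffelFirst_pullbackMetric (hκ : κ ≤ 0) (hΦ : ContDiffAt ℝ ∞ Φ y) (u v w : E) :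
    christoffelFirst (pullbackMetric κ Φ) y u v w =
      spaceFormMetric κ (Φ y) (covariantHessian κ Φ y u v) (fderiv ℝ Φ y w) := by
  simp only [christoffelFirst, smul_apply, add_apply, sub_apply, ContinuousLinearMap.flip_apply,
    fderiv_pullbackMetric hκ hΦ, smul_eq_mul]
  rw [covariantHessian_symm hΦ v u, covariantHessian_symm hΦ w u, covariantHessian_symm hΦ w v,
    spaceFormMetric_symm κ (Φ y) (fderiv ℝ Φ y u), spaceFormMetric_symm κ (Φ y) (fderiv ℝ Φ y v)]
  ring

variable [FiniteDimensional ℝ E]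

lemma pullbackMetric_christoffel (hκ : κ ≤ 0) (hΦ : ContDiffAt ℝ ∞ Φ y)
    (hi : Function.Injective (fderiv ℝ Φ y)) (u v w : E) :
    pullbackMetric κ Φ y (christoffel (pullbackMetric κ Φ) y u v) w =
      spaceFormMetric κ (Φ y) (covariantHessian κ Φ y u v) (fderiv ℝ Φ y w) := by
  rw [christoffel, apply_rieszVector (pullbackMetric_pos hκ hi),
    christoffelFirst_pullbackMetric hκ hΦ]

/-- The second fundamental form is normal to the immersion. -/
lemma spaceFormMetric_secondForm (hκ : κ ≤ 0) (hΦ : ContDiffAt ℝ ∞ Φ y)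
    (hi : Function.Injective (fderiv ℝ Φ y)) (u v w : E) :
    spaceFormMetric κ (Φ y) (secondForm κ Φ y u v) (fderiv ℝ Φ y w) = 0 := by
  have := pullbackMetric_christoffel hκ hΦ hi u v w
  rw [pullbackMetric_apply] at this
  rw [secondForm, map_sub, sub_apply, this, sub_self]

set_option maxSynthPendingDepth 3 in
lemma differentiableAt_christoffel {G : E → E →L[ℝ] E →L[ℝ] ℝ} (hG : ContDiffAt ℝ ∞ G y)
    (hpos : ∀ v, v ≠ 0 → 0 < G y v v) (u v : E) :
    DifferentiableAt ℝ (fun z => christoffel G z u v) y := by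
  have h1 : ContDiffAt ℝ ∞ (fun z => (G z).inverse) y :=
    (isInvertible_of_pos hpos).contDiffAt_map_inverse.comp y hG
  have h2 : ContDiffAt ℝ ∞ (fderiv ℝ G) y := hG.fderiv_right (by simp)
  have h3 : ∀ a b : E, ContDiffAt ℝ ∞ (fun z => fderiv ℝ G z a b) y := fun a b =>
    (h2.clm_apply contDiffAt_const).clm_apply contDiffAt_const
  have h4 : ContDiffAt ℝ ∞ (fun z => ((fderiv ℝ G z).flip u).flip v) y :=
    (h2.clm_flip.clm_apply contDiffAt_const).clm_flip.clm_apply contDiffAt_const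
  have h6 : ContDiffAt ℝ ∞ (fun z => christoffelFirst G z u v) y :=
    (contDiffAt_const (c := (1 / 2 : ℝ))).smul (((h3 u v).add (h3 v u)).sub h4)
  exact (h1.clm_apply h6).differentiableAt (by simp)

/-- Half of the Gauss equation, before antisymmetrization in `u` and `v`. -/
lemma pullbackMetric_fderiv_christoffel (hκ : κ ≤ 0) (hev : ∀ᶠ z in 𝓝 y, ContDiffAt ℝ ∞ Φ z)
    (hi : ∀ᶠ z in 𝓝 y, Function.Injective (fderiv ℝ Φ z)) (u v w c : E) :
    pullbackMetric κ Φ y (fderiv ℝ (fun z => christoffel (pullbackMetric κ Φ) z v w) y u +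
        christoffel (pullbackMetric κ Φ) y u (christoffel (pullbackMetric κ Φ) y v w)) c =
      spaceFormMetric κ (Φ y) (fderiv ℝ (fderiv ℝ (fun z => fderiv ℝ Φ z w)) y u v)
          (fderiv ℝ Φ y c) +
        κ * (spaceFormMetric κ (Φ y) (covariantHessian κ Φ y u v) (fderiv ℝ Φ y w) +
          spaceFormMetric κ (Φ y) (fderiv ℝ Φ y v) (covariantHessian κ Φ y u w) +
          spaceFormMetric κ (Φ y) (fderiv ℝ Φ y u) (covariantHessian κ Φ y v w)) *
          spaceFormMetric κ (Φ y) (Φ y) (fderiv ℝ Φ y c) +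
        κ * pullbackMetric κ Φ y v w * pullbackMetric κ Φ y u c +
        spaceFormMetric κ (Φ y) (secondForm κ Φ y v w) (secondForm κ Φ y u c) := by
  have hy := hi.self_of_nhds
  have hΦ := hev.self_of_nhds
  have hd := hΦ.differentiableAt_fderiv
  have hΦd := hΦ.differentiableAt (n := ∞) (by simp)
  have hG := hΦ.pullbackMetric hκ
  have hΨ : ContDiffAt ℝ ∞ (fun z => fderiv ℝ Φ z w) y :=
    (hΦ.fderiv_right (m := ∞) (by simp)).clm_apply contDiffAt_const
  have hΓ := differentiableAt_christoffel hG (pullbackMetric_pos hκ hy) v w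
  have hc := hd.clm_apply (differentiableAt_const c)
  have heq : (fun z => spaceFormMetric κ (Φ z)
        (fderiv ℝ Φ z (christoffel (pullbackMetric κ Φ) z v w)) (fderiv ℝ Φ z c)) =ᶠ[𝓝 y]
      fun z => spaceFormMetric κ (Φ z) (covariantHessian κ Φ z v w) (fderiv ℝ Φ z c) := by
    filter_upwards [hev, hi] with z hz hiz
    exact pullbackMetric_christoffel hκ hz hiz v w c
  have e1 : fderiv ℝ (fun z => fderiv ℝ Φ z (christoffel (pullbackMetric κ Φ) z v w)) y u =
      fderiv ℝ (fderiv ℝ Φ) y u (christoffel (pullbackMetric κ Φ) y v w) +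
        fderiv ℝ Φ y (fderiv ℝ (fun z => christoffel (pullbackMetric κ Φ) z v w) y u) := by
    rw [(hd.hasFDerivAt.clm_apply hΓ.hasFDerivAt).fderiv]
    simp [add_comm]
  have hcov : (fun z => covariantHessian κ Φ z v w) =ᶠ[𝓝 y] fun z =>
      fderiv ℝ (fun z => fderiv ℝ Φ z w) z v + (κ * pullbackMetric κ Φ z v w) • Φ z := by
    filter_upwards [hev] with z hz
    rw [covariantHessian, fderiv_fderiv_apply hz]
  have hGd : DifferentiableAt ℝ (fun z => pullbackMetric κ Φ z v w) y :=
    ((hG.clm_apply contDiffAt_const).clm_apply contDiffAt_const).differentiableAt (by simp)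
  have hA := ((hΨ.differentiableAt_fderiv.hasFDerivAt.clm_apply (hasFDerivAt_const v y)).add
    ((hGd.hasFDerivAt.const_mul κ).smul hΦd.hasFDerivAt)).congr_of_eventuallyEq hcov
  have e2 : fderiv ℝ (fun z => covariantHessian κ Φ z v w) y u =
      fderiv ℝ (fderiv ℝ (fun z => fderiv ℝ Φ z w)) y u v +
        ((κ * pullbackMetric κ Φ y v w) • fderiv ℝ Φ y u +
          (κ * fderiv ℝ (fun z => pullbackMetric κ Φ z v w) y u) • Φ y) := by
    rw [hA.fderiv]; simp
  have key := congrArg (fun L : E →L[ℝ] ℝ => L u) heq.fderiv_eq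
  rw [fderiv_spaceFormMetric hκ hΦd (hd.clm_apply hΓ) hc, fderiv_spaceFormMetric hκ hΦd
    hA.differentiableAt hc, e1, e2, fderiv_fderiv_apply hΦ, fderiv_pullbackMetric_apply hκ hΦ] at key
  have e3 := pullbackMetric_christoffel hκ hΦ hy u (christoffel (pullbackMetric κ Φ) y v w) c
  have e4 := spaceFormMetric_secondForm hκ hΦ hy v w (christoffel (pullbackMetric κ Φ) y u c)
  have e5 : spaceFormMetric κ (Φ y) (secondForm κ Φ y v w) (secondForm κ Φ y u c) =
      spaceFormMetric κ (Φ y) (secondForm κ Φ y v w) (covariantHessian κ Φ y u c) := by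
    conv_lhs => rw [secondForm.eq_def κ Φ y u c, map_sub, e4, sub_zero]
  rw [e5, map_add, add_apply, e3]
  simp only [secondForm, covariantHessian, pullbackMetric_apply, map_add, map_sub, add_apply,
    sub_apply, map_smul, smul_apply, smul_eq_mul] at key ⊢
  linear_combination key

/-- The Gauss equation for an immersion into the space form of curvature `κ`. -/
lemma pullbackMetric_riemannCurvature (hκ : κ ≤ 0) (hev : ∀ᶠ z in 𝓝 y, ContDiffAt ℝ ∞ Φ z)
    (hi : ∀ᶠ z in 𝓝 y, Function.Injective (fderiv ℝ Φ z)) (u v w c : E) :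
    pullbackMetric κ Φ y (riemannCurvature (pullbackMetric κ Φ) y u v w) c =
      κ * (pullbackMetric κ Φ y v w * pullbackMetric κ Φ y u c -
          pullbackMetric κ Φ y u w * pullbackMetric κ Φ y v c) +
        (spaceFormMetric κ (Φ y) (secondForm κ Φ y v w) (secondForm κ Φ y u c) -
          spaceFormMetric κ (Φ y) (secondForm κ Φ y u w) (secondForm κ Φ y v c)) := by
  have hΦ := hev.self_of_nhds
  have h1 := pullbackMetric_fderiv_christoffel hκ hev hi u v w c
  have h2 := pullbackMetric_fderiv_christoffel hκ hev hi v u w c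
  have hΨ : ContDiffAt ℝ ∞ (fun z => fderiv ℝ Φ z w) y :=
    (hΦ.fderiv_right (m := ∞) (by simp)).clm_apply contDiffAt_const
  rw [fderiv_fderiv_symm hΨ v u, covariantHessian_symm hΦ v u] at h2
  simp only [riemannCurvature, map_add, map_sub, add_apply, sub_apply] at h1 h2 ⊢
  linear_combination h1 - h2

end Pullback

/-! ### The potential along an immersion -/

section PotentialAlong

variable {n : ℕ} {κ : ℝ} {E : Type*} [NormedAddCommGroup E] [NormedSpace ℝ E]
  {Φ : E → SpaceForm n} {y : E}

lemma fderiv_potential_comp (hκ : κ ≤ 0) (o : SpaceForm n) (hΦ : DifferentiableAt ℝ Φ y) (u : E) :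
    fderiv ℝ (fun z => potential κ o (Φ z)) y u =
      spaceFormMetric κ (Φ y) (gradPotential κ o (Φ y)) (fderiv ℝ Φ y u) := by
  have h := ((contDiff_potential hκ o).differentiable (by simp) (Φ y)).hasFDerivAt.comp y
    hΦ.hasFDerivAt
  rw [(show HasFDerivAt (fun z => potential κ o (Φ z)) _ y from h).fderiv]
  simp [fderiv_potential hκ]

/-- The Hessian of the potential in the space form is `C_κ(r)` times the metric; for an immersion
this gives the second derivative of the potential along it. -/
lemma fderiv_fderiv_potential_comp (hκ : κ ≤ 0) (o : SpaceForm n) (hΦ : ContDiffAt ℝ ∞ Φ y)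
    (u v : E) :
    fderiv ℝ (fderiv ℝ fun z => potential κ o (Φ z)) y u v =
      (1 - κ * potential κ o (Φ y)) * pullbackMetric κ Φ y u v +
        spaceFormMetric κ (Φ y) (gradPotential κ o (Φ y)) (covariantHessian κ Φ y u v) := by
  have hf : ContDiffAt ℝ ∞ (fun z => potential κ o (Φ z)) y :=
    (contDiff_potential hκ o).contDiffAt.comp y hΦ
  have hΦd := hΦ.differentiableAt (n := ∞) (by simp)
  have h1 : fderiv ℝ (fun z => fderiv ℝ (fun z => potential κ o (Φ z)) z v) y u =
      fderiv ℝ (fderiv ℝ fun z => potential κ o (Φ z)) y u v := by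
    have hd : DifferentiableAt ℝ (fderiv ℝ fun z => potential κ o (Φ z)) y :=
      (hf.fderiv_right (m := ∞) (by simp)).differentiableAt (by simp)
    have := (hd.hasFDerivAt.clm_apply (hasFDerivAt_const v y)).fderiv
    rw [this]; simp
  have h2 : (fun z => fderiv ℝ (fun z => potential κ o (Φ z)) z v) =ᶠ[𝓝 y] fun z =>
      spaceFormMetric κ (Φ z) (gradPotential κ o (Φ z)) (fderiv ℝ Φ z v) := by
    filter_upwards [(hΦ.of_le (m := 1) (by simp)).eventually (by simp)] with z hz
    exact fderiv_potential_comp hκ o (hz.differentiableAt (by simp)) v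
  have hfd : HasFDerivAt (fun z => potential κ o (Φ z))
      (fderiv ℝ (fun z => potential κ o (Φ z)) y) y :=
    (hf.differentiableAt (by simp)).hasFDerivAt
  have hb := (((hfd.const_mul κ).const_sub 1).smul hΦd.hasFDerivAt).sub_const o
  have hb' : fderiv ℝ (fun z => gradPotential κ o (Φ z)) y u =
      (1 - κ * potential κ o (Φ y)) • fderiv ℝ Φ y u -
        (κ * spaceFormMetric κ (Φ y) (gradPotential κ o (Φ y)) (fderiv ℝ Φ y u)) • Φ y := by
    rw [(show HasFDerivAt (fun z => gradPotential κ o (Φ z)) _ y from hb).fderiv]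
    simp [fderiv_potential_comp hκ o hΦd, sub_eq_add_neg]
  rw [← h1, h2.fderiv_eq, fderiv_spaceFormMetric hκ hΦd
    (show HasFDerivAt (fun z => gradPotential κ o (Φ z)) _ y from hb).differentiableAt
    (hΦ.differentiableAt_fderiv.clm_apply (differentiableAt_const v)), hb', fderiv_fderiv_apply hΦ,
    spaceFormMetric_symm κ (Φ y) (fderiv ℝ Φ y u) (gradPotential κ o (Φ y))]
  simp only [sub_add_cancel, map_smul, smul_apply, smul_eq_mul, covariantHessian,
    pullbackMetric_apply]

end PotentialAlong

/-! ### The Hilbert–Schmidt norm of a vector-valued bilinear form -/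

section HilbertSchmidt

variable {T V : Type*} [NormedAddCommGroup T] [InnerProductSpace ℝ T]
  [NormedAddCommGroup V] [NormedSpace ℝ V] {ι ι' : Type*} [Fintype ι] [Fintype ι']

lemma OrthonormalBasis.sum_bilin_apply_eq (e : OrthonormalBasis ι ℝ T) (f : OrthonormalBasis ι' ℝ T)
    (B : V →L[ℝ] V →L[ℝ] ℝ) (L : T →ₗ[ℝ] V) :
    ∑ i, B (L (e i)) (L (e i)) = ∑ a, B (L (f a)) (L (f a)) := by
  calc ∑ i, B (L (e i)) (L (e i))
      = ∑ i, ∑ a, inner ℝ (f a) (e i) * B (L (e i)) (L (f a)) := by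
        refine Finset.sum_congr rfl fun i _ => ?_
        conv_lhs => enter [2]; rw [← f.sum_repr' (e i), map_sum]
        simp only [map_sum, map_smul, smul_eq_mul]
    _ = ∑ a, ∑ i, inner ℝ (e i) (f a) * B (L (e i)) (L (f a)) := by
        rw [Finset.sum_comm]
        simp only [real_inner_comm]
    _ = ∑ a, B (L (f a)) (L (f a)) := by
        refine Finset.sum_congr rfl fun a _ => ?_
        conv_rhs => enter [1]; rw [← e.sum_repr' (f a), map_sum, map_sum]
        simp only [sum_apply, map_smul, smul_apply, smul_eq_mul]

/-- The Hilbert–Schmidt norm does not depend on the orthonormal basis, so it dominates the sum over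
any finite orthonormal set. -/
lemma OrthonormalBasis.sum_bilin_le (e : OrthonormalBasis ι ℝ T) {B : V →L[ℝ] V →L[ℝ] ℝ}
    (hB : ∀ v, 0 ≤ B v v) (L : T →ₗ[ℝ] T →ₗ[ℝ] V) (s : Finset T)
    (hs : Orthonormal ℝ (Subtype.val : ↥(s : Set T) → T)) :
    ∑ u ∈ s, ∑ v ∈ s, B (L u v) (L u v) ≤ ∑ i, ∑ j, B (L (e i) (e j)) (L (e i) (e j)) := by
  have : FiniteDimensional ℝ T := e.toBasis.finiteDimensional_of_finite
  obtain ⟨t, b, hst, hb⟩ := hs.exists_orthonormalBasis_extension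
  have h1 : ∑ i, ∑ j, B (L (e i) (e j)) (L (e i) (e j)) =
      ∑ a, ∑ c, B (L (b a) (b c)) (L (b a) (b c)) := by
    calc ∑ i, ∑ j, B (L (e i) (e j)) (L (e i) (e j))
        = ∑ i, ∑ c, B (L (e i) (b c)) (L (e i) (b c)) :=
          Finset.sum_congr rfl fun i _ => e.sum_bilin_apply_eq b B (L (e i))
      _ = ∑ c, ∑ i, B (L (e i) (b c)) (L (e i) (b c)) := Finset.sum_comm
      _ = ∑ c, ∑ a, B (L (b a) (b c)) (L (b a) (b c)) :=
          Finset.sum_congr rfl fun c _ => e.sum_bilin_apply_eq b B (L.flip (b c))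
      _ = _ := Finset.sum_comm
  rw [h1, hb]
  have hst' : s ⊆ t := by exact_mod_cast hst
  rw [Finset.sum_coe_sort t fun u => ∑ c : t, B (L u c) (L u c)]
  have h2 : ∀ w, ∑ c : t, B (L w c) (L w c) = ∑ v ∈ t, B (L w v) (L w v) := fun w =>
    Finset.sum_coe_sort t fun v => B (L w v) (L w v)
  simp only [h2]
  calc ∑ u ∈ s, ∑ v ∈ s, B (L u v) (L u v)
      ≤ ∑ u ∈ s, ∑ v ∈ t, B (L u v) (L u v) :=
        Finset.sum_le_sum fun u _ =>
          Finset.sum_le_sum_of_subset_of_nonneg hst' fun _ _ _ => hB _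
    _ ≤ _ := Finset.sum_le_sum_of_subset_of_nonneg hst' fun _ _ _ =>
        Finset.sum_nonneg fun _ _ => hB _

/-- On the diagonal, a bilinear map is bounded by its Hilbert–Schmidt norm. -/
lemma OrthonormalBasis.bilin_apply_le (e : OrthonormalBasis ι ℝ T) {B : V →L[ℝ] V →L[ℝ] ℝ}
    (hB : ∀ v, 0 ≤ B v v) (L : T →ₗ[ℝ] T →ₗ[ℝ] V) (u : T) :
    B (L u u) (L u u) ≤ ‖u‖ ^ 4 * ∑ i, ∑ j, B (L (e i) (e j)) (L (e i) (e j)) := by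
  classical
  rcases eq_or_ne u 0 with rfl | hu
  · simp
  have hn : ‖u‖ ≠ 0 := norm_ne_zero_iff.2 hu
  have h1 : ‖(‖u‖⁻¹ • u : T)‖ = 1 := by rw [norm_smul, norm_inv, norm_norm, inv_mul_cancel₀ hn]
  have h2 := e.sum_bilin_le hB L {‖u‖⁻¹ • u} (by
    rw [orthonormal_iff_ite]
    rintro ⟨a, ha⟩ ⟨b, hb⟩
    simp only [Finset.coe_singleton, mem_singleton_iff] at ha hb
    subst ha hb
    simp [h1])
  simp only [Finset.sum_singleton] at h2
  have h3 : u = ‖u‖ • (‖u‖⁻¹ • u) := by rw [smul_smul, mul_inv_cancel₀ hn, one_smul]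
  calc B (L u u) (L u u)
      = ‖u‖ ^ 4 * B (L (‖u‖⁻¹ • u) (‖u‖⁻¹ • u)) (L (‖u‖⁻¹ • u) (‖u‖⁻¹ • u)) := by
        conv_lhs => rw [h3]
        simp only [LinearMap.smul_apply, map_smul, smul_apply, smul_eq_mul]
        ring
    _ ≤ _ := mul_le_mul_of_nonneg_left h2 (by positivity)

lemma OrthonormalBasis.bilin_pair_le (e : OrthonormalBasis ι ℝ T) {B : V →L[ℝ] V →L[ℝ] ℝ}
    (hB : ∀ v, 0 ≤ B v v) (L : T →ₗ[ℝ] T →ₗ[ℝ] V) {u v : T} (hu : inner ℝ u u = 1)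
    (hv : inner ℝ v v = 1) (huv : inner ℝ u v = 0) :
    B (L u u) (L u u) + B (L u v) (L u v) + (B (L v u) (L v u) + B (L v v) (L v v)) ≤
      ∑ i, ∑ j, B (L (e i) (e j)) (L (e i) (e j)) := by
  classical
  have hu' : ‖u‖ = 1 := by rw [norm_eq_sqrt_real_inner, hu, Real.sqrt_one]
  have hv' : ‖v‖ = 1 := by rw [norm_eq_sqrt_real_inner, hv, Real.sqrt_one]
  have hne : u ≠ v := by rintro rfl; rw [hu] at huv; exact one_ne_zero huv
  have h2 := e.sum_bilin_le hB L {u, v} (by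
    rw [orthonormal_iff_ite]
    rintro ⟨a, ha⟩ ⟨b, hb⟩
    simp only [Finset.coe_insert, Finset.coe_singleton, mem_insert_iff, mem_singleton_iff] at ha hb
    have huv' : inner ℝ v u = 0 := by rw [real_inner_comm]; exact huv
    rcases ha with rfl | rfl <;> rcases hb with rfl | rfl <;>
      simp [hu', hv', huv, huv', hne, hne.symm])
  simpa only [Finset.sum_pair hne] using h2

end HilbertSchmidt

/-! ### The second fundamental form at a point -/

section Tangent

variable {m n : ℕ} {κ : ℝ} {M : Type*} [MetricSpace M] [ChartedSpace (EuclideanSpace ℝ (Fin m)) M]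

instance finiteDimensional_tangentSpace_euclidean (p : M) :
    FiniteDimensional ℝ (TangentSpace (𝓡 m) p) :=
  inferInstanceAs (FiniteDimensional ℝ (EuclideanSpace ℝ (Fin m)))

/-- The identification of `ℝᵐ` with `T_p M` given by the preferred chart at `p`. -/
noncomputable def toTangent (p : M) : EuclideanSpace ℝ (Fin m) ≃L[ℝ] TangentSpace (𝓡 m) p :=
  ContinuousLinearEquiv.refl ℝ (EuclideanSpace ℝ (Fin m))

/-- The immersion `φ` read in the preferred chart at `p`. -/
noncomputable def chartMap (m : ℕ) {n : ℕ} {M : Type*} [MetricSpace M]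
    [ChartedSpace (EuclideanSpace ℝ (Fin m)) M] (φ : M → SpaceForm n) (p : M) :
    EuclideanSpace ℝ (Fin m) → SpaceForm n :=
  φ ∘ (extChartAt (𝓡 m) p).symm

lemma contDiffAt_chartMap [IsManifold (𝓡 m) ∞ M] {φ : M → SpaceForm n}
    (hφ : ContMDiff (𝓡 m) 𝓘(ℝ, SpaceForm n) ∞ φ) (p : M) {z : EuclideanSpace ℝ (Fin m)}
    (hz : z ∈ (extChartAt (𝓡 m) p).target) : ContDiffAt ℝ ∞ (chartMap m φ p) z := by
  have h1 : ContMDiffOn 𝓘(ℝ, EuclideanSpace ℝ (Fin m)) 𝓘(ℝ, SpaceForm n) ∞ (chartMap m φ p)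
      (extChartAt (𝓡 m) p).target :=
    hφ.comp_contMDiffOn (contMDiffOn_extChartAt_symm p)
  rw [contMDiffOn_iff_contDiffOn] at h1
  exact h1.contDiffAt ((isOpen_extChartAt_target p).mem_nhds hz)

lemma chartMap_apply_self (φ : M → SpaceForm n) (p : M) :
    chartMap m φ p (extChartAt (𝓡 m) p p) = φ p := by
  simp [chartMap]

lemma eventually_contDiffAt_chartMap [IsManifold (𝓡 m) ∞ M] {φ : M → SpaceForm n}
    (hφ : ContMDiff (𝓡 m) 𝓘(ℝ, SpaceForm n) ∞ φ) (p : M) :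
    ∀ᶠ z in 𝓝 (extChartAt (𝓡 m) p p), ContDiffAt ℝ ∞ (chartMap m φ p) z := by
  filter_upwards [(isOpen_extChartAt_target p).mem_nhds (mem_extChartAt_target p)] with z hz
  exact contDiffAt_chartMap hφ p hz

/-- The differential at `p` is the derivative in the preferred chart at `p`. -/
lemma pushforward_toTangent {φ : M → SpaceForm n}
    (hφ : ContMDiff (𝓡 m) 𝓘(ℝ, SpaceForm n) ∞ φ) (p : M) (u : EuclideanSpace ℝ (Fin m)) :
    pushforward m φ p (toTangent p u) = fderiv ℝ (chartMap m φ p) (extChartAt (𝓡 m) p p) u := by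
  have h : MDifferentiableAt (𝓡 m) 𝓘(ℝ, SpaceForm n) φ p := hφ.mdifferentiableAt (by simp)
  have h1 : pushforward m φ p = fderivWithin ℝ (writtenInExtChartAt (𝓡 m) 𝓘(ℝ, SpaceForm n) p φ)
      (range (𝓡 m)) (extChartAt (𝓡 m) p p) := if_pos h
  have h2 : fderivWithin ℝ (writtenInExtChartAt (𝓡 m) 𝓘(ℝ, SpaceForm n) p φ)
      (range (𝓡 m)) (extChartAt (𝓡 m) p p) =
        fderiv ℝ (chartMap m φ p) (extChartAt (𝓡 m) p p) := by
    simp only [writtenInExtChartAt, extChartAt_model_space_eq_id, modelWithCornersSelf_coe,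
      range_id, fderivWithin_univ]
    rfl
  rw [h2] at h1
  exact DFunLike.congr_fun h1 u

variable [RiemannianBundle (fun x : M => TangentSpace (𝓡 m) x)]

lemma tangentMetric_pos (p : M) (v : TangentSpace (𝓡 m) p) (hv : v ≠ 0) :
    0 < tangentMetric m p v v := by
  change 0 < inner ℝ v v
  exact real_inner_self_pos.2 hv

lemma inner_tangentRiesz (p : M) (L : TangentSpace (𝓡 m) p →L[ℝ] ℝ)
    (v : TangentSpace (𝓡 m) p) : inner ℝ (tangentRiesz m p L) v = L v :=
  apply_rieszVector (E := TangentSpace (𝓡 m) p) (tangentMetric_pos p) L v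

/-- The tangential component of `w`, as a vector of `T_p M`. -/
noncomputable def tangentPart (m : ℕ) {n : ℕ} {M : Type*} [MetricSpace M]
    [ChartedSpace (EuclideanSpace ℝ (Fin m)) M]
    [RiemannianBundle (fun x : M => TangentSpace (𝓡 m) x)] (κ : ℝ) (φ : M → SpaceForm n) (p : M)
    (w : SpaceForm n) : TangentSpace (𝓡 m) p :=
  tangentRiesz m p ((spaceFormMetric κ (φ p) w).comp (pushforward m φ p))

lemma normalPart_eq (φ : M → SpaceForm n) (p : M) (w : SpaceForm n) :
    normalPart m κ φ p w = w - pushforward m φ p (tangentPart m κ φ p w) := rfl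

lemma inner_tangentPart (φ : M → SpaceForm n) (p : M) (w : SpaceForm n)
    (v : TangentSpace (𝓡 m) p) :
    inner ℝ (tangentPart m κ φ p w) v = spaceFormMetric κ (φ p) w (pushforward m φ p v) :=
  inner_tangentRiesz p _ v

variable {φ : M → SpaceForm n}

lemma spaceFormMetric_normalPart_pushforward (hφ : IsIsometricImmersion m κ φ) (p : M)
    (w : SpaceForm n) (v : TangentSpace (𝓡 m) p) :
    spaceFormMetric κ (φ p) (normalPart m κ φ p w) (pushforward m φ p v) = 0 := by
  rw [normalPart_eq, map_sub, sub_apply, hφ.isometric, inner_tangentPart, sub_self]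

lemma spaceFormMetric_normalPart_normalPart (hφ : IsIsometricImmersion m κ φ) (p : M)
    (w w' : SpaceForm n) :
    spaceFormMetric κ (φ p) (normalPart m κ φ p w) (normalPart m κ φ p w') =
      spaceFormMetric κ (φ p) (normalPart m κ φ p w) w' := by
  rw [normalPart_eq φ p w', map_sub, spaceFormMetric_normalPart_pushforward hφ, sub_zero]

lemma spaceFormMetric_self_eq (hφ : IsIsometricImmersion m κ φ) (p : M) (w : SpaceForm n) :
    spaceFormMetric κ (φ p) w w =
      spaceFormMetric κ (φ p) (normalPart m κ φ p w) (normalPart m κ φ p w) +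
        ‖tangentPart m κ φ p w‖ ^ 2 := by
  rw [spaceFormMetric_normalPart_normalPart hφ, normalPart_eq, map_sub, sub_apply,
    spaceFormMetric_symm κ (φ p) (pushforward m φ p (tangentPart m κ φ p w)) w,
    ← inner_tangentPart, real_inner_self_eq_norm_sq]
  ring

lemma normalPart_pushforward (hφ : IsIsometricImmersion m κ φ) (p : M)
    (v : TangentSpace (𝓡 m) p) : normalPart m κ φ p (pushforward m φ p v) = 0 := by
  have : tangentPart m κ φ p (pushforward m φ p v) = v := by
    refine ext_inner_right ℝ fun u => ?_
    rw [inner_tangentPart, hφ.isometric]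
  rw [normalPart_eq, this, sub_self]

lemma normalPart_add (p : M) (w w' : SpaceForm n) :
    normalPart m κ φ p (w + w') = normalPart m κ φ p w + normalPart m κ φ p w' := by
  have : tangentPart m κ φ p (w + w') = tangentPart m κ φ p w + tangentPart m κ φ p w' := by
    refine ext_inner_right ℝ fun u => ?_
    rw [inner_add_left, inner_tangentPart, inner_tangentPart, inner_tangentPart, map_add, add_apply]
  rw [normalPart_eq, this, map_add, normalPart_eq, normalPart_eq]
  abel

lemma normalPart_smul (p : M) (c : ℝ) (w : SpaceForm n) :
    normalPart m κ φ p (c • w) = c • normalPart m κ φ p w := by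
  have : tangentPart m κ φ p (c • w) = c • tangentPart m κ φ p w := by
    refine ext_inner_right ℝ fun u => ?_
    rw [real_inner_smul_left, inner_tangentPart, inner_tangentPart, map_smul, smul_apply,
      smul_eq_mul]
  rw [normalPart_eq, this, map_smul, normalPart_eq, smul_sub]

lemma pullbackMetric_chartMap (hφ : IsIsometricImmersion m κ φ) (p : M)
    (u v : EuclideanSpace ℝ (Fin m)) :
    pullbackMetric κ (chartMap m φ p) (extChartAt (𝓡 m) p p) u v =
      inner ℝ (toTangent p u) (toTangent p v) := by
  rw [pullbackMetric_apply, chartMap_apply_self, ← hφ.isometric, pushforward_toTangent hφ.contMDiff,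
    pushforward_toTangent hφ.contMDiff]

lemma secondFundamentalForm_toTangent (hκ : κ ≤ 0) (hφ : IsIsometricImmersion m κ φ) (p : M)
    (u v : EuclideanSpace ℝ (Fin m)) :
    secondFundamentalForm m κ φ p (toTangent p u) (toTangent p v) =
      normalPart m κ φ p (covariantHessian κ (chartMap m φ p) (extChartAt (𝓡 m) p p) u v) := by
  have h1 : secondFundamentalForm m κ φ p (toTangent p u) (toTangent p v) = normalPart m κ φ p
      (fderiv ℝ (fderiv ℝ (chartMap m φ p)) (extChartAt (𝓡 m) p p) u v
      + christoffel (spaceFormMetric κ) (φ p) (pushforward m φ p (toTangent p u))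
        (pushforward m φ p (toTangent p v))) := rfl
  rw [h1, christoffel_spaceFormMetric hκ, covariantHessian,
    pullbackMetric_apply, chartMap_apply_self, pushforward_toTangent hφ.contMDiff,
    pushforward_toTangent hφ.contMDiff]

/-- The second fundamental form as a bilinear map. -/
noncomputable def secondFundamentalFormBilin (hκ : κ ≤ 0) (hφ : IsIsometricImmersion m κ φ)
    (p : M) : TangentSpace (𝓡 m) p →ₗ[ℝ] TangentSpace (𝓡 m) p →ₗ[ℝ] SpaceForm n :=
  LinearMap.mk₂ ℝ (secondFundamentalForm m κ φ p)
    (fun u u' v => by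
      obtain ⟨u, rfl⟩ := (toTangent p).surjective u
      obtain ⟨u', rfl⟩ := (toTangent p).surjective u'
      obtain ⟨v, rfl⟩ := (toTangent p).surjective v
      rw [← map_add]
      simp only [secondFundamentalForm_toTangent hκ hφ]
      simp only [covariantHessian, normalPart_add, map_add,
        add_apply, mul_add, add_smul]
      abel)
    (fun c u v => by
      obtain ⟨u, rfl⟩ := (toTangent p).surjective u
      obtain ⟨v, rfl⟩ := (toTangent p).surjective v
      rw [← map_smul]
      simp only [secondFundamentalForm_toTangent hκ hφ]
      simp only [covariantHessian, normalPart_add, map_smul,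
        smul_apply, normalPart_smul, smul_eq_mul, mul_left_comm κ c, mul_smul, smul_add])
    (fun u v v' => by
      obtain ⟨u, rfl⟩ := (toTangent p).surjective u
      obtain ⟨v, rfl⟩ := (toTangent p).surjective v
      obtain ⟨v', rfl⟩ := (toTangent p).surjective v'
      rw [← map_add]
      simp only [secondFundamentalForm_toTangent hκ hφ]
      simp only [covariantHessian, normalPart_add, map_add,
        mul_add, add_smul]
      abel)
    (fun c u v => by
      obtain ⟨u, rfl⟩ := (toTangent p).surjective u
      obtain ⟨v, rfl⟩ := (toTangent p).surjective v
      rw [← map_smul]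
      simp only [secondFundamentalForm_toTangent hκ hφ]
      simp only [covariantHessian, normalPart_add, map_smul,
        normalPart_smul, smul_eq_mul, mul_left_comm κ c, mul_smul, smul_add])

lemma alphaNorm_sq (hκ : κ ≤ 0) (p : M) :
    alphaNorm m κ φ p ^ 2 =
      ∑ i, ∑ j, spaceFormMetric κ (φ p)
        (secondFundamentalForm m κ φ p (stdOrthonormalBasis ℝ (TangentSpace (𝓡 m) p) i)
          (stdOrthonormalBasis ℝ (TangentSpace (𝓡 m) p) j))
        (secondFundamentalForm m κ φ p (stdOrthonormalBasis ℝ (TangentSpace (𝓡 m) p) i)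
          (stdOrthonormalBasis ℝ (TangentSpace (𝓡 m) p) j)) := by
  rw [alphaNorm,
    Real.sq_sqrt (Finset.sum_nonneg fun _ _ => Finset.sum_nonneg fun _ _ => sq_nonneg _)]
  simp only [spaceFormNorm_sq hκ]

lemma alphaNorm_nonneg (p : M) : 0 ≤ alphaNorm m κ φ p := Real.sqrt_nonneg _

lemma spaceFormNorm_secondFundamentalForm_le (hκ : κ ≤ 0) (hφ : IsIsometricImmersion m κ φ) (p : M)
    (u : TangentSpace (𝓡 m) p) :
    spaceFormNorm κ (φ p) (secondFundamentalForm m κ φ p u u) ≤ alphaNorm m κ φ p * ‖u‖ ^ 2 := by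
  refine abs_le_of_sq_le_sq' ?_ (mul_nonneg (alphaNorm_nonneg p) (sq_nonneg _)) |>.2
  rw [spaceFormNorm_sq hκ, mul_pow, alphaNorm_sq hκ, ← pow_mul, mul_comm]
  exact (stdOrthonormalBasis ℝ (TangentSpace (𝓡 m) p)).bilin_apply_le
    (spaceFormMetric_nonneg hκ (φ p)) (secondFundamentalFormBilin hκ hφ p) u

variable [IsManifold (𝓡 m) ∞ M]

lemma secondFundamentalForm_symm (hκ : κ ≤ 0) (hφ : IsIsometricImmersion m κ φ) (p : M)
    (u v : TangentSpace (𝓡 m) p) :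
    secondFundamentalForm m κ φ p u v = secondFundamentalForm m κ φ p v u := by
  obtain ⟨u, rfl⟩ := (toTangent p).surjective u
  obtain ⟨v, rfl⟩ := (toTangent p).surjective v
  rw [secondFundamentalForm_toTangent hκ hφ, secondFundamentalForm_toTangent hκ hφ,
    covariantHessian_symm
    (contDiffAt_chartMap hφ.contMDiff p (mem_extChartAt_target p))]

lemma sum_secondFundamentalForm_le (hκ : κ ≤ 0) (hφ : IsIsometricImmersion m κ φ) (p : M)
    {u v : TangentSpace (𝓡 m) p} (hu : inner ℝ u u = 1) (hv : inner ℝ v v = 1)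
    (huv : inner ℝ u v = 0) :
    spaceFormNorm κ (φ p) (secondFundamentalForm m κ φ p u u) ^ 2 +
      spaceFormNorm κ (φ p) (secondFundamentalForm m κ φ p v v) ^ 2 +
      2 * spaceFormNorm κ (φ p) (secondFundamentalForm m κ φ p u v) ^ 2 ≤
        alphaNorm m κ φ p ^ 2 := by
  have h := (stdOrthonormalBasis ℝ (TangentSpace (𝓡 m) p)).bilin_pair_le
    (spaceFormMetric_nonneg hκ (φ p)) (secondFundamentalFormBilin hκ hφ p) hu hv huv
  simp only [secondFundamentalFormBilin, LinearMap.mk₂_apply] at h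
  rw [← alphaNorm_sq hκ, secondFundamentalForm_symm hκ hφ p v u] at h
  simp only [spaceFormNorm_sq hκ]
  linarith

end Tangent

/-! ### Sectional curvature of an immersed hypersurface of a submanifold -/

section Sectional

variable {n : ℕ} {κ : ℝ} {E : Type*} [NormedAddCommGroup E] [NormedSpace ℝ E]

lemma christoffel_congr {G G' : E → E →L[ℝ] E →L[ℝ] ℝ} {y : E} (h : G =ᶠ[𝓝 y] G') (u v : E) :
    christoffel G y u v = christoffel G' y u v := by
  simp only [christoffel, christoffelFirst, h.fderiv_eq, h.eq_of_nhds]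

lemma sectionalCurvature_congr {G G' : E → E →L[ℝ] E →L[ℝ] ℝ} {y : E} (h : G =ᶠ[𝓝 y] G')
    (u v : E) : sectionalCurvature G y u v = sectionalCurvature G' y u v := by
  have h1 : ∀ a b, (fun z => christoffel G z a b) =ᶠ[𝓝 y] fun z => christoffel G' z a b :=
    fun a b => h.eventuallyEq_nhds.mono fun z hz => christoffel_congr hz a b
  simp only [sectionalCurvature, riemannCurvature, (h1 _ _).fderiv_eq, h.eq_of_nhds,
    christoffel_congr h]

variable [FiniteDimensional ℝ E] {Φ : E → SpaceForm n} {y : E}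

lemma secondForm_symm (hκ : κ ≤ 0) (hΦ : ContDiffAt ℝ ∞ Φ y)
    (hi : Function.Injective (fderiv ℝ Φ y)) (u v : E) :
    secondForm κ Φ y u v = secondForm κ Φ y v u := by
  have h : christoffel (pullbackMetric κ Φ) y u v = christoffel (pullbackMetric κ Φ) y v u :=
    eq_rieszVector (pullbackMetric_pos hκ hi) fun w => by
      rw [pullbackMetric_christoffel hκ hΦ hi, christoffelFirst_pullbackMetric hκ hΦ,
        covariantHessian_symm hΦ]
  rw [secondForm, secondForm, h, covariantHessian_symm hΦ]

/-- Linearity of the second fundamental form in its second argument; with `secondForm_symm` it is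
bilinear. -/
lemma secondForm_combination (hκ : κ ≤ 0) (hΦ : ContDiffAt ℝ ∞ Φ y)
    (hi : Function.Injective (fderiv ℝ Φ y)) (u v w : E) (a b : ℝ) :
    secondForm κ Φ y u (a • v + b • w) = a • secondForm κ Φ y u v + b • secondForm κ Φ y u w := by
  have h0 : covariantHessian κ Φ y u (a • v + b • w) =
      a • covariantHessian κ Φ y u v + b • covariantHessian κ Φ y u w := by
    simp only [covariantHessian, map_add, map_smul, smul_eq_mul]
    module
  have h : christoffel (pullbackMetric κ Φ) y u (a • v + b • w) =
      a • christoffel (pullbackMetric κ Φ) y u v + b • christoffel (pullbackMetric κ Φ) y u w :=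
    eq_rieszVector (pullbackMetric_pos hκ hi) fun x => by
      rw [christoffelFirst_pullbackMetric hκ hΦ, h0]
      simp only [map_add, map_smul, add_apply, smul_apply, pullbackMetric_christoffel hκ hΦ hi]
  rw [secondForm, h0, h, secondForm, secondForm, map_add, map_smul, map_smul]
  module

/-- The sectional curvature of an immersed submanifold of the space form in terms of an orthonormal
basis of the plane. -/
lemma exists_sectionalCurvature_pullbackMetric_eq (hκ : κ ≤ 0)
    (hΦ : ∀ᶠ z in 𝓝 y, ContDiffAt ℝ ∞ Φ z)
    (hi : ∀ᶠ z in 𝓝 y, Function.Injective (fderiv ℝ Φ z)) {u v : E}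
    (huv : LinearIndependent ℝ ![u, v]) :
    ∃ a b : E, pullbackMetric κ Φ y a a = 1 ∧ pullbackMetric κ Φ y b b = 1 ∧
      pullbackMetric κ Φ y a b = 0 ∧
      sectionalCurvature (pullbackMetric κ Φ) y u v =
        κ + (spaceFormMetric κ (Φ y) (secondForm κ Φ y a a) (secondForm κ Φ y b b) -
          spaceFormMetric κ (Φ y) (secondForm κ Φ y a b) (secondForm κ Φ y a b)) := by
  have hΦy := hΦ.self_of_nhds
  have hiy := hi.self_of_nhds
  have hu : u ≠ 0 := huv.ne_zero 0
  set p := pullbackMetric κ Φ y u u with hp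
  set q := pullbackMetric κ Φ y u v with hq
  have hp0 : 0 < p := pullbackMetric_pos hκ hiy u hu
  set w := v + (-(q / p)) • u with hw
  have hw0 : w ≠ 0 := fun h => by
    rw [LinearIndependent.pair_iff] at huv
    have := huv (-(q / p)) 1 (by rw [one_smul, add_comm]; exact h)
    exact one_ne_zero this.2
  set s := pullbackMetric κ Φ y w w with hs
  have hs0 : 0 < s := pullbackMetric_pos hκ hiy w hw0
  have hsv : s = pullbackMetric κ Φ y v v - q ^ 2 / p := by
    rw [hs, hw]
    simp only [map_add, map_smul, add_apply, smul_apply, smul_eq_mul,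
      pullbackMetric_symm κ Φ y v u, ← hp, ← hq]
    field_simp
    ring
  have hsx : (√s)⁻¹ ^ 2 = s⁻¹ := by rw [inv_pow, Real.sq_sqrt hs0.le]
  have hpx : (√p)⁻¹ ^ 2 = p⁻¹ := by rw [inv_pow, Real.sq_sqrt hp0.le]
  set x := (√p)⁻¹ with hx
  set z := (√s)⁻¹ with hz
  have ea : ∀ c, secondForm κ Φ y c (x • u) = x • secondForm κ Φ y c u := fun c => by
    have := secondForm_combination hκ hΦy hiy c u u x 0
    simpa using this
  have eb : ∀ c, secondForm κ Φ y c (z • w) =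
      z • (secondForm κ Φ y c v + (-(q / p)) • secondForm κ Φ y c u) := fun c => by
    have h1 := secondForm_combination hκ hΦy hiy c w w z 0
    have h2 := secondForm_combination hκ hΦy hiy c v u 1 (-(q / p))
    simp only [one_smul, zero_smul, add_zero] at h1 h2
    rw [h1, hw, h2]
  have sy := secondForm_symm hκ hΦy hiy
  refine ⟨x • u, z • w, ?_, ?_, ?_, ?_⟩
  · simp only [map_smul, smul_apply, smul_eq_mul, ← hp]
    rw [← mul_assoc, ← sq, hpx, inv_mul_cancel₀ hp0.ne']
  · simp only [map_smul, smul_apply, smul_eq_mul, ← hs]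
    rw [← mul_assoc, ← sq, hsx, inv_mul_cancel₀ hs0.ne']
  · simp only [map_smul, smul_apply, smul_eq_mul, hw, map_add, ← hp, ← hq]
    field_simp
    ring
  · have hD : p * pullbackMetric κ Φ y v v - q ^ 2 = p * s := by rw [hsv]; field_simp
    have hD0 : p * s ≠ 0 := (mul_pos hp0 hs0).ne'
    have e1 : secondForm κ Φ y (x • u) (x • u) = (x * x) • secondForm κ Φ y u u := by
      rw [ea, sy, ea, smul_smul]
    have e2 : secondForm κ Φ y (x • u) (z • w) =
        (x * z) • (secondForm κ Φ y u v + (-(q / p)) • secondForm κ Φ y u u) := by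
      rw [sy, ea, sy, eb, smul_smul]
    have e3 : secondForm κ Φ y (z • w) (z • w) = (z * z) •
        (secondForm κ Φ y v v + (-(2 * (q / p))) • secondForm κ Φ y u v +
          (q / p) ^ 2 • secondForm κ Φ y u u) := by
      rw [eb, sy _ v, sy _ u, eb, eb, sy v u]
      module
    rw [sectionalCurvature, pullbackMetric_riemannCurvature hκ hΦ hi, ← hp, ← hq,
      pullbackMetric_symm κ Φ y v u, ← hq, hD, e1, e2, e3, sy v u]
    simp only [map_add, map_smul, add_apply, smul_apply, smul_eq_mul]
    rw [spaceFormMetric_symm κ (Φ y) (secondForm κ Φ y u v) (secondForm κ Φ y u u),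
      spaceFormMetric_symm κ (Φ y) (secondForm κ Φ y v v) (secondForm κ Φ y u u)]
    have hxz : x * x * (z * z) = (p * s)⁻¹ := by rw [← sq, ← sq, hpx, hsx, mul_inv]
    have hxz' : x * z * (x * z) = (p * s)⁻¹ := by rw [← hxz]; ring
    have hDD : pullbackMetric κ Φ y v v = s + q ^ 2 / p := by rw [hsv]; ring
    rw [div_eq_iff hD0, hDD]
    generalize spaceFormMetric κ (Φ y) (secondForm κ Φ y u u) (secondForm κ Φ y u u) = A
    generalize spaceFormMetric κ (Φ y) (secondForm κ Φ y u u) (secondForm κ Φ y u v) = B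
    generalize spaceFormMetric κ (Φ y) (secondForm κ Φ y u u) (secondForm κ Φ y v v) = C
    generalize spaceFormMetric κ (Φ y) (secondForm κ Φ y u v) (secondForm κ Φ y u v) = D
    have h5 : ∀ X Y : ℝ, (κ + ((x * x) * ((z * z) * X) - (x * z) * ((x * z) * Y))) * (p * s) =
        κ * (p * s) + (X - Y) := fun X Y => by
      have : (κ + ((x * x) * ((z * z) * X) - (x * z) * ((x * z) * Y))) =
        κ + ((x * x * (z * z)) * X - (x * z * (x * z)) * Y) := by ring
      rw [this, hxz, hxz']
      field_simp
    have h6 := h5 (C + -(2 * (q / p)) * B + (q / p) ^ 2 * A)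
      (D + -(q / p) * B + -(q / p) * (B + -(q / p) * A))
    have h7 : κ * ((s + q ^ 2 / p) * p - q * q) + (C - D) =
        κ * (p * s) + ((C + -(2 * (q / p)) * B + (q / p) ^ 2 * A) -
          (D + -(q / p) * B + -(q / p) * (B + -(q / p) * A))) := by
      field_simp
      ring
    rw [h7, ← h6]
    ring

end Sectional

/-- The algebraic form of the upper bound. Here `a`, `c`, `e` are the norms of `α(u, u)`,
`α(v, v)`, `α(u, v)` for an orthonormal pair, `A = C_κ / S_κ`, `q = |∇^⊥ r|` and
`g = |∇^M r|²`. -/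
lemma gauss_upper_bound {a c e N q A g I x y z : ℝ} (hc : 0 ≤ c)
    (hN : a ^ 2 + c ^ 2 + 2 * e ^ 2 ≤ N ^ 2) (hN0 : 0 ≤ N) (hq : 0 ≤ q) (hA : 0 ≤ A) (hg : 0 < g)
    (hI : |I| ≤ a * c) (hx : |x| ≤ q * a) (hy : |y| ≤ q * c) :
    I - e ^ 2 + ((A + x) * (A + y) - z ^ 2) / g ≤ N ^ 2 + (A + q * N) ^ 2 / g := by
  have haN : a ≤ N := by nlinarith [sq_nonneg c, sq_nonneg e]
  have hcN : c ≤ N := by nlinarith [sq_nonneg a, sq_nonneg e]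
  have h1 : I ≤ N ^ 2 := by nlinarith [le_abs_self I, mul_le_mul haN hcN hc hN0]
  have h2 : |A + x| ≤ A + q * N :=
    (abs_add_le A x).trans (by rw [abs_of_nonneg hA]; nlinarith [mul_le_mul_of_nonneg_left haN hq])
  have h3 : |A + y| ≤ A + q * N :=
    (abs_add_le A y).trans (by rw [abs_of_nonneg hA]; nlinarith [mul_le_mul_of_nonneg_left hcN hq])
  have h4 : (A + x) * (A + y) ≤ (A + q * N) ^ 2 := by
    calc (A + x) * (A + y) ≤ |A + x| * |A + y| := by rw [← abs_mul]; exact le_abs_self _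
      _ ≤ (A + q * N) * (A + q * N) := mul_le_mul h2 h3 (abs_nonneg _) (by positivity)
      _ = _ := by ring
  have h5 : ((A + x) * (A + y) - z ^ 2) / g ≤ (A + q * N) ^ 2 / g :=
    div_le_div_of_nonneg_right (by nlinarith [sq_nonneg z]) hg.le
  nlinarith [sq_nonneg e]

/-- The algebraic form of the lower bound, in the notation of `gauss_upper_bound`. The cross terms
are absorbed because `‖α‖ ≤ C_κ / S_κ` and `|∇^⊥ r| ≤ 1`. -/
lemma gauss_lower_bound {a c e N q A g I x y z : ℝ} (ha : 0 ≤ a)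
    (hN : a ^ 2 + c ^ 2 + 2 * e ^ 2 ≤ N ^ 2) (hN0 : 0 ≤ N) (hq : 0 ≤ q) (hq1 : q ≤ 1) (hNA : N ≤ A)
    (hg : 0 < g) (hI : |I| ≤ a * c) (hx : |x| ≤ q * a) (hy : |y| ≤ q * c) (hz : |z| ≤ q * e) :
    -(2 * N ^ 2) + (A ^ 2 - 2 * q * N * A) / g ≤ I - e ^ 2 + ((A + x) * (A + y) - z ^ 2) / g := by
  have hA : 0 ≤ A := hN0.trans hNA
  have h1 : -(2 * N ^ 2) ≤ I - e ^ 2 := by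
    nlinarith [neg_abs_le I, sq_nonneg (a - c), sq_nonneg a, sq_nonneg c, sq_nonneg e]
  have h2 : A ^ 2 - 2 * q * N * A ≤ (A + x) * (A + y) - z ^ 2 := by
    have h3 : x + y ≥ -(q * (a + c)) := by nlinarith [neg_abs_le x, neg_abs_le y]
    have h4 : a + c ≤ 3 / 2 * N := by
      refine abs_le_of_sq_le_sq' ?_ (by positivity) |>.2
      nlinarith [sq_nonneg (a - c), sq_nonneg e, sq_nonneg N]
    have h5 : x * y ≥ -(q ^ 2 * (a * c)) := by
      have : |x * y| ≤ (q * a) * (q * c) := by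
        rw [abs_mul]; exact mul_le_mul hx hy (abs_nonneg _) (by positivity)
      nlinarith [neg_abs_le (x * y)]
    have h6 : z ^ 2 ≤ q ^ 2 * e ^ 2 := by
      rw [← sq_abs z, ← mul_pow]; gcongr
    have h7 : a * c + e ^ 2 ≤ N ^ 2 / 2 := by nlinarith [sq_nonneg (a - c)]
    have h8 : q ^ 2 * N ^ 2 ≤ q * N * A := by
      calc q ^ 2 * N ^ 2 = (q * N) * (q * N) := by ring
        _ ≤ (q * N) * (1 * A) :=
          mul_le_mul_of_nonneg_left (mul_le_mul hq1 hNA hN0 zero_le_one) (by positivity)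
        _ = _ := by ring
    have h9 : A * (x + y) ≥ -(A * (q * (3 / 2 * N))) := by
      have := mul_le_mul_of_nonneg_left h4 hq
      nlinarith [mul_le_mul_of_nonneg_left (h3.le.trans' (neg_le_neg this)) hA]
    nlinarith [mul_le_mul_of_nonneg_left h7 (sq_nonneg q)]
  have h3 := div_le_div_of_nonneg_right h2 hg.le
  linarith

/-! ### Level hypersurfaces of the extrinsic distance -/

section Hypersurface

variable {m n : ℕ} {κ : ℝ} {M : Type*} [MetricSpace M] [ChartedSpace (EuclideanSpace ℝ (Fin m)) M]
  [RiemannianBundle (fun x : M => TangentSpace (𝓡 m) x)] {φ : M → SpaceForm n}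

lemma mfderiv_extrinsicDist_apply (hκ : κ ≤ 0) (hφ : IsIsometricImmersion m κ φ) {o : SpaceForm n}
    {p : M} (hp : 0 < extrinsicDist κ φ o p) (v : TangentSpace (𝓡 m) p) :
    mfderiv (𝓡 m) 𝓘(ℝ, ℝ) (extrinsicDist κ φ o) p v =
      (sinK κ (extrinsicDist κ φ o p))⁻¹ *
        spaceFormMetric κ (φ p) (gradPotential κ o (φ p)) (pushforward m φ p v) := by
  have h1 := hasFDerivAt_spaceFormDist hκ hp
  have h2 := h1.hasMFDerivAt.comp p (hφ.contMDiff.mdifferentiableAt (by simp)).hasMFDerivAt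
  have h3 := h2.mfderiv
  rw [← fderiv_potential hκ]
  exact DFunLike.congr_fun h3 v

lemma gradExtrinsicDist_eq (hκ : κ ≤ 0) (hφ : IsIsometricImmersion m κ φ) {o : SpaceForm n}
    {p : M} (hp : 0 < extrinsicDist κ φ o p) :
    gradExtrinsicDist m κ φ o p =
      (sinK κ (extrinsicDist κ φ o p))⁻¹ • tangentPart m κ φ p (gradPotential κ o (φ p)) := by
  refine ext_inner_right ℝ fun v => ?_
  rw [real_inner_smul_left, inner_tangentPart, ← mfderiv_extrinsicDist_apply hκ hφ hp v]
  exact inner_tangentRiesz p _ v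

lemma normalGradDist_eq (hκ : κ ≤ 0) {o : SpaceForm n}
    {p : M} (hp : 0 < extrinsicDist κ φ o p) :
    normalGradDist m κ φ o p =
      (sinK κ (extrinsicDist κ φ o p))⁻¹ • normalPart m κ φ p (gradPotential κ o (φ p)) := by
  have h : rieszVector (spaceFormMetric κ (φ p)) (fderiv ℝ (spaceFormDist κ o) (φ p)) =
      (sinK κ (extrinsicDist κ φ o p))⁻¹ • gradPotential κ o (φ p) := by
    refine eq_rieszVector (spaceFormMetric_pos hκ (φ p)) fun w => ?_
    rw [(hasFDerivAt_spaceFormDist hκ hp).fderiv, smul_apply, fderiv_potential hκ, map_smul,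
      smul_apply]
    rfl
  rw [normalGradDist, h, normalPart_smul]

lemma spaceFormNorm_smul (x w : SpaceForm n) {c : ℝ} (hc : 0 ≤ c) :
    spaceFormNorm κ x (c • w) = c * spaceFormNorm κ x w := by
  simp only [spaceFormNorm, map_smul, smul_apply, smul_eq_mul]
  rw [← mul_assoc, ← sq, Real.sqrt_mul (sq_nonneg c), Real.sqrt_sq hc]

lemma spaceFormNorm_normalGradDist_le_one (hκ : κ ≤ 0) (hφ : IsIsometricImmersion m κ φ)
    {o : SpaceForm n} {p : M} (hp : 0 < extrinsicDist κ φ o p) :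
    spaceFormNorm κ (φ p) (normalGradDist m κ φ o p) ≤ 1 := by
  have hS := sinK_pos (κ := κ) hp
  have h1 := sinK_spaceFormDist_sq hκ o (φ p)
  rw [← spaceFormMetric_gradPotential_self hκ, spaceFormMetric_self_eq hφ,
    ← spaceFormNorm_sq hκ] at h1
  change sinK κ (extrinsicDist κ φ o p) ^ 2 = _ at h1
  rw [normalGradDist_eq hκ hp, spaceFormNorm_smul _ _ (inv_nonneg.2 hS.le),
    inv_mul_le_one₀ hS]
  refine abs_le_of_sq_le_sq' ?_ hS.le |>.2
  rw [h1]
  linarith [sq_nonneg ‖tangentPart m κ φ p (gradPotential κ o (φ p))‖]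

variable {E : Type*} [NormedAddCommGroup E] [NormedSpace ℝ E] {Φ : E → SpaceForm n} {y : E} {p : M}
  {c : E → EuclideanSpace ℝ (Fin m)}

variable [IsManifold (𝓡 m) ∞ M]

lemma fderiv_eq_pushforward (hφ : IsIsometricImmersion m κ φ) (hc : ContDiffAt ℝ ∞ c y)
    (hcy : c y = extChartAt (𝓡 m) p p) (hΦ : Φ =ᶠ[𝓝 y] chartMap m φ p ∘ c) (u : E) :
    fderiv ℝ Φ y u = pushforward m φ p (toTangent p (fderiv ℝ c y u)) := by
  have h1 : DifferentiableAt ℝ (chartMap m φ p) (c y) := by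
    rw [hcy]
    exact (contDiffAt_chartMap hφ.contMDiff p (mem_extChartAt_target p)).differentiableAt (by simp)
  rw [hΦ.fderiv_eq, fderiv_comp _ h1 (hc.differentiableAt (by simp)), pushforward_toTangent
    hφ.contMDiff, hcy]
  rfl

/-- The second derivative of an immersion into `M` differs from the second fundamental form of `M`
by a vector tangent to `M`. -/
lemma normalPart_covariantHessian (hκ : κ ≤ 0) (hφ : IsIsometricImmersion m κ φ)
    (hc : ContDiffAt ℝ ∞ c y) (hcy : c y = extChartAt (𝓡 m) p p)
    (hΦ : Φ =ᶠ[𝓝 y] chartMap m φ p ∘ c) (u v : E) :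
    normalPart m κ φ p (covariantHessian κ Φ y u v) =
      secondFundamentalForm m κ φ p (toTangent p (fderiv ℝ c y u))
        (toTangent p (fderiv ℝ c y v)) := by
  have h0 := contDiffAt_chartMap hφ.contMDiff p (mem_extChartAt_target p)
  have h1 : ∀ᶠ z in 𝓝 y, fderiv ℝ Φ z = (fderiv ℝ (chartMap m φ p) (c z)).comp (fderiv ℝ c z) := by
    have h2 := hc.continuousAt
    rw [ContinuousAt, hcy] at h2
    filter_upwards [hΦ.eventuallyEq_nhds, h2.eventually (eventually_contDiffAt_chartMap
      hφ.contMDiff p), (hc.of_le (m := 1) (by simp)).eventually (by simp)] with z hz hz1 hz2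
    rw [hz.fderiv_eq, fderiv_comp _ (hz1.differentiableAt (by simp))
      (hz2.differentiableAt (by simp))]
  have hd : HasFDerivAt (fderiv ℝ (chartMap m φ p))
      (fderiv ℝ (fderiv ℝ (chartMap m φ p)) (extChartAt (𝓡 m) p p)) (c y) := by
    rw [hcy]; exact h0.differentiableAt_fderiv.hasFDerivAt
  have hcd : DifferentiableAt ℝ (fderiv ℝ c) y :=
    (hc.fderiv_right (m := ∞) (by simp)).differentiableAt (by simp)
  have h3 := ((hd.comp y (hc.differentiableAt (by simp)).hasFDerivAt).clm_comp
    hcd.hasFDerivAt).congr_of_eventuallyEq h1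
  have h4 : fderiv ℝ (fderiv ℝ Φ) y u v =
      fderiv ℝ (fderiv ℝ (chartMap m φ p)) (extChartAt (𝓡 m) p p) (fderiv ℝ c y u)
          (fderiv ℝ c y v) +
        pushforward m φ p (toTangent p (fderiv ℝ (fderiv ℝ c) y u v)) := by
    rw [h3.fderiv, pushforward_toTangent hφ.contMDiff]
    simp [hcy, add_comm]
  have h5 : Φ y = φ p := by
    rw [hΦ.eq_of_nhds, Function.comp_apply, hcy, chartMap_apply_self]
  rw [secondFundamentalForm_toTangent hκ hφ, covariantHessian, h4, covariantHessian,
    normalPart_add, normalPart_add, normalPart_add, normalPart_pushforward hφ, add_zero,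
    chartMap_apply_self, h5, pullbackMetric_chartMap hφ, pullbackMetric_apply, h5,
    fderiv_eq_pushforward hφ hc hcy hΦ, fderiv_eq_pushforward hφ hc hcy hΦ, hφ.isometric]

variable [FiniteDimensional ℝ E]

/-- A hypersurface of `M` on which the extrinsic distance is constant: the sectional curvature is
determined by the second fundamental form of `M` and the gradient of the potential. The component
of the second fundamental form in the direction of `∇^M r` comes from differentiating the potential
twice along the hypersurface. -/
lemma exists_sectionalCurvature_level (hκ : κ ≤ 0) (hφ : IsIsometricImmersion m κ φ)
    (o : SpaceForm n)
    (hΦs : ∀ᶠ z in 𝓝 y, ContDiffAt ℝ ∞ Φ z)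
    (hi : ∀ᶠ z in 𝓝 y, Function.Injective (fderiv ℝ Φ z))
    (hdim : Module.finrank ℝ E + 1 = m)
    (hc : ContDiffAt ℝ ∞ c y) (hcy : c y = extChartAt (𝓡 m) p p)
    (hΦ : Φ =ᶠ[𝓝 y] chartMap m φ p ∘ c)
    (hconst : ∀ᶠ z in 𝓝 y, potential κ o (Φ z) = potential κ o (Φ y))
    (hw : tangentPart m κ φ p (gradPotential κ o (φ p)) ≠ 0)
    {u v : E} (huv : LinearIndependent ℝ ![u, v]) :
    ∃ a b : TangentSpace (𝓡 m) p, inner ℝ a a = 1 ∧ inner ℝ b b = 1 ∧ inner ℝ a b = 0 ∧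
      sectionalCurvature (pullbackMetric κ Φ) y u v =
        κ + (spaceFormMetric κ (φ p) (secondFundamentalForm m κ φ p a a)
              (secondFundamentalForm m κ φ p b b) -
            spaceFormMetric κ (φ p) (secondFundamentalForm m κ φ p a b)
              (secondFundamentalForm m κ φ p a b) +
          ((1 - κ * potential κ o (φ p) + spaceFormMetric κ (φ p)
                (secondFundamentalForm m κ φ p a a) (normalPart m κ φ p (gradPotential κ o (φ p)))) *
              (1 - κ * potential κ o (φ p) + spaceFormMetric κ (φ p)
                (secondFundamentalForm m κ φ p b b) (normalPart m κ φ p (gradPotential κ o (φ p)))) -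
            spaceFormMetric κ (φ p) (secondFundamentalForm m κ φ p a b)
              (normalPart m κ φ p (gradPotential κ o (φ p))) ^ 2) /
            ‖tangentPart m κ φ p (gradPotential κ o (φ p))‖ ^ 2) := by
  have hΦy := hΦs.self_of_nhds
  have hiy := hi.self_of_nhds
  have hp : Φ y = φ p := by
    rw [hΦ.eq_of_nhds, Function.comp_apply, hcy, chartMap_apply_self]
  obtain ⟨a, b, haa, hbb, hab, hK⟩ := exists_sectionalCurvature_pullbackMetric_eq hκ hΦs hi huv
  set w := tangentPart m κ φ p (gradPotential κ o (φ p)) with hwdef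
  let X : E →ₗ[ℝ] TangentSpace (𝓡 m) p := (toTangent p).toLinearMap ∘ₗ (fderiv ℝ c y).toLinearMap
  have hX : ∀ e, fderiv ℝ Φ y e = pushforward m φ p (X e) :=
    fderiv_eq_pushforward hφ hc hcy hΦ
  have hinner : ∀ e e', pullbackMetric κ Φ y e e' = inner ℝ (X e) (X e') := fun e e' => by
    rw [pullbackMetric_apply, hp, hX, hX, hφ.isometric]
  have hXinj : Function.Injective X := fun e e' h => hiy (by rw [hX, hX, h])
  have hpot : (fun z => potential κ o (Φ z)) =ᶠ[𝓝 y] fun _ => potential κ o (Φ y) := hconst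
  -- the potential is constant along the hypersurface, so its first two derivatives vanish
  have hD1 : ∀ e, spaceFormMetric κ (φ p) (gradPotential κ o (φ p)) (fderiv ℝ Φ y e) = 0 := by
    intro e
    rw [← hp, ← fderiv_potential_comp hκ o (hΦy.differentiableAt (by simp)), hpot.fderiv_eq]
    simp
  have hD2 : ∀ e e', (1 - κ * potential κ o (φ p)) * pullbackMetric κ Φ y e e' +
      spaceFormMetric κ (φ p) (gradPotential κ o (φ p)) (covariantHessian κ Φ y e e') = 0 := by
    intro e e'
    have h1 : fderiv ℝ (fun z => potential κ o (Φ z)) =ᶠ[𝓝 y] fun _ => 0 := by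
      filter_upwards [hpot.eventuallyEq_nhds] with z hz
      rw [hz.fderiv_eq]; simp
    rw [← hp, ← fderiv_fderiv_potential_comp hκ o hΦy, h1.fderiv_eq]
    simp
  have hwX : ∀ e, inner ℝ w (X e) = 0 := fun e => by
    rw [hwdef, inner_tangentPart, ← hX, hD1]
  let β := secondForm κ Φ y
  have hβX : ∀ e e' f, spaceFormMetric κ (φ p) (β e e') (pushforward m φ p (X f)) = 0 :=
    fun e e' f => by
      have := spaceFormMetric_secondForm hκ hΦy hiy e e' f
      rwa [hX, hp] at this
  have hβn : ∀ e e', normalPart m κ φ p (β e e') =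
      secondFundamentalForm m κ φ p (X e) (X e') := fun e e' => by
    have h1 : covariantHessian κ Φ y e e' = β e e' + pushforward m φ p
        (X (christoffel (pullbackMetric κ Φ) y e e')) := by
      rw [← hX]; simp [β, secondForm]
    have h2 := normalPart_covariantHessian hκ hφ hc hcy hΦ e e'
    rw [h1, normalPart_add, normalPart_pushforward hφ, add_zero] at h2
    exact h2
  -- the tangential parts of the second fundamental form are multiples of `w`, since the orthogonal
  -- complement of the tangent space of the hypersurface in `T_p M` is a line
  have hline : ∀ e e', ∃ s : ℝ, s • w = tangentPart m κ φ p (β e e') := by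
    intro e e'
    let K := LinearMap.range X
    have hK1 : Module.finrank ℝ K + 1 = m := by
      rw [LinearMap.finrank_range_of_inj hXinj, hdim]
    have hK2 : Module.finrank ℝ K + Module.finrank ℝ Kᗮ = m := by
      rw [K.finrank_add_finrank_orthogonal, ← (toTangent p).toLinearEquiv.finrank_eq]
      simp
    have hK3 : Module.finrank ℝ Kᗮ = 1 := by omega
    have hwK : w ∈ Kᗮ := by
      rw [Submodule.mem_orthogonal]
      rintro _ ⟨f, rfl⟩
      rw [real_inner_comm]; exact hwX f
    have hβK : tangentPart m κ φ p (β e e') ∈ Kᗮ := by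
      rw [Submodule.mem_orthogonal]
      rintro _ ⟨f, rfl⟩
      rw [real_inner_comm, inner_tangentPart]; exact hβX e e' f
    obtain ⟨s, hs⟩ := (finrank_eq_one_iff_of_nonzero' (⟨w, hwK⟩ : Kᗮ)
      (by simpa [Subtype.ext_iff] using hw)).1 hK3 ⟨_, hβK⟩
    exact ⟨s, by simpa [Subtype.ext_iff] using hs⟩
  have hβw : ∀ e e', inner ℝ (tangentPart m κ φ p (β e e')) w =
      -((1 - κ * potential κ o (φ p)) * pullbackMetric κ Φ y e e' +
        spaceFormMetric κ (φ p) (secondFundamentalForm m κ φ p (X e) (X e'))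
          (normalPart m κ φ p (gradPotential κ o (φ p)))) := by
    intro e e'
    have h1 := hD2 e e'
    have h2 : spaceFormMetric κ (φ p) (gradPotential κ o (φ p)) (covariantHessian κ Φ y e e') =
        spaceFormMetric κ (φ p) (gradPotential κ o (φ p)) (β e e') := by
      simp only [β, secondForm, map_sub, hD1, sub_zero]
    rw [h2] at h1
    have h3 : inner ℝ w (tangentPart m κ φ p (β e e')) = spaceFormMetric κ (φ p)
        (gradPotential κ o (φ p)) (pushforward m φ p (tangentPart m κ φ p (β e e'))) :=
      inner_tangentPart φ p _ _
    have h4 : pushforward m φ p (tangentPart m κ φ p (β e e')) =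
        β e e' - normalPart m κ φ p (β e e') := by rw [normalPart_eq]; abel
    rw [real_inner_comm, h3, h4, map_sub, ← hβn, spaceFormMetric_normalPart_normalPart hφ,
      spaceFormMetric_symm κ _ (normalPart m κ φ p (β e e'))]
    linarith
  have hββ : ∀ e e' f f', spaceFormMetric κ (φ p) (β e e') (β f f') =
      spaceFormMetric κ (φ p) (secondFundamentalForm m κ φ p (X e) (X e'))
        (secondFundamentalForm m κ φ p (X f) (X f')) +
      inner ℝ (tangentPart m κ φ p (β e e')) w * inner ℝ (tangentPart m κ φ p (β f f')) w /
        ‖w‖ ^ 2 := by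
    intro e e' f f'
    have h1 : spaceFormMetric κ (φ p) (β e e') (β f f') =
        spaceFormMetric κ (φ p) (normalPart m κ φ p (β e e')) (normalPart m κ φ p (β f f')) +
          inner ℝ (tangentPart m κ φ p (β e e')) (tangentPart m κ φ p (β f f')) := by
      rw [spaceFormMetric_normalPart_normalPart hφ, normalPart_eq, map_sub, sub_apply,
        inner_tangentPart, spaceFormMetric_symm κ (φ p) (pushforward m φ p _) (β f f'),
        ← inner_tangentPart φ p (β f f'), real_inner_comm, inner_tangentPart]
      ring
    have hw2 : ‖w‖ ^ 2 ≠ 0 := by positivity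
    obtain ⟨s, hs⟩ := hline e e'
    obtain ⟨s', hs'⟩ := hline f f'
    rw [h1, hβn, hβn, ← hs, ← hs']
    simp only [real_inner_smul_left, real_inner_smul_right, real_inner_self_eq_norm_sq]
    field_simp
  refine ⟨X a, X b, ?_, ?_, ?_, ?_⟩
  · rw [← hinner, haa]
  · rw [← hinner, hbb]
  · rw [← hinner, hab]
  · rw [hK, hp]
    have e1 := hββ a a b b
    have e2 := hββ a b a b
    rw [hβw, hβw, haa, hbb] at e1
    rw [hβw, hab] at e2
    change κ + (spaceFormMetric κ (φ p) (β a a) (β b b) -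
      spaceFormMetric κ (φ p) (β a b) (β a b)) = _
    rw [e1, e2]
    ring

end Hypersurface

/-! ### Curvature bounds for parametrized level hypersurfaces -/

section Param

variable {m n : ℕ} {κ : ℝ} {M : Type*} [MetricSpace M] [ChartedSpace (EuclideanSpace ℝ (Fin m)) M]
  [RiemannianBundle (fun x : M => TangentSpace (𝓡 m) x)]
  {φ : M → SpaceForm n} {S : Set M} {U : Set (EuclideanSpace ℝ (Fin (m - 1)))}
  {ψ : EuclideanSpace ℝ (Fin (m - 1)) → M} {y : EuclideanSpace ℝ (Fin (m - 1))}

/-- The differential of a parametrization, as a map defined on `ℝ^{m-1}`. -/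
noncomputable def paramDeriv (m : ℕ) {M : Type*} [MetricSpace M]
    [ChartedSpace (EuclideanSpace ℝ (Fin m)) M] (ψ : EuclideanSpace ℝ (Fin (m - 1)) → M)
    (y : EuclideanSpace ℝ (Fin (m - 1))) :
    EuclideanSpace ℝ (Fin (m - 1)) →L[ℝ] TangentSpace (𝓡 m) (ψ y) :=
  mfderiv (𝓡 (m - 1)) (𝓡 m) ψ y

lemma inducedMetric_apply (y u v : EuclideanSpace ℝ (Fin (m - 1))) :
    inducedMetric m ψ y u v = inner ℝ (paramDeriv m ψ y u) (paramDeriv m ψ y v) := rfl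

lemma fderiv_comp_param (hφ : IsIsometricImmersion m κ φ) (hψ : IsHypersurfaceParam m S U ψ)
    (hy : y ∈ U) (u : EuclideanSpace ℝ (Fin (m - 1))) :
    fderiv ℝ (φ ∘ ψ) y u = pushforward m φ (ψ y) (paramDeriv m ψ y u) := by
  have h1 : MDifferentiableAt (𝓡 (m - 1)) (𝓡 m) ψ y :=
    ((hψ.contMDiffOn y hy).contMDiffAt (hψ.isOpen.mem_nhds hy)).mdifferentiableAt (by simp)
  have h2 : MDifferentiableAt (𝓡 m) 𝓘(ℝ, SpaceForm n) φ (ψ y) :=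
    hφ.contMDiff.mdifferentiableAt (by simp)
  have h3 := mfderiv_comp y h2 h1
  rw [mfderiv_eq_fderiv] at h3
  exact DFunLike.congr_fun h3 u

lemma contDiffAt_comp_param (hφ : IsIsometricImmersion m κ φ) (hψ : IsHypersurfaceParam m S U ψ)
    (hy : y ∈ U) : ContDiffAt ℝ ∞ (φ ∘ ψ) y := by
  have h : ContMDiffOn (𝓡 (m - 1)) 𝓘(ℝ, SpaceForm n) ∞ (φ ∘ ψ) U :=
    hφ.contMDiff.comp_contMDiffOn hψ.contMDiffOn
  rw [contMDiffOn_iff_contDiffOn] at h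
  exact h.contDiffAt (hψ.isOpen.mem_nhds hy)

lemma inducedMetric_eq_pullbackMetric (hφ : IsIsometricImmersion m κ φ)
    (hψ : IsHypersurfaceParam m S U ψ) (hy : y ∈ U) :
    inducedMetric m ψ y = pullbackMetric κ (φ ∘ ψ) y := by
  ext1 u; ext1 v
  rw [inducedMetric_apply, pullbackMetric_apply, fderiv_comp_param hφ hψ hy,
    fderiv_comp_param hφ hψ hy, Function.comp_apply, hφ.isometric]

lemma injective_fderiv_comp_param (hφ : IsIsometricImmersion m κ φ)
    (hψ : IsHypersurfaceParam m S U ψ) (hy : y ∈ U) :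
    Function.Injective (fderiv ℝ (φ ∘ ψ) y) := by
  refine (injective_iff_map_eq_zero _).2 fun u hu => ?_
  have h1 : inducedMetric m ψ y u u = 0 := by
    rw [inducedMetric_eq_pullbackMetric hφ hψ hy, pullbackMetric_apply, hu]; simp
  rw [inducedMetric_apply, inner_self_eq_zero] at h1
  exact hψ.immersion y hy (h1.trans (map_zero (paramDeriv m ψ y)).symm)

variable [IsManifold (𝓡 m) ∞ M]

/-- The two-sided curvature estimate for a hypersurface of `M` contained in the level set
`{r = t}` of the extrinsic distance, at a point which is not critical for `r` and where
`‖α‖ ≤ C_κ(t) / S_κ(t)`. -/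
lemma sectionalCurvature_inducedMetric_bounds (hκ : κ ≤ 0) (hφ : IsIsometricImmersion m κ φ)
    {o : SpaceForm n} {t : ℝ} (ht : 0 < t) (hS : ∀ q ∈ S, extrinsicDist κ φ o q = t)
    (hψ : IsHypersurfaceParam m S U ψ) (hy : y ∈ U)
    (hgrad : gradExtrinsicDist m κ φ o (ψ y) ≠ 0)
    (hα : alphaNorm m κ φ (ψ y) ≤ cosK κ t / sinK κ t)
    {u v : EuclideanSpace ℝ (Fin (m - 1))} (huv : LinearIndependent ℝ ![u, v]) :
    sectionalCurvature (inducedMetric m ψ) y u v ≤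
        κ + alphaNorm m κ φ (ψ y) ^ 2 +
          (cosK κ t / sinK κ t +
              spaceFormNorm κ (φ (ψ y)) (normalGradDist m κ φ o (ψ y)) *
                alphaNorm m κ φ (ψ y)) ^ 2 /
            ‖gradExtrinsicDist m κ φ o (ψ y)‖ ^ 2 ∧
      κ - 2 * alphaNorm m κ φ (ψ y) ^ 2 +
          ((cosK κ t / sinK κ t) ^ 2 -
              2 * spaceFormNorm κ (φ (ψ y)) (normalGradDist m κ φ o (ψ y)) *
                alphaNorm m κ φ (ψ y) * (cosK κ t / sinK κ t)) /
            ‖gradExtrinsicDist m κ φ o (ψ y)‖ ^ 2 ≤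
        sectionalCurvature (inducedMetric m ψ) y u v := by
  have hU : ∀ᶠ z in 𝓝 y, z ∈ U := hψ.isOpen.mem_nhds hy
  have hr : extrinsicDist κ φ o (ψ y) = t := hS _ (hψ.mapsTo hy)
  have hr0 : 0 < extrinsicDist κ φ o (ψ y) := by rw [hr]; exact ht
  have hs := sinK_pos (κ := κ) ht
  have hdim : Module.finrank ℝ (EuclideanSpace ℝ (Fin (m - 1))) + 1 = m := by
    have h := huv.fintype_card_le_finrank
    simp only [Fintype.card_fin, finrank_euclideanSpace_fin] at h ⊢
    omega
  have hc : ContDiffAt ℝ ∞ (extChartAt (𝓡 m) (ψ y) ∘ ψ) y := by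
    have h1 : ContMDiffAt (𝓡 (m - 1)) (𝓡 m) ∞ ψ y :=
      (hψ.contMDiffOn y hy).contMDiffAt (hψ.isOpen.mem_nhds hy)
    have h2 : ContMDiffAt (𝓡 (m - 1)) 𝓘(ℝ, EuclideanSpace ℝ (Fin m)) ∞
        (extChartAt (𝓡 m) (ψ y) ∘ ψ) y :=
      (contMDiffAt_extChartAt (I := 𝓡 m) (x := ψ y)).comp y h1
    rwa [contMDiffAt_iff_contDiffAt] at h2
  have hcont : ContinuousAt ψ y :=
    ((hψ.contMDiffOn y hy).contMDiffAt (hψ.isOpen.mem_nhds hy)).continuousAt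
  have hΦ : φ ∘ ψ =ᶠ[𝓝 y] chartMap m φ (ψ y) ∘ (extChartAt (𝓡 m) (ψ y) ∘ ψ) := by
    filter_upwards [hcont (extChartAt_source_mem_nhds (I := 𝓡 m) (ψ y))] with z hz
    simp only [chartMap, Function.comp_apply]
    rw [(extChartAt (𝓡 m) (ψ y)).left_inv hz]
  have hpot : ∀ z ∈ U, 1 - κ * potential κ o (φ (ψ z)) = cosK κ t := fun z hz => by
    rw [← hS _ (hψ.mapsTo hz)]; exact (cosK_spaceFormDist hκ o _).symm
  have hpot2 : ∀ z ∈ U, potential κ o (φ (ψ z)) = potential κ o (φ (ψ y)) := fun z hz => by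
    by_contra hne
    have h1 : spaceFormDist κ o (φ (ψ z)) = spaceFormDist κ o (φ (ψ y)) :=
      (hS _ (hψ.mapsTo hz)).trans hr.symm
    have h2 := sinK_spaceFormDist_sq hκ o (φ (ψ z))
    have h3 := sinK_spaceFormDist_sq hκ o (φ (ψ y))
    rw [h1, h3] at h2
    have h4 := potential_nonneg hκ o (φ (ψ z))
    have h5 := potential_nonneg hκ o (φ (ψ y))
    have h6 : (potential κ o (φ (ψ z)) - potential κ o (φ (ψ y))) *
        (2 - κ * (potential κ o (φ (ψ z)) + potential κ o (φ (ψ y)))) = 0 := by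
      linear_combination -h2
    rcases mul_eq_zero.1 h6 with h7 | h7
    · exact hne (sub_eq_zero.1 h7)
    · nlinarith
  -- the gradient of the potential is `S_κ(t)` times that of the distance; rescaling turns the
  -- formula for the curvature into one in terms of `∇^M r` and `∇^⊥ r`
  have hgr := gradExtrinsicDist_eq hκ hφ hr0
  have hng := normalGradDist_eq (m := m) hκ hr0
  rw [hr] at hgr hng
  set p := ψ y with hpdef
  have hw : tangentPart m κ φ p (gradPotential κ o (φ p)) ≠ 0 := fun h => hgrad (by
    rw [hgr, h, smul_zero])
  obtain ⟨a, b, haa, hbb, hab, hK⟩ := exists_sectionalCurvature_level hκ hφ o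
    (hU.mono fun z hz => contDiffAt_comp_param hφ hψ hz)
    (hU.mono fun z hz => injective_fderiv_comp_param hφ hψ hz) hdim hc rfl hΦ
    (hU.mono fun z hz => hpot2 z hz) hw huv
  have hKeq : sectionalCurvature (inducedMetric m ψ) y u v =
      sectionalCurvature (pullbackMetric κ (φ ∘ ψ)) y u v :=
    sectionalCurvature_congr (hU.mono fun z hz => inducedMetric_eq_pullbackMetric hφ hψ hz) u v
  rw [hKeq, hK, hpot y hy]
  set w := tangentPart m κ φ p (gradPotential κ o (φ p)) with hwdef
  set b0 := normalPart m κ φ p (gradPotential κ o (φ p)) with hb0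
  set s := sinK κ t with hsdef
  have hnorm : b0 = s • normalGradDist m κ φ o p := by
    rw [hng, smul_smul, mul_inv_cancel₀ hs.ne', one_smul]
  have hgnorm : ‖gradExtrinsicDist m κ φ o p‖ ^ 2 = ‖w‖ ^ 2 / s ^ 2 := by
    rw [hgr, norm_smul, norm_inv, Real.norm_of_nonneg hs.le]; field_simp
  have hg0 : 0 < ‖gradExtrinsicDist m κ φ o p‖ ^ 2 := by positivity
  have hw2 : ‖w‖ ^ 2 ≠ 0 := by positivity
  have hN := sum_secondFundamentalForm_le hκ hφ p haa hbb hab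
  set νn := normalGradDist m κ φ o p with hνn
  have hx : ∀ z : SpaceForm n, |spaceFormMetric κ (φ p) z νn| ≤
      spaceFormNorm κ (φ p) νn * spaceFormNorm κ (φ p) z := fun z => by
    rw [mul_comm]; exact abs_spaceFormMetric_le hκ _ _ _
  have key : ∀ x y z : ℝ, ((cosK κ t + s * x) * (cosK κ t + s * y) - (s * z) ^ 2) / ‖w‖ ^ 2 =
      ((cosK κ t / s + x) * (cosK κ t / s + y) - z ^ 2) /
        ‖gradExtrinsicDist m κ φ o p‖ ^ 2 := fun x y z => by
    rw [hgnorm]; field_simp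
  rw [hnorm]
  simp only [map_smul, smul_eq_mul]
  rw [key, ← spaceFormNorm_sq hκ (φ p) (secondFundamentalForm m κ φ p a b)]
  have hA : 0 ≤ cosK κ t / s := (alphaNorm_nonneg p).trans hα
  have hI := abs_spaceFormMetric_le hκ (φ p) (secondFundamentalForm m κ φ p a a)
    (secondFundamentalForm m κ φ p b b)
  have hq1 := spaceFormNorm_normalGradDist_le_one hκ hφ hr0
  have hq0 : 0 ≤ spaceFormNorm κ (φ p) νn := Real.sqrt_nonneg _
  have ha0 : 0 ≤ spaceFormNorm κ (φ p) (secondFundamentalForm m κ φ p a a) := Real.sqrt_nonneg _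
  have hc0 : 0 ≤ spaceFormNorm κ (φ p) (secondFundamentalForm m κ φ p b b) := Real.sqrt_nonneg _
  constructor
  · have := gauss_upper_bound (z := spaceFormMetric κ (φ p) (secondFundamentalForm m κ φ p a b) νn)
      hc0 hN (alphaNorm_nonneg p) hq0 hA hg0 hI (hx _) (hx _)
    linarith
  · have := gauss_lower_bound ha0 hN (alphaNorm_nonneg p) hq0
      hq1 hα hg0 hI (hx _) (hx _) (hx (secondFundamentalForm m κ φ p a b))
    linarith

end Param

/-! ### Length spaces and the Hopf–Rinow theorem -/

section LengthSpace

variable {X : Type*} [MetricSpace X]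

/-- `X` is a length space: points at distance less than `a + b` have a point in between, at
distance at most `a` from the one and at most `b` from the other. For complete spaces this is
equivalent to the distance being the infimum of the lengths of curves. -/
def HasApproxBetween (X : Type*) [MetricSpace X] : Prop :=
  ∀ (x y : X) (a b : ℝ), 0 ≤ a → 0 ≤ b → dist x y < a + b → ∃ z, dist x z ≤ a ∧ dist z y ≤ b

lemma HasApproxBetween.closedBall_subset_cthickening (hX : HasApproxBetween X) (x : X) {R s ε : ℝ}
    (hR : 0 ≤ R) (hε : 0 ≤ ε) (hs : s < R + ε) :
    Metric.closedBall x s ⊆ Metric.cthickening ε (Metric.closedBall x R) := fun y hy => by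
  obtain ⟨z, hz1, hz2⟩ := hX x y R ε hR hε (by
    rw [dist_comm]; exact lt_of_le_of_lt (Metric.mem_closedBall.1 hy) hs)
  exact Metric.mem_cthickening_of_dist_le y z ε _ (by rwa [Metric.mem_closedBall, dist_comm])
    (by rwa [dist_comm])

/-- The metric part of the Hopf–Rinow theorem. -/
lemma HasApproxBetween.properSpace (hX : HasApproxBetween X) [CompleteSpace X]
    [LocallyCompactSpace X] : ProperSpace X := by
  refine ⟨fun x => ?_⟩
  by_contra! hcon
  obtain ⟨R₀, hR₀⟩ := hcon
  set A : Set ℝ := {R | 0 ≤ R ∧ IsCompact (Metric.closedBall x R)} with hA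
  have hA0 : (0 : ℝ) ∈ A := ⟨le_rfl, by simp⟩
  have hAb : ∀ R ∈ A, R ≤ R₀ := fun R hR => by
    by_contra! h
    exact hR₀ (hR.2.of_isClosed_subset Metric.isClosed_closedBall
      (Metric.closedBall_subset_closedBall h.le))
  have hbdd : BddAbove A := ⟨R₀, hAb⟩
  have hs0 : 0 ≤ sSup A := le_csSup hbdd hA0
  -- the closed ball of the supremal radius is totally bounded, being near smaller compact balls
  have hcomp : IsCompact (Metric.closedBall x (sSup A)) := by
    refine isCompact_iff_totallyBounded_isComplete.2 ⟨?_, Metric.isClosed_closedBall.isComplete⟩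
    refine Metric.totallyBounded_iff.2 fun ε hε => ?_
    obtain ⟨R, hR, hRs⟩ := exists_lt_of_lt_csSup ⟨0, hA0⟩ (show sSup A - ε / 2 < sSup A by linarith)
    obtain ⟨t, ht, htc⟩ := Metric.totallyBounded_iff.1 hR.2.totallyBounded (ε / 2) (by linarith)
    refine ⟨t, ht, fun y hy => ?_⟩
    obtain ⟨z, hz1, hz2⟩ := hX x y R (ε / 2) hR.1 (by linarith) (by
      rw [dist_comm]; have := Metric.mem_closedBall.1 hy; linarith)
    have hz := htc (show z ∈ Metric.closedBall x R by rwa [Metric.mem_closedBall, dist_comm])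
    simp only [mem_iUnion, Metric.mem_ball] at hz ⊢
    obtain ⟨w, hw, hzw⟩ := hz
    refine ⟨w, hw, ?_⟩
    have := dist_triangle y z w
    rw [dist_comm y z] at this
    linarith
  obtain ⟨δ, hδ, hδc⟩ := hcomp.exists_isCompact_cthickening
  have h1 : sSup A + δ / 2 ∈ A := ⟨by linarith, hδc.of_isClosed_subset Metric.isClosed_closedBall
    (hX.closedBall_subset_cthickening x hs0 hδ.le (by linarith))⟩
  have := le_csSup hbdd h1
  linarith

/-- In a proper length space any two points are joined by points at prescribed distances. -/
lemma HasApproxBetween.exists_between (hX : HasApproxBetween X) [ProperSpace X] (x y : X)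
    {a b : ℝ} (ha : 0 ≤ a) (hb : 0 ≤ b) (hab : a + b = dist x y) :
    ∃ z, dist x z = a ∧ dist z y = b := by
  obtain ⟨z, hz, hmin⟩ := (isCompact_closedBall y b).exists_isMinOn
    ⟨y, Metric.mem_closedBall_self hb⟩ (f := fun z => dist x z) (by fun_prop)
  have h1 : dist x z ≤ a := le_of_forall_pos_le_add fun ε hε => by
    obtain ⟨w, hw1, hw2⟩ := hX x y (a + ε) b (by linarith) hb (by linarith)
    exact (hmin (Metric.mem_closedBall.2 hw2)).trans hw1
  have h2 : dist z y ≤ b := Metric.mem_closedBall.1 hz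
  have h3 := dist_triangle x z y
  exact ⟨z, by linarith, by linarith⟩

end LengthSpace

section Riemannian

variable {m : ℕ} {M : Type*} [MetricSpace M] [ChartedSpace (EuclideanSpace ℝ (Fin m)) M]
  [RiemannianBundle (fun x : M => TangentSpace (𝓡 m) x)]
  [IsRiemannianManifold (𝓡 m) M]

lemma exists_path_of_dist_lt {x y : M} {r : ℝ} (h : dist x y < r) :
    ∃ γ : ℝ → M, γ 0 = x ∧ γ 1 = y ∧ ContMDiff 𝓘(ℝ, ℝ) (𝓡 m) 1 γ ∧
      pathELength (𝓡 m) γ 0 1 < ENNReal.ofReal r := by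
  have h1 : riemannianEDist (𝓡 m) x y < ENNReal.ofReal r := by
    rw [← IsRiemannianManifold.out (I := 𝓡 m), edist_dist]
    exact (ENNReal.ofReal_lt_ofReal_iff (dist_nonneg.trans_lt h)).2 h
  obtain ⟨γ, h0, h1, h2, h3, -⟩ := exists_lt_locally_constant_of_riemannianEDist_lt h1
    (zero_lt_one (α := ℝ))
  exact ⟨γ, h0, h1, h2, h3⟩

lemma ofReal_dist_le_pathELength {γ : ℝ → M} (hγ : ContMDiff 𝓘(ℝ, ℝ) (𝓡 m) 1 γ) {a b : ℝ}
    (hab : a ≤ b) : ENNReal.ofReal (dist (γ a) (γ b)) ≤ pathELength (𝓡 m) γ a b := by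
  rw [← edist_dist, IsRiemannianManifold.out (I := 𝓡 m)]
  exact riemannianEDist_le_pathELength hγ.contMDiffOn rfl rfl hab

lemma hasApproxBetween_of_isRiemannianManifold (m : ℕ) (M : Type*) [MetricSpace M]
    [ChartedSpace (EuclideanSpace ℝ (Fin m)) M]
    [RiemannianBundle (fun x : M => TangentSpace (𝓡 m) x)]
    [IsRiemannianManifold (𝓡 m) M] : HasApproxBetween M := fun x y a b ha hb hlt => by
  by_cases hxa : dist x y ≤ a
  · exact ⟨y, hxa, by simpa using hb⟩
  push Not at hxa
  obtain ⟨γ, h0, h1, hγ, hL⟩ := exists_path_of_dist_lt (m := m) hlt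
  have hc : ContinuousOn (fun s => dist x (γ s)) (Icc 0 1) :=
    (continuous_const.dist hγ.continuous).continuousOn
  obtain ⟨s, hs, hsa⟩ := intermediate_value_Icc zero_le_one hc
    (show a ∈ Icc (dist x (γ 0)) (dist x (γ 1)) by
      rw [h0, h1, dist_self]; exact ⟨ha, hxa.le⟩)
  refine ⟨γ s, hsa.le, ?_⟩
  have h2 := ofReal_dist_le_pathELength hγ hs.1
  have h3 := ofReal_dist_le_pathELength hγ hs.2
  rw [h0] at h2
  rw [h1] at h3
  have h4 := add_le_add h2 h3
  rw [pathELength_add hs.1 hs.2, ← ENNReal.ofReal_add dist_nonneg dist_nonneg] at h4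
  have h5 := (ENNReal.ofReal_lt_ofReal_iff (by linarith)).1 (h4.trans_lt hL)
  change dist x (γ s) = a at hsa
  linarith

end Riemannian

/-! ### First variation in coordinates -/

section Variation

variable {E : Type*} [NormedAddCommGroup E] [NormedSpace ℝ E]

lemma abs_bilin_le (B : E →L[ℝ] E →L[ℝ] ℝ) (v w : E) : |B v w| ≤ ‖B‖ * ‖v‖ * ‖w‖ :=
  B.le_opNorm₂ v w

/-- The pointwise second-order estimate behind the first variation formula. Here `B` and `B'` are
the metrics at `y` and at `y - τ s W`, `D` is the differential of the metric at `y`, `A` that of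
the vector field, and `D W v v + 2 B (A v) v` is the Lie derivative of the metric along the vector
field, evaluated on `(v, v)`. -/
lemma variation_estimate {B B' : E →L[ℝ] E →L[ℝ] ℝ} {D : E →L[ℝ] E →L[ℝ] E →L[ℝ] ℝ} {W : E}
    {A : E →L[ℝ] E} {K c b τ s σ : ℝ} {v : E} (hB : ∀ v w, B v w = B w v)
    (hB' : ∀ v w, B' v w = B' w v) (hK : 0 < K) (hc : 0 < c) (hb : 0 ≤ b) (hτ : 0 ≤ τ)
    (hs : s ∈ Icc (0 : ℝ) 1) (h1 : ‖B' - B‖ ≤ K * (τ * K))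
    (h2 : ‖B' - B + (τ * s) • D W‖ ≤ K * (τ * K) ^ 2) (h3 : ‖B‖ ≤ K) (h4 : ‖B'‖ ≤ K)
    (h5 : ‖W‖ ≤ K) (h6 : ‖A‖ ≤ K) (h7 : c * ‖v‖ ^ 2 ≤ B v v)
    (h8 : b * ‖v‖ ^ 2 ≤ D W v v + 2 * B (A v) v) :
    B' (v - τ • (s • A v + σ • W)) (v - τ • (s • A v + σ • W)) ≤
      B v v - 2 * τ * (s * (b / (2 * K)) * B v v + σ * B W v)
        + 6 * K ^ 3 * (1 / c + 1) * τ ^ 2 * (B v v + σ ^ 2) := by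
  obtain ⟨hs0, hs1⟩ := hs
  set a := s • A v + σ • W with ha
  have hna : ‖a‖ ≤ K * (‖v‖ + |σ|) := by
    have e1 : ‖s • A v‖ ≤ K * ‖v‖ := by
      rw [norm_smul, Real.norm_of_nonneg hs0]
      calc s * ‖A v‖ ≤ 1 * (K * ‖v‖) := by
            gcongr
            exact (A.le_opNorm v).trans (by gcongr)
        _ = _ := one_mul _
    have e2 : ‖σ • W‖ ≤ |σ| * K := by
      rw [norm_smul, Real.norm_eq_abs]; gcongr
    calc ‖a‖ ≤ ‖s • A v‖ + ‖σ • W‖ := norm_add_le _ _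
      _ ≤ K * ‖v‖ + |σ| * K := add_le_add e1 e2
      _ = _ := by ring
  have e1 : (B' - B + (τ * s) • D W) v v ≤ K * (τ * K) ^ 2 * ‖v‖ ^ 2 := by
    refine (le_abs_self _).trans ((abs_bilin_le _ v v).trans ?_)
    rw [mul_assoc, ← sq]; gcongr
  have e2 : -((B' - B) v a) ≤ K * (τ * K) * ‖v‖ * (K * (‖v‖ + |σ|)) := by
    refine (neg_le_abs _).trans ((abs_bilin_le _ v a).trans ?_)
    gcongr
  have e3 : B' a a ≤ K * (K * (‖v‖ + |σ|)) ^ 2 := by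
    refine (le_abs_self _).trans ((abs_bilin_le _ a a).trans ?_)
    rw [mul_assoc, ← sq]; gcongr
  have hexp : B' (v - τ • a) (v - τ • a) = B v v - τ * (s * (D W v v + 2 * B (A v) v))
      - 2 * τ * (σ * B W v) + (B' - B + (τ * s) • D W) v v + 2 * τ * -((B' - B) v a)
      + τ ^ 2 * B' a a := by
    have e4 : B v a = s * B (A v) v + σ * B W v := by
      rw [ha]; simp only [map_add, map_smul, smul_eq_mul]; rw [hB v (A v), hB v W]
    simp only [map_sub, map_smul, sub_apply, add_apply,
      smul_apply, smul_eq_mul]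
    rw [hB' a v, e4]
    ring
  have hx : B v v ≤ K * ‖v‖ ^ 2 := by
    refine (le_abs_self _).trans ((abs_bilin_le _ v v).trans ?_)
    rw [mul_assoc, ← sq]; gcongr
  have e5 : s * (b / K) * B v v ≤ s * (D W v v + 2 * B (A v) v) := by
    rw [mul_assoc]
    refine mul_le_mul_of_nonneg_left (le_trans ?_ h8) hs0
    rw [div_mul_eq_mul_div, div_le_iff₀ hK]
    nlinarith
  have e6 : ‖v‖ ^ 2 ≤ 1 / c * B v v := by
    rw [one_div, inv_mul_eq_div, le_div_iff₀ hc]; linarith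
  have hBv : 0 ≤ B v v := le_trans (by positivity) h7
  have e7 : K * (τ * K) ^ 2 * ‖v‖ ^ 2 + 2 * τ * (K * (τ * K) * ‖v‖ * (K * (‖v‖ + |σ|)))
      + τ ^ 2 * (K * (K * (‖v‖ + |σ|)) ^ 2) ≤ 6 * K ^ 3 * τ ^ 2 * (‖v‖ ^ 2 + σ ^ 2) := by
    have : ‖v‖ ^ 2 + 2 * (‖v‖ * (‖v‖ + |σ|)) + (‖v‖ + |σ|) ^ 2 ≤ 6 * (‖v‖ ^ 2 + σ ^ 2) := by
      nlinarith [sq_nonneg (‖v‖ - |σ|), sq_abs σ, sq_nonneg σ]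
    calc _ = K ^ 3 * τ ^ 2 * (‖v‖ ^ 2 + 2 * (‖v‖ * (‖v‖ + |σ|)) + (‖v‖ + |σ|) ^ 2) := by ring
      _ ≤ K ^ 3 * τ ^ 2 * (6 * (‖v‖ ^ 2 + σ ^ 2)) := by gcongr
      _ = _ := by ring
  have e8 : 6 * K ^ 3 * τ ^ 2 * (‖v‖ ^ 2 + σ ^ 2) ≤
      6 * K ^ 3 * (1 / c + 1) * τ ^ 2 * (B v v + σ ^ 2) := by
    have : ‖v‖ ^ 2 + σ ^ 2 ≤ (1 / c + 1) * (B v v + σ ^ 2) := by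
      have : 0 ≤ 1 / c * σ ^ 2 := by positivity
      nlinarith
    calc _ ≤ 6 * K ^ 3 * τ ^ 2 * ((1 / c + 1) * (B v v + σ ^ 2)) := by gcongr
      _ = _ := by ring
  have e9 : τ * (s * (b / K) * B v v) ≤ τ * (s * (D W v v + 2 * B (A v) v)) :=
    mul_le_mul_of_nonneg_left e5 hτ
  have e10 : 2 * τ * -((B' - B) v a) ≤ 2 * τ * (K * (τ * K) * ‖v‖ * (K * (‖v‖ + |σ|))) :=
    mul_le_mul_of_nonneg_left e2 (by positivity)
  have e11 : τ ^ 2 * B' a a ≤ τ ^ 2 * (K * (K * (‖v‖ + |σ|)) ^ 2) :=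
    mul_le_mul_of_nonneg_left e3 (by positivity)
  have e12 : b / (2 * K) = (b / K) / 2 := by field_simp
  rw [hexp, e12]
  linarith

set_option maxSynthPendingDepth 3 in
lemma exists_pos_mul_norm_sq_le [FiniteDimensional ℝ E] {B : E →L[ℝ] E →L[ℝ] ℝ}
    (hB : ∀ v, v ≠ 0 → 0 < B v v) : ∃ c > 0, ∀ v, c * ‖v‖ ^ 2 ≤ B v v := by
  have := FiniteDimensional.proper ℝ E
  rcases subsingleton_or_nontrivial E with hE | hE
  · exact ⟨1, one_pos, fun v => by simp [Subsingleton.elim v 0]⟩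
  obtain ⟨u, hu, hmin⟩ := (isCompact_sphere (0 : E) 1).exists_isMinOn
    (NormedSpace.sphere_nonempty.2 zero_le_one) (f := fun v => B v v) (by fun_prop)
  have hu1 : ‖u‖ = 1 := by simpa using hu
  refine ⟨B u u, hB u (by rintro rfl; simp at hu1), fun v => ?_⟩
  rcases eq_or_ne v 0 with rfl | hv
  · simp
  have hv' : 0 < ‖v‖ := norm_pos_iff.2 hv
  have h := hmin (show ‖v‖⁻¹ • v ∈ Metric.sphere (0 : E) 1 by
    simp [norm_smul, hv'.ne'])
  simp only [mem_ofPred_eq, map_smul, smul_apply, smul_eq_mul] at h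
  rw [← le_div_iff₀ (by positivity)]
  calc B u u ≤ ‖v‖⁻¹ * (‖v‖⁻¹ * B v v) := h
    _ = _ := by field_simp

lemma ContinuousAt.eventually_norm_sub_lt {F : Type*} [NormedAddCommGroup F] {X : Type*}
    [TopologicalSpace X]
    {B : X → F} {x : X} (hB : ContinuousAt B x) {ε : ℝ} (hε : 0 < ε) :
    ∀ᶠ y in 𝓝 x, ‖B y - B x‖ < ε := by
  filter_upwards [hB.eventually (Metric.ball_mem_nhds (B x) hε)] with y hy
  exact mem_ball_iff_norm.1 hy

set_option maxSynthPendingDepth 3 in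
/-- Coercivity is an open condition. -/
lemma eventually_mul_norm_sq_le [FiniteDimensional ℝ E] {X : Type*} [TopologicalSpace X]
    {B : X → E →L[ℝ] E →L[ℝ] ℝ} {x : X} (hB : ContinuousAt B x)
    (hpos : ∀ v, v ≠ 0 → 0 < B x v v) : ∃ c > 0, ∀ᶠ y in 𝓝 x, ∀ v, c * ‖v‖ ^ 2 ≤ B y v v := by
  obtain ⟨c, hc, h⟩ := exists_pos_mul_norm_sq_le hpos
  refine ⟨c / 2, by positivity, ?_⟩
  have hcont := ContinuousAt.eventually_norm_sub_lt (F := E →L[ℝ] E →L[ℝ] ℝ) hB (half_pos hc)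
  filter_upwards [hcont] with y hy v
  have h1 : -((B y - B x) v v) ≤ c / 2 * ‖v‖ ^ 2 := by
    refine (neg_le_abs _).trans ((abs_bilin_le _ v v).trans ?_)
    rw [mul_assoc, ← sq]; gcongr
  simp only [sub_apply] at h1
  linarith [h v]

/-- First-order Taylor expansion with quadratic remainder, uniformly near a point. -/
lemma ContDiffAt.exists_ball_taylor {F : Type*} [NormedAddCommGroup F] [NormedSpace ℝ F]
    {f : E → F} {x : E} (hf : ContDiffAt ℝ ∞ f x) :
    ∃ K > 0, ∃ ρ > 0, ∀ y ∈ Metric.ball x ρ, ∀ z ∈ Metric.ball x ρ,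
      ‖f z - f y‖ ≤ K * ‖z - y‖ ∧ ‖f z - f y - fderiv ℝ f y (z - y)‖ ≤ K * ‖z - y‖ ^ 2 := by
  obtain ⟨K₁, t₁, ht₁, hL₁⟩ :=
    (hf.of_le (m := 1) (by exact_mod_cast le_top)).exists_lipschitzOnWith
  obtain ⟨K₂, t₂, ht₂, hL₂⟩ :=
    ((hf.fderiv_right (m := ∞) (by simp)).of_le (m := 1)
      (by exact_mod_cast le_top)).exists_lipschitzOnWith
  have hd : ∀ᶠ y in 𝓝 x, DifferentiableAt ℝ f y :=
    ((hf.of_le (m := 1) (by exact_mod_cast le_top)).eventually (by simp)).mono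
      fun y hy => hy.differentiableAt one_ne_zero
  obtain ⟨ρ, hρ, hsub⟩ := Metric.mem_nhds_iff.1 (inter_mem (inter_mem ht₁ ht₂) hd)
  refine ⟨K₁ + K₂ + 1, by positivity, ρ, hρ, fun y hy z hz => ⟨?_, ?_⟩⟩
  · refine (hL₁.norm_sub_le (hsub hz).1.1 (hsub hy).1.1).trans ?_
    gcongr
    linarith [K₂.2, NNReal.coe_nonneg K₂]
  · have hseg : segment ℝ y z ⊆ Metric.ball x ρ := (convex_ball x ρ).segment_subset hy hz
    have := (convex_segment y z).norm_image_sub_le_of_norm_hasFDerivWithin_le' (f := f)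
      (f' := fderiv ℝ f) (φ := fderiv ℝ f y) (C := K₂ * ‖z - y‖)
      (fun w hw => ((hsub (hseg hw)).2.hasFDerivAt).hasFDerivWithinAt)
      (fun w hw => (hL₂.norm_sub_le (hsub (hseg hw)).1.2 (hsub hy).1.2).trans (by
        gcongr; exact norm_sub_le_of_mem_segment hw)) (left_mem_segment ℝ y z)
      (right_mem_segment ℝ y z)
    refine this.trans ?_
    rw [mul_assoc, ← sq]
    gcongr
    linarith [NNReal.coe_nonneg K₁]

end Variation

section Variation

variable {E : Type*} [NormedAddCommGroup E] [NormedSpace ℝ E]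

lemma ContinuousAt.eventually_norm_le {F : Type*} [NormedAddCommGroup F] {X : Type*}
    [TopologicalSpace X] {f : X → F} {x : X} (hf : ContinuousAt f x) :
    ∀ᶠ y in 𝓝 x, ‖f y‖ ≤ ‖f x‖ + 1 :=
  (hf.eventually_norm_sub_lt one_pos).mono fun y hy => by
    have := norm_le_norm_add_norm_sub' (f y) (f x)
    linarith

set_option maxSynthPendingDepth 3 in
/-- If the Lie derivative of the metric `G` along `W` is positive definite at `y₀`, then moving
curves near `y₀` along `-W` shortens them, uniformly near `y₀`. -/
lemma exists_ball_variation_estimate [FiniteDimensional ℝ E] {G : E → E →L[ℝ] E →L[ℝ] ℝ}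
    {W : E → E} {y₀ : E} (hG : ContDiffAt ℝ ∞ G y₀) (hW : ContDiffAt ℝ ∞ W y₀)
    (hsymm : ∀ y v w, G y v w = G y w v) (hpos : ∀ v, v ≠ 0 → 0 < G y₀ v v)
    (hLie : ∀ v, v ≠ 0 → 0 < fderiv ℝ G y₀ (W y₀) v v + 2 * G y₀ (fderiv ℝ W y₀ v) v) :
    ∃ δ > 0, ∃ C ≥ 0, ∃ ρ > 0, ∃ τ₀ > 0, ∀ y ∈ Metric.ball y₀ ρ, ∀ τ ∈ Icc (0 : ℝ) τ₀,
      ∀ s ∈ Icc (0 : ℝ) 1, ∀ (v : E) (σ : ℝ),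
        G (y - τ • (s • W y)) (v - τ • (s • fderiv ℝ W y v + σ • W y))
            (v - τ • (s • fderiv ℝ W y v + σ • W y)) ≤
          G y v v - 2 * τ * (s * δ * G y v v + σ * G y (W y) v)
            + C * τ ^ 2 * (G y v v + σ ^ 2) := by
  have hDG : ContDiffAt ℝ ∞ (fderiv ℝ G) y₀ := hG.fderiv_right (by simp)
  have hDW : ContDiffAt ℝ ∞ (fderiv ℝ W) y₀ := hW.fderiv_right (by simp)
  have hLc : ContDiffAt ℝ ∞
      (fun y => fderiv ℝ G y (W y) + (2 : ℝ) • (G y).comp (fderiv ℝ W y)) y₀ :=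
    (hDG.clm_apply hW).add ((hG.clm_comp hDW).const_smul (2 : ℝ))
  obtain ⟨K₁, hK₁, ρ₁, hρ₁, hT⟩ := ContDiffAt.exists_ball_taylor (F := E →L[ℝ] E →L[ℝ] ℝ) hG
  obtain ⟨c, hc, hce⟩ := eventually_mul_norm_sq_le hG.continuousAt hpos
  obtain ⟨b, hb, hbe⟩ := eventually_mul_norm_sq_le hLc.continuousAt
    (fun v hv => by simpa using hLie v hv)
  have bd1 : ∀ᶠ y in 𝓝 y₀, ‖G y‖ ≤ ‖G y₀‖ + 1 :=
    ContinuousAt.eventually_norm_le (F := E →L[ℝ] E →L[ℝ] ℝ) hG.continuousAt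
  have bd2 : ∀ᶠ y in 𝓝 y₀, ‖W y‖ ≤ ‖W y₀‖ + 1 := hW.continuousAt.eventually_norm_le
  have bd3 : ∀ᶠ y in 𝓝 y₀, ‖fderiv ℝ W y‖ ≤ ‖fderiv ℝ W y₀‖ + 1 :=
    ContinuousAt.eventually_norm_le (F := E →L[ℝ] E) hDW.continuousAt
  set K := K₁ + (‖G y₀‖ + 1) + (‖W y₀‖ + 1) + (‖fderiv ℝ W y₀‖ + 1) with hKdef
  have hK : 0 < K := by positivity
  have n1 := norm_nonneg (G y₀)
  have n2 := norm_nonneg (W y₀)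
  have n3 := norm_nonneg (fderiv ℝ W y₀)
  obtain ⟨ρ₂, hρ₂, hsub⟩ := Metric.eventually_nhds_iff_ball.1
    (hce.and (hbe.and (bd1.and (bd2.and bd3))))
  have hmin : 0 < min ρ₁ ρ₂ := lt_min hρ₁ hρ₂
  refine ⟨b / (2 * K), by positivity, 6 * K ^ 3 * (1 / c + 1), by positivity, min ρ₁ ρ₂ / 2,
    half_pos hmin, min ρ₁ ρ₂ / 2 / K, by positivity, fun y hy τ hτ s hs v σ => ?_⟩
  have hτK : τ * K ≤ min ρ₁ ρ₂ / 2 := (le_div_iff₀ hK).1 hτ.2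
  have hy2 : y ∈ Metric.ball y₀ ρ₂ := Metric.ball_subset_ball (by
    linarith [min_le_right ρ₁ ρ₂]) hy
  obtain ⟨q1, q2, q3, q4, q5⟩ := hsub y hy2
  have hW' : ‖W y‖ ≤ K := by linarith
  set y' := y - τ • (s • W y) with hy'
  have hyy : y' - y = -((τ * s) • W y) := by rw [hy', smul_smul]; abel
  have hd : ‖y' - y‖ ≤ τ * K := by
    rw [hyy, norm_neg, norm_smul, Real.norm_of_nonneg (mul_nonneg hτ.1 hs.1)]
    calc τ * s * ‖W y‖ ≤ τ * 1 * K := by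
          gcongr
          · exact mul_nonneg hτ.1 zero_le_one
          · exact hτ.1
          · exact hs.2
      _ = τ * K := by ring
  have hball : ∀ z, ‖z - y‖ ≤ τ * K → z ∈ Metric.ball y₀ (min ρ₁ ρ₂) := fun z hz => by
    rw [Metric.mem_ball] at hy ⊢
    have := dist_triangle z y y₀
    rw [dist_eq_norm z y] at this
    linarith
  have hy1' : y' ∈ Metric.ball y₀ ρ₁ := Metric.ball_subset_ball (min_le_left _ _) (hball y' hd)
  have hy2' : y' ∈ Metric.ball y₀ ρ₂ := Metric.ball_subset_ball (min_le_right _ _) (hball y' hd)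
  have hy1 : y ∈ Metric.ball y₀ ρ₁ := Metric.ball_subset_ball (by
    linarith [min_le_left ρ₁ ρ₂]) hy
  obtain ⟨t1, t2⟩ := hT y hy1 y' hy1'
  have hKK : K₁ ≤ K := by linarith
  refine variation_estimate (hsymm y) (hsymm y') hK hc hb.le hτ.1 hs
    (t1.trans (mul_le_mul hKK hd (norm_nonneg _) hK.le)) ?_ (by linarith)
    ((hsub y' hy2').2.2.1.trans (by linarith)) hW' (by linarith) (q1 v) (by simpa using q2 v)
    (D := fderiv ℝ G y)
  have e : G y' - G y + (τ * s) • fderiv ℝ G y (W y) = G y' - G y - fderiv ℝ G y (y' - y) := by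
    rw [hyy, map_neg, map_smul, sub_neg_eq_add]
  rw [e]
  exact t2.trans (mul_le_mul hKK (by gcongr) (by positivity) hK.le)

/-- The resulting bound for the speed: `n`, `Q` are the squares of the old and new speed, and the
square root is estimated by the inequality of the arithmetic and the geometric mean. -/
lemma sqrt_variation_le {n Q g δ C τ s L : ℝ} (hn : 0 ≤ n) (hg : n = 0 → g = 0) (hQ0 : 0 ≤ Q)
    (hQ : Q ≤ n ^ 2 - 2 * τ * (s * δ * n ^ 2 + n / L * g) + C * τ ^ 2 * (n ^ 2 + (n / L) ^ 2)) :
    √Q ≤ n - τ * (δ * s * n + g / L) + C * τ ^ 2 * (1 + 1 / L ^ 2) / 2 * n := by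
  rcases hn.eq_or_lt with rfl | hn
  · rw [hg rfl, Real.sqrt_eq_zero_of_nonpos (by simpa using hQ)]; simp
  · have h1 : √Q ≤ (Q / n + n) / 2 := by
      have := Real.sq_sqrt hQ0
      rw [le_div_iff₀ two_pos, div_add' _ _ _ hn.ne', le_div_iff₀ hn]
      nlinarith [sq_nonneg (√Q - n)]
    have h2 := div_le_div_of_nonneg_right hQ hn.le
    have h3 : (n ^ 2 - 2 * τ * (s * δ * n ^ 2 + n / L * g) + C * τ ^ 2 * (n ^ 2 + (n / L) ^ 2)) / n
        = 2 * (n - τ * (δ * s * n + g / L) + C * τ ^ 2 * (1 + 1 / L ^ 2) / 2 * n) - n := by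
      field_simp; ring
    linarith

end Variation

/-! ### Curves in the Riemannian manifold -/

section Curves

variable {m n : ℕ} {κ : ℝ} {M : Type*} [MetricSpace M] [ChartedSpace (EuclideanSpace ℝ (Fin m)) M]
  [RiemannianBundle (fun x : M => TangentSpace (𝓡 m) x)] {φ : M → SpaceForm n} {γ : ℝ → M}

/-- The speed of a curve at time `t`. -/
noncomputable def speed (m : ℕ) {M : Type*} [MetricSpace M]
    [ChartedSpace (EuclideanSpace ℝ (Fin m)) M]
    [RiemannianBundle (fun x : M => TangentSpace (𝓡 m) x)] (γ : ℝ → M) (t : ℝ) : ℝ :=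
  ‖(mfderiv 𝓘(ℝ, ℝ) (𝓡 m) γ t 1 : TangentSpace (𝓡 m) (γ t))‖

lemma speed_eq (hφ : IsIsometricImmersion m κ φ) {t : ℝ}
    (hγ : MDifferentiableAt 𝓘(ℝ, ℝ) (𝓡 m) γ t) :
    speed m γ t = √(spaceFormMetric κ (φ (γ t)) (deriv (φ ∘ γ) t) (deriv (φ ∘ γ) t)) := by
  have h2 : MDifferentiableAt (𝓡 m) 𝓘(ℝ, SpaceForm n) φ (γ t) :=
    hφ.contMDiff.mdifferentiableAt (by simp)
  have h3 := mfderiv_comp t h2 hγ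
  rw [mfderiv_eq_fderiv] at h3
  have h4 : deriv (φ ∘ γ) t = pushforward m φ (γ t) (mfderiv 𝓘(ℝ, ℝ) (𝓡 m) γ t 1) :=
    DFunLike.congr_fun h3 (1 : ℝ)
  rw [h4, hφ.isometric, real_inner_self_eq_norm_sq, Real.sqrt_sq (norm_nonneg _)]
  rfl

lemma pathELength_eq_speed (γ : ℝ → M) (a b : ℝ) :
    pathELength (𝓡 m) γ a b = ∫⁻ t in Ioo a b, ENNReal.ofReal (speed m γ t) := by
  rw [pathELength_eq_lintegral_mfderiv_Ioo]
  refine MeasureTheory.setLIntegral_congr_fun measurableSet_Ioo fun t _ => ?_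
  exact (ofReal_norm _).symm

lemma continuous_speed (hκ : κ ≤ 0) (hφ : IsIsometricImmersion m κ φ)
    (hγ : ContMDiff 𝓘(ℝ, ℝ) (𝓡 m) 1 γ) : Continuous (speed m γ) := by
  have h1 : ContDiff ℝ 1 (φ ∘ γ) := by
    rw [← contMDiff_iff_contDiff]
    exact (hφ.contMDiff.of_le (by simp)).comp hγ
  have h2 : speed m γ = fun t =>
      √(spaceFormMetric κ ((φ ∘ γ) t) (deriv (φ ∘ γ) t) (deriv (φ ∘ γ) t)) :=
    funext fun t => speed_eq hφ (hγ.mdifferentiableAt one_ne_zero)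
  have h3 : Continuous (deriv (φ ∘ γ)) := h1.continuous_deriv le_rfl
  rw [h2]
  exact ((((contDiff_spaceFormMetric hκ).continuous.comp h1.continuous).clm_apply h3).clm_apply
    h3).sqrt

/-- The arclength of a `C¹` curve as an interval integral. -/
lemma pathELength_eq_ofReal_integral_speed (hκ : κ ≤ 0) (hφ : IsIsometricImmersion m κ φ)
    (hγ : ContMDiff 𝓘(ℝ, ℝ) (𝓡 m) 1 γ) {a b : ℝ} (hab : a ≤ b) :
    pathELength (𝓡 m) γ a b = ENNReal.ofReal (∫ t in a..b, speed m γ t) := by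
  have hc := continuous_speed hκ hφ hγ
  rw [pathELength_eq_speed, intervalIntegral.integral_of_le hab,
    MeasureTheory.integral_Ioc_eq_integral_Ioo, MeasureTheory.ofReal_integral_eq_lintegral_ofReal
      (hc.continuousOn.integrableOn_Icc.mono_set Ioo_subset_Icc_self)
      (Eventually.of_forall fun t => norm_nonneg _)]

/-- A curve whose speed is at most the derivative of `P` is not longer than the increment
of `P`. -/
lemma dist_le_of_speed_le [IsRiemannianManifold (𝓡 m) M]
    (hγ : ContMDiffOn 𝓘(ℝ, ℝ) (𝓡 m) 1 γ (Icc 0 1)) {P P' : ℝ → ℝ}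
    (hP : ∀ t ∈ Icc (0 : ℝ) 1, HasDerivAt P (P' t) t) (hc : ContinuousOn P' (Icc 0 1))
    (hle : ∀ t ∈ Ioo (0 : ℝ) 1, speed m γ t ≤ P' t) : dist (γ 0) (γ 1) ≤ P 1 - P 0 := by
  have hint : ∫ t in (0 : ℝ)..1, P' t = P 1 - P 0 :=
    intervalIntegral.integral_eq_sub_of_hasDerivAt (fun t ht => hP t (by
      rwa [uIcc_of_le zero_le_one] at ht)) (hc.intervalIntegrable_of_Icc zero_le_one)
  have hnn : ∀ t ∈ Ioo (0 : ℝ) 1, 0 ≤ P' t := fun t ht => (norm_nonneg _).trans (hle t ht)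
  have h0 : 0 ≤ P 1 - P 0 := by
    rw [← hint, intervalIntegral.integral_of_le zero_le_one,
      MeasureTheory.integral_Ioc_eq_integral_Ioo]
    exact MeasureTheory.setIntegral_nonneg measurableSet_Ioo hnn
  have h1 : ENNReal.ofReal (dist (γ 0) (γ 1)) ≤ pathELength (𝓡 m) γ 0 1 := by
    rw [← edist_dist, IsRiemannianManifold.out (I := 𝓡 m)]
    exact riemannianEDist_le_pathELength hγ rfl rfl zero_le_one
  have h2 : pathELength (𝓡 m) γ 0 1 ≤ ENNReal.ofReal (P 1 - P 0) := by
    rw [pathELength_eq_speed, ← hint, intervalIntegral.integral_of_le zero_le_one,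
      MeasureTheory.integral_Ioc_eq_integral_Ioo, MeasureTheory.ofReal_integral_eq_lintegral_ofReal
      (hc.integrableOn_Icc.mono_set Ioo_subset_Icc_self)
      ((MeasureTheory.ae_restrict_iff' measurableSet_Ioo).2 (Eventually.of_forall hnn))]
    exact MeasureTheory.setLIntegral_mono' measurableSet_Ioo fun t ht =>
      ENNReal.ofReal_le_ofReal (hle t ht)
  exact (ENNReal.ofReal_le_ofReal_iff h0).1 (h1.trans h2)

end Curves

/-! ### First variation of the distance -/

section FirstVariation

variable {m n : ℕ} {κ : ℝ} {M : Type*} [MetricSpace M] [ChartedSpace (EuclideanSpace ℝ (Fin m)) M]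
  [IsManifold (𝓡 m) ∞ M]
  [RiemannianBundle (fun x : M => TangentSpace (𝓡 m) x)] {φ : M → SpaceForm n} {γ : ℝ → M}

/-- The speed of a curve given in the chart at `z`, computed with the metric in coordinates. -/
lemma speed_extChartAt_symm_comp (hφ : IsIsometricImmersion m κ φ) (z : M)
    {c : ℝ → EuclideanSpace ℝ (Fin m)} {c' : EuclideanSpace ℝ (Fin m)} {t : ℝ}
    (hc : HasDerivAt c c' t) (hct : c t ∈ (extChartAt (𝓡 m) z).target) :
    speed m ((extChartAt (𝓡 m) z).symm ∘ c) t =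
      √(pullbackMetric κ (chartMap m φ z) (c t) c' c') := by
  have h1 : MDifferentiableAt 𝓘(ℝ, ℝ) (𝓡 m) ((extChartAt (𝓡 m) z).symm ∘ c) t := by
    have h2 : MDifferentiableAt 𝓘(ℝ, EuclideanSpace ℝ (Fin m)) (𝓡 m)
        (extChartAt (𝓡 m) z).symm (c t) :=
      (((contMDiffOn_extChartAt_symm (I := 𝓡 m) (n := ∞) z) _ hct).contMDiffAt
        ((isOpen_extChartAt_target z).mem_nhds hct)).mdifferentiableAt (by simp)
    exact h2.comp t hc.differentiableAt.mdifferentiableAt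
  have h3 : HasDerivAt (φ ∘ ((extChartAt (𝓡 m) z).symm ∘ c))
      (fderiv ℝ (chartMap m φ z) (c t) c') t :=
    ((contDiffAt_chartMap hφ.contMDiff z hct).differentiableAt (by simp)).hasFDerivAt.comp_hasDerivAt
      t hc
  rw [speed_eq hφ h1, h3.deriv, pullbackMetric_apply]
  rfl

lemma hasDerivAt_comp_of_extChartAt (hφ : IsIsometricImmersion m κ φ) (z : M) {t : ℝ}
    (hγ : ContMDiffAt 𝓘(ℝ, ℝ) (𝓡 m) 1 γ t) (ht : γ t ∈ (extChartAt (𝓡 m) z).source) :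
    deriv (φ ∘ γ) t = fderiv ℝ (chartMap m φ z) (extChartAt (𝓡 m) z (γ t))
      (deriv (extChartAt (𝓡 m) z ∘ γ) t) ∧ ContDiffAt ℝ 1 (extChartAt (𝓡 m) z ∘ γ) t := by
  have hc : ContDiffAt ℝ 1 (extChartAt (𝓡 m) z ∘ γ) t := by
    rw [← contMDiffAt_iff_contDiffAt]
    exact ((contMDiffAt_extChartAt' (I := 𝓡 m) (n := ∞) (x := z) (by simpa using ht)).of_le
      (by simp)).comp t hγ
  refine ⟨?_, hc⟩
  have h1 : φ ∘ γ =ᶠ[𝓝 t] chartMap m φ z ∘ (extChartAt (𝓡 m) z ∘ γ) := by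
    filter_upwards [hγ.continuousAt.eventually ((isOpen_extChartAt_source z).mem_nhds ht)] with s hs
    simp only [chartMap, Function.comp_apply]
    rw [(extChartAt (𝓡 m) z).left_inv hs]
  rw [h1.deriv_eq]
  exact ((((contDiffAt_chartMap hφ.contMDiff z ((extChartAt (𝓡 m) z).map_source ht)).differentiableAt
    (by simp)).hasFDerivAt).comp_hasDerivAt t
      (hc.differentiableAt one_ne_zero).hasDerivAt).deriv

/-- A one-sided form of the first variation formula for the distance, with quadratic error. The
point `z`, with coordinate `y₀`, is moved along `-W`, where `W` is near `y₀` the gradient of the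
function `f`, whose Hessian is half the Lie derivative of the metric along `W`; its positivity
gives the gain `δ d / 2`. -/
lemma exists_dist_flow_le [IsRiemannianManifold (𝓡 m) M] (hκ : κ ≤ 0)
    (hφ : IsIsometricImmersion m κ φ) {f : SpaceForm n → ℝ} (hf : ContDiff ℝ ∞ f) (z : M)
    {W : EuclideanSpace ℝ (Fin m) → EuclideanSpace ℝ (Fin m)}
    (hW : ContDiffAt ℝ ∞ W (extChartAt (𝓡 m) z z))
    (hgrad : ∀ᶠ y in 𝓝 (extChartAt (𝓡 m) z z), ∀ v,
      pullbackMetric κ (chartMap m φ z) y (W y) v = fderiv ℝ (f ∘ chartMap m φ z) y v)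
    (hLie : ∀ v, v ≠ 0 → 0 <
      fderiv ℝ (pullbackMetric κ (chartMap m φ z)) (extChartAt (𝓡 m) z z)
          (W (extChartAt (𝓡 m) z z)) v v +
        2 * pullbackMetric κ (chartMap m φ z) (extChartAt (𝓡 m) z z)
          (fderiv ℝ W (extChartAt (𝓡 m) z z) v) v) :
    ∃ h₀ > 0, ∃ δ > 0, ∃ C ≥ 0, ∃ τ₀ > 0, ∀ x, 0 < dist x z → dist x z < h₀ →
      ∀ τ ∈ Icc (0 : ℝ) τ₀,
        dist x ((extChartAt (𝓡 m) z).symm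
            (extChartAt (𝓡 m) z z - τ • W (extChartAt (𝓡 m) z z))) ≤
          dist x z - τ * (δ / 2 * dist x z + (f (φ z) - f (φ x)) / dist x z)
            + C * τ ^ 2 * (1 + 1 / dist x z ^ 2) / 2 * dist x z := by
  set χ := extChartAt (𝓡 m) z with hχ
  set y₀ := χ z with hy₀
  set Φ := chartMap m φ z with hΦ
  set G := pullbackMetric κ Φ with hG
  have hy₀t : y₀ ∈ χ.target := mem_extChartAt_target z
  have hΦs : ∀ y ∈ χ.target, ContDiffAt ℝ ∞ Φ y := fun y hy => contDiffAt_chartMap hφ.contMDiff z hy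
  have hposG : ∀ v, v ≠ 0 → 0 < G y₀ v v := fun v hv => by
    rw [hG, pullbackMetric_chartMap hφ]
    exact real_inner_self_pos.2 (by simpa using hv)
  obtain ⟨δ, hδ, C, hC, ρ, hρ, τ₁, hτ₁, hvar⟩ := exists_ball_variation_estimate
    (ContDiffAt.pullbackMetric hκ (hΦs y₀ hy₀t)) hW
    (fun y v w => pullbackMetric_symm κ Φ y v w) hposG hLie
  have hWe : ∀ᶠ y in 𝓝 y₀, ContDiffAt ℝ 1 W y :=
    (hW.of_le (m := 1) (by simp)).eventually (by simp)
  have hte : ∀ᶠ y in 𝓝 y₀, y ∈ χ.target := (isOpen_extChartAt_target z).mem_nhds hy₀t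
  have hbe : ∀ᶠ y in 𝓝 y₀, y ∈ Metric.ball y₀ ρ := Metric.ball_mem_nhds y₀ hρ
  obtain ⟨ρ', hρ', hsub⟩ := Metric.eventually_nhds_iff_ball.1
    (hWe.and (hte.and (hgrad.and (hW.continuousAt.eventually_norm_le.and hbe))))
  set K := ‖W y₀‖ + 1 with hK
  have hK0 : 0 < K := by positivity
  have hse : ∀ᶠ x in 𝓝 z, x ∈ χ.source := extChartAt_source_mem_nhds (I := 𝓡 m) z
  have hsrc : ∀ᶠ x in 𝓝 z, x ∈ χ.source ∧ χ x ∈ Metric.ball y₀ (ρ' / 2) :=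
    hse.and
      ((continuousAt_extChartAt (I := 𝓡 m) z).eventually
        (Metric.ball_mem_nhds y₀ (by positivity)))
  obtain ⟨h₀, hh₀, hball⟩ := Metric.eventually_nhds_iff_ball.1 hsrc
  refine ⟨h₀, hh₀, δ, hδ, C, hC, min τ₁ (ρ' / 2 / K), by positivity, fun x hx0 hxh τ hτ => ?_⟩
  have hτ1 : τ ∈ Icc (0 : ℝ) τ₁ := ⟨hτ.1, hτ.2.trans (min_le_left _ _)⟩
  have hτK : τ * K ≤ ρ' / 2 := (le_div_iff₀ hK0).1 (hτ.2.trans (min_le_right _ _))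
  set w := χ.symm (y₀ - τ • W y₀) with hw
  set Ψ : ℝ → ℝ := fun L => L - τ * (δ / 2 * L + (f (φ z) - f (φ x)) / L)
    + C * τ ^ 2 * (1 + 1 / L ^ 2) / 2 * L with hΨ
  -- it suffices to treat curves from `x` to `z` of length close to the distance
  suffices H : ∀ r, dist x z < r → r < h₀ → ∃ L, dist x z ≤ L ∧ L < r ∧ dist x w ≤ Ψ L by
    by_contra! hcon
    have hcont : ContinuousAt Ψ (dist x z) := by
      have := hx0.ne'
      fun_prop (disch := positivity)
    obtain ⟨ε, hε, hεb⟩ := Metric.eventually_nhds_iff_ball.1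
      (hcont.eventually_lt continuousAt_const hcon)
    obtain ⟨L, hL1, hL2, hL3⟩ := H (min (dist x z + ε) ((dist x z + h₀) / 2))
      (lt_min (by linarith) (by linarith)) ((min_le_right _ _).trans_lt (by linarith))
    refine hL3.not_gt (hεb L ?_)
    rw [Metric.mem_ball, Real.dist_eq, abs_of_nonneg (by linarith)]
    linarith [min_le_left (dist x z + ε) ((dist x z + h₀) / 2)]
  intro r hr1 hr2
  obtain ⟨γ, hγ0, hγ1, hγ, hlen⟩ := exists_path_of_dist_lt (m := m) hr1
  set ν := speed m γ with hν
  have hνc : Continuous ν := continuous_speed hκ hφ hγ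
  have hν0 : ∀ t, 0 ≤ ν t := fun t => norm_nonneg _
  set ℓ : ℝ → ℝ := fun t => ∫ s in (0 : ℝ)..t, ν s with hℓ
  have hℓd : ∀ t, HasDerivAt ℓ (ν t) t := fun t =>
    (hνc.integral_hasStrictDerivAt 0 t).hasDerivAt
  have hℓ0 : ℓ 0 = 0 := intervalIntegral.integral_same
  have hℓm : Monotone ℓ := monotone_of_hasDerivAt_nonneg hℓd hν0
  set L := ℓ 1 with hL
  have hlen' : pathELength (𝓡 m) γ 0 1 = ENNReal.ofReal L :=
    pathELength_eq_ofReal_integral_speed hκ hφ hγ zero_le_one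
  have hLr : L < r := (ENNReal.ofReal_lt_ofReal_iff (hx0.trans hr1)).1 (hlen' ▸ hlen)
  have hL0' : 0 ≤ L := by rw [← hℓ0]; exact hℓm zero_le_one
  have hdL : dist x z ≤ L := by
    have h := ofReal_dist_le_pathELength hγ (zero_le_one (α := ℝ))
    rw [hlen', hγ0, hγ1] at h
    exact (ENNReal.ofReal_le_ofReal_iff hL0').1 h
  have hL0 : 0 < L := hx0.trans_le hdL
  refine ⟨L, hdL, hLr, ?_⟩
  have hγb : ∀ t ∈ Icc (0 : ℝ) 1, γ t ∈ Metric.ball z h₀ := fun t ht => by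
    have h := (ofReal_dist_le_pathELength hγ ht.2).trans (pathELength_mono ht.1 le_rfl)
    rw [hlen', hγ1] at h
    exact ((ENNReal.ofReal_le_ofReal_iff hL0').1 h).trans_lt (hLr.trans hr2)
  set c : ℝ → EuclideanSpace ℝ (Fin m) := χ ∘ γ with hc
  have hcb : ∀ t ∈ Icc (0 : ℝ) 1, c t ∈ Metric.ball y₀ (ρ' / 2) := fun t ht =>
    (hball _ (hγb t ht)).2
  have hcb' : ∀ t ∈ Icc (0 : ℝ) 1, c t ∈ Metric.ball y₀ ρ' := fun t ht =>
    Metric.ball_subset_ball (by linarith) (hcb t ht)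
  have hcd : ∀ t ∈ Icc (0 : ℝ) 1, deriv (φ ∘ γ) t = fderiv ℝ Φ (c t) (deriv c t) ∧
      ContDiffAt ℝ 1 c t := fun t ht =>
    hasDerivAt_comp_of_extChartAt hφ z hγ.contMDiffAt (hball _ (hγb t ht)).1
  have hφγ : ∀ t ∈ Icc (0 : ℝ) 1, Φ (c t) = φ (γ t) := fun t ht => by
    simp only [hΦ, chartMap, hc, Function.comp_apply]
    rw [χ.left_inv (hball _ (hγb t ht)).1]
  have hνG : ∀ t ∈ Icc (0 : ℝ) 1, ν t ^ 2 = G (c t) (deriv c t) (deriv c t) := fun t ht => by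
    rw [hν, speed_eq hφ (hγ.mdifferentiableAt one_ne_zero), (hcd t ht).1, hG,
      pullbackMetric_apply, hφγ t ht, Real.sq_sqrt (spaceFormMetric_nonneg hκ _ _)]
  have hφγd : ContDiff ℝ 1 (φ ∘ γ) := by
    rw [← contMDiff_iff_contDiff]
    exact (hφ.contMDiff.of_le (by simp)).comp hγ
  have hu : ContDiff ℝ 1 (f ∘ (φ ∘ γ)) := (hf.of_le (by simp)).comp hφγd
  set u := f ∘ (φ ∘ γ) with hudef
  have hud : ∀ t, HasDerivAt u (deriv u t) t := fun t =>
    (hu.differentiable one_ne_zero t).hasDerivAt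
  have hGu : ∀ t ∈ Icc (0 : ℝ) 1, G (c t) (W (c t)) (deriv c t) = deriv u t := fun t ht => by
    rw [(hsub _ (hcb' t ht)).2.2.1]
    have h1 : HasFDerivAt (f ∘ Φ) ((fderiv ℝ f (Φ (c t))).comp (fderiv ℝ Φ (c t))) (c t) :=
      ((hf.differentiable (by simp) _).hasFDerivAt).comp (c t)
        ((hΦs _ (hsub _ (hcb' t ht)).2.1).differentiableAt (by simp)).hasFDerivAt
    have h2 : HasDerivAt u (fderiv ℝ f (φ (γ t)) (deriv (φ ∘ γ) t)) t :=
      ((hf.differentiable (by simp) _).hasFDerivAt).comp_hasDerivAt t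
        (hφγd.differentiable one_ne_zero t).hasDerivAt
    rw [h1.fderiv, h2.deriv, (hcd t ht).1, ← hφγ t ht]
    rfl
  -- the curve is moved along `-W`, by an amount proportional to the arc length from `x`; so `x` is
  -- fixed and `z` moves to `w`
  set cτ : ℝ → EuclideanSpace ℝ (Fin m) := fun t => c t - τ • ((ℓ t / L) • W (c t)) with hcτ
  have hs : ∀ t ∈ Icc (0 : ℝ) 1, ℓ t / L ∈ Icc (0 : ℝ) 1 := fun t ht =>
    ⟨div_nonneg (hℓ0 ▸ hℓm ht.1) hL0.le, (div_le_one hL0).2 (hℓm ht.2)⟩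
  have hcτb : ∀ t ∈ Icc (0 : ℝ) 1, cτ t ∈ χ.target := fun t ht => by
    refine (hsub _ ?_).2.1
    have h1 : ‖τ • ((ℓ t / L) • W (c t))‖ ≤ τ * K := by
      rw [norm_smul, norm_smul, Real.norm_of_nonneg hτ.1, Real.norm_of_nonneg (hs t ht).1]
      have h2 : ‖W (c t)‖ ≤ K := (hsub _ (hcb' t ht)).2.2.2.1
      have h3 : ℓ t / L * ‖W (c t)‖ ≤ 1 * K :=
        mul_le_mul (hs t ht).2 h2 (norm_nonneg _) zero_le_one
      rw [one_mul] at h3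
      exact mul_le_mul_of_nonneg_left h3 hτ.1
    have h2 := hcb t ht
    rw [mem_ball_iff_norm] at h2 ⊢
    have h3 : cτ t - y₀ = (c t - y₀) - τ • ((ℓ t / L) • W (c t)) := by simp only [hcτ]; abel
    rw [h3]
    have := norm_sub_le (c t - y₀) (τ • ((ℓ t / L) • W (c t)))
    linarith
  have hcτd : ∀ t ∈ Icc (0 : ℝ) 1, HasDerivAt cτ (deriv c t - τ • ((ℓ t / L) •
      fderiv ℝ W (c t) (deriv c t) + (ν t / L) • W (c t))) t := fun t ht => by
    have h1 : HasDerivAt c (deriv c t) t := ((hcd t ht).2.differentiableAt one_ne_zero).hasDerivAt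
    have h2 : HasDerivAt (fun t => W (c t)) (fderiv ℝ W (c t) (deriv c t)) t :=
      (((hsub _ (hcb' t ht)).1.differentiableAt one_ne_zero).hasFDerivAt).comp_hasDerivAt t h1
    exact h1.sub ((((hℓd t).div_const L).smul h2).const_smul τ)
  have hcτs : ∀ t ∈ Icc (0 : ℝ) 1, ContDiffAt ℝ 1 cτ t := fun t ht => by
    have h1 : ContDiffAt ℝ 1 (fun t => W (c t)) t := (hsub _ (hcb' t ht)).1.comp t (hcd t ht).2
    have h2 : ContDiff ℝ 1 ℓ := contDiff_one_iff_deriv.2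
      ⟨fun t => (hℓd t).differentiableAt, by
        rw [show deriv ℓ = ν from funext fun t => (hℓd t).deriv]; exact hνc⟩
    exact (hcd t ht).2.sub (((h2.contDiffAt.div_const L).smul h1).const_smul τ)
  have hγτ : ContMDiffOn 𝓘(ℝ, ℝ) (𝓡 m) 1 (χ.symm ∘ cτ) (Icc 0 1) := fun t ht => by
    have h1 : ContMDiffAt 𝓘(ℝ, EuclideanSpace ℝ (Fin m)) (𝓡 m) 1 χ.symm (cτ t) :=
      (((contMDiffOn_extChartAt_symm (I := 𝓡 m) (n := ∞) z) _ (hcτb t ht)).contMDiffAt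
        ((isOpen_extChartAt_target z).mem_nhds (hcτb t ht))).of_le (by simp)
    exact (h1.comp t (contMDiffAt_iff_contDiffAt.2 (hcτs t ht))).contMDiffWithinAt
  have hend0 : (χ.symm ∘ cτ) 0 = x := by
    simp only [Function.comp_apply, hcτ, hℓ0, zero_div, zero_smul, smul_zero, sub_zero, hc]
    rw [χ.left_inv (hball _ (hγb 0 (by simp))).1, hγ0]
  have hend1 : (χ.symm ∘ cτ) 1 = w := by
    simp only [Function.comp_apply, hcτ, hc, hγ1]
    rw [← hL, div_self hL0.ne', one_smul]
  -- a bound on the speed of the varied curve, and a primitive of it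
  set P' : ℝ → ℝ := fun t => ν t - τ * (δ * (ℓ t / L) * ν t + deriv u t / L)
    + C * τ ^ 2 * (1 + 1 / L ^ 2) / 2 * ν t with hP'
  set P : ℝ → ℝ := fun t => ℓ t - τ * (δ / (2 * L) * ℓ t ^ 2 + u t / L)
    + C * τ ^ 2 * (1 + 1 / L ^ 2) / 2 * ℓ t with hP
  have hPd : ∀ t ∈ Icc (0 : ℝ) 1, HasDerivAt P (P' t) t := fun t _ => by
    have h1 := ((hℓd t).sub (((((hℓd t).pow 2).const_mul (δ / (2 * L))).add
      ((hud t).div_const L)).const_mul τ)).add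
      ((hℓd t).const_mul (C * τ ^ 2 * (1 + 1 / L ^ 2) / 2))
    refine h1.congr_deriv ?_
    simp only [hP']
    field_simp
    ring
  have hℓc : Continuous ℓ := continuous_iff_continuousAt.2 fun t => (hℓd t).continuousAt
  have hP'c : Continuous P' := by
    have := hu.continuous_deriv le_rfl
    fun_prop
  have hkey := dist_le_of_speed_le hγτ hPd hP'c.continuousOn fun t ht => by
    have ht' := Ioo_subset_Icc_self ht
    rw [speed_extChartAt_symm_comp hφ z (hcτd t ht') (hcτb t ht')]
    refine sqrt_variation_le (hν0 t) (fun h0 => ?_) (pullbackMetric_nonneg hκ _) ?_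
    · have h1 : fderiv ℝ Φ (c t) (deriv c t) = 0 := by
        by_contra hne
        have h2 := spaceFormMetric_pos hκ (Φ (c t)) _ hne
        rw [← pullbackMetric_apply] at h2
        have := hνG t ht'
        rw [h0] at this
        simp only [hG] at this
        linarith
      rw [← hGu t ht', hG, pullbackMetric_apply, h1, map_zero]
    · rw [hνG t ht', ← hGu t ht']
      exact hvar (c t) (hsub _ (hcb' t ht')).2.2.2.2 τ hτ1 (ℓ t / L) (hs t ht') (deriv c t) (ν t / L)
        |>.trans (by rw [← hνG t ht'])
  rw [hend0, hend1] at hkey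
  refine hkey.trans (le_of_eq ?_)
  simp only [hP, hΨ, hudef, Function.comp_apply, hγ0, hγ1, hℓ0, ← hL]
  field_simp
  ring

end FirstVariation

/-! ### Convexity of the potential -/

section Gradient

variable {E : Type*} [NormedAddCommGroup E] [NormedSpace ℝ E]

set_option maxSynthPendingDepth 3 in
lemma contDiffAt_rieszVector [FiniteDimensional ℝ E] {G : E → E →L[ℝ] E →L[ℝ] ℝ}
    {L : E → E →L[ℝ] ℝ} {y : E} (hG : ContDiffAt ℝ ∞ G y) (hL : ContDiffAt ℝ ∞ L y)
    (hpos : ∀ v, v ≠ 0 → 0 < G y v v) : ContDiffAt ℝ ∞ (fun z => rieszVector (G z) (L z)) y := by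
  have h1 : ContDiffAt ℝ ∞ (fun z => (G z).inverse) y :=
    (isInvertible_of_pos hpos).contDiffAt_map_inverse.comp y hG
  exact h1.clm_apply hL

set_option maxSynthPendingDepth 3 in
/-- The Lie derivative of the metric `G` along the gradient `W` of `f` is twice the Hessian
of `f`. -/
lemma lieDerivative_gradient {G : E → E →L[ℝ] E →L[ℝ] ℝ} {W : E → E} {f : E → ℝ} {y : E}
    (hG : DifferentiableAt ℝ G y) (hW : DifferentiableAt ℝ W y)
    (hf : DifferentiableAt ℝ (fderiv ℝ f) y)
    (hgrad : ∀ᶠ z in 𝓝 y, ∀ v, G z (W z) v = fderiv ℝ f z v) (v : E) :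
    fderiv ℝ G y (W y) v v + 2 * G y (fderiv ℝ W y v) v =
      2 * (fderiv ℝ (fderiv ℝ f) y v v - christoffelFirst G y v v (W y)) +
        2 * (fderiv ℝ G y v v (W y) - fderiv ℝ G y v (W y) v) := by
  have h1 : HasFDerivAt (fun z => G z (W z) v) _ y :=
    ((hG.hasFDerivAt.clm_apply hW.hasFDerivAt).clm_apply (hasFDerivAt_const v y))
  have h2 : HasFDerivAt (fun z => fderiv ℝ f z v) _ y :=
    hf.hasFDerivAt.clm_apply (hasFDerivAt_const v y)
  have h3 : (fun z => G z (W z) v) =ᶠ[𝓝 y] fun z => fderiv ℝ f z v := hgrad.mono fun z hz => hz v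
  have h4 := DFunLike.congr_fun (h1.unique (h2.congr_of_eventuallyEq h3)) v
  simp only [christoffelFirst, smul_apply, add_apply, sub_apply, ContinuousLinearMap.flip_apply,
    smul_eq_mul]
  simp at h4
  linarith

end Gradient

lemma nonpos_of_mul_le_sq_mul {a B τ₀ : ℝ} (hτ₀ : 0 < τ₀)
    (h : ∀ τ ∈ Icc (0 : ℝ) τ₀, τ * a ≤ τ ^ 2 * B) : a ≤ 0 := by
  by_contra! ha
  have hB : 0 < |B| + 1 := by positivity
  set τ := min τ₀ (a / (|B| + 1)) with hτ
  have hτ0 : 0 < τ := lt_min hτ₀ (by positivity)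
  have h1 := h τ ⟨hτ0.le, min_le_left _ _⟩
  have h2 : τ * (|B| + 1) ≤ a := (le_div_iff₀ hB).1 (min_le_right _ _)
  have h3 : a ≤ τ * B := le_of_mul_le_mul_left (by linarith [sq τ, mul_assoc τ τ B]) hτ0
  have h4 : τ * B ≤ τ * |B| := mul_le_mul_of_nonneg_left (le_abs_self B) hτ0.le
  linarith

section Convexity

variable {m n : ℕ} {κ : ℝ} {M : Type*} [MetricSpace M] [ChartedSpace (EuclideanSpace ℝ (Fin m)) M]
  [IsManifold (𝓡 m) ∞ M]
  [RiemannianBundle (fun x : M => TangentSpace (𝓡 m) x)] {φ : M → SpaceForm n}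

/-- Where `S_κ(r) ‖α‖ < C_κ(r)`, the potential of the distance to `o` has positive definite Hessian
along the immersion. The points `w τ` are obtained by following its negative gradient. -/
lemma exists_dist_potential_flow_le [IsRiemannianManifold (𝓡 m) M] (hκ : κ ≤ 0)
    (hφ : IsIsometricImmersion m κ φ) (o : SpaceForm n) (z : M)
    (hz : sinK κ (extrinsicDist κ φ o z) * alphaNorm m κ φ z < cosK κ (extrinsicDist κ φ o z)) :
    ∃ w : ℝ → M, (tangentPart m κ φ z (gradPotential κ o (φ z)) = 0 → ∀ τ, w τ = z) ∧
      ∃ h₀ > 0, ∃ δ > 0, ∃ C ≥ 0, ∃ τ₀ > 0, ∀ x, 0 < dist x z → dist x z < h₀ →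
        ∀ τ ∈ Icc (0 : ℝ) τ₀, dist x (w τ) ≤ dist x z - τ * (δ / 2 * dist x z +
            (potential κ o (φ z) - potential κ o (φ x)) / dist x z)
          + C * τ ^ 2 * (1 + 1 / dist x z ^ 2) / 2 * dist x z := by
  set y₀ := extChartAt (𝓡 m) z z with hy₀
  set Φ := chartMap m φ z with hΦ
  have hΦs : ContDiffAt ℝ ∞ Φ y₀ := contDiffAt_chartMap hφ.contMDiff z (mem_extChartAt_target z)
  have hG : ContDiffAt ℝ ∞ (pullbackMetric κ Φ) y₀ := ContDiffAt.pullbackMetric hκ hΦs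
  have hposG : ∀ v, v ≠ 0 → 0 < pullbackMetric κ Φ y₀ v v := fun v hv => by
    rw [pullbackMetric_chartMap hφ]
    exact real_inner_self_pos.2 (by simpa using hv)
  have hfs : ContDiffAt ℝ ∞ (potential κ o ∘ Φ) y₀ :=
    (contDiff_potential hκ o).contDiffAt.comp y₀ hΦs
  have hDf : ContDiffAt ℝ ∞ (fderiv ℝ (potential κ o ∘ Φ)) y₀ := hfs.fderiv_right (by simp)
  set W := fun y => rieszVector (pullbackMetric κ Φ y) (fderiv ℝ (potential κ o ∘ Φ) y) with hWdef
  have hW : ContDiffAt ℝ ∞ W y₀ := contDiffAt_rieszVector hG hDf hposG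
  have hgrad : ∀ᶠ y in 𝓝 y₀, ∀ v,
      pullbackMetric κ Φ y (W y) v = fderiv ℝ (potential κ o ∘ Φ) y v := by
    obtain ⟨c, hc, hce⟩ := eventually_mul_norm_sq_le hG.continuousAt hposG
    filter_upwards [hce] with y hy v
    refine apply_rieszVector (fun v hv => lt_of_lt_of_le ?_ (hy v)) _ v
    have := norm_pos_iff.2 hv
    positivity
  set b := gradPotential κ o (φ z) with hb
  have hΦy : Φ y₀ = φ z := chartMap_apply_self φ z
  have hWb : toTangent z (W y₀) = tangentPart m κ φ z b := by
    refine ext_inner_right ℝ fun v => ?_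
    obtain ⟨v, rfl⟩ := (toTangent z).surjective v
    rw [← pullbackMetric_chartMap hφ, hgrad.self_of_nhds v, inner_tangentPart,
      pushforward_toTangent hφ.contMDiff, hb, ← hΦy]
    exact fderiv_potential_comp hκ o (hΦs.differentiableAt (by simp)) v
  have hLie : ∀ v, v ≠ 0 → 0 < fderiv ℝ (pullbackMetric κ Φ) y₀ (W y₀) v v +
      2 * pullbackMetric κ Φ y₀ (fderiv ℝ W y₀ v) v := fun v hv => by
    have hsym : fderiv ℝ (pullbackMetric κ Φ) y₀ v v (W y₀) =
        fderiv ℝ (pullbackMetric κ Φ) y₀ v (W y₀) v := by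
      rw [fderiv_pullbackMetric hκ hΦs, fderiv_pullbackMetric hκ hΦs,
        spaceFormMetric_symm κ (Φ y₀) (covariantHessian κ Φ y₀ v v),
        spaceFormMetric_symm κ (Φ y₀) (covariantHessian κ Φ y₀ v (W y₀))]
      ring
    rw [lieDerivative_gradient (hG.differentiableAt (by simp)) (hW.differentiableAt (by simp))
      (hDf.differentiableAt (by simp)) hgrad, hsym, sub_self, mul_zero, add_zero,
      christoffelFirst_pullbackMetric hκ hΦs]
    have h1 : fderiv ℝ (fderiv ℝ (potential κ o ∘ Φ)) y₀ v v = _ :=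
      fderiv_fderiv_potential_comp hκ o hΦs v v
    rw [h1, ← pushforward_toTangent hφ.contMDiff, hWb, hΦy, ← hb]
    set A := covariantHessian κ Φ y₀ v v with hA
    have h2 : spaceFormMetric κ (φ z) b A -
        spaceFormMetric κ (φ z) A (pushforward m φ z (tangentPart m κ φ z b)) =
        spaceFormMetric κ (φ z) (secondFundamentalForm m κ φ z (toTangent z v) (toTangent z v))
          (normalPart m κ φ z b) := by
      rw [secondFundamentalForm_toTangent hκ hφ, ← hΦ, ← hy₀, ← hA, spaceFormMetric_symm _ _ b,
        spaceFormMetric_symm _ _ (normalPart m κ φ z A),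
        spaceFormMetric_normalPart_normalPart hφ z b A,
        normalPart_eq φ z b, map_sub, sub_apply, spaceFormMetric_symm _ _ b A,
        spaceFormMetric_symm _ _ (pushforward m φ z _) A]
    -- the Hessian in direction `v` is `C_κ(r) |v|² + ⟨α(v, v), grad⟩`, and the normal part of the
    -- gradient of the potential has length at most `S_κ(r)`
    have h3 := abs_spaceFormMetric_le hκ (φ z)
      (secondFundamentalForm m κ φ z (toTangent z v) (toTangent z v)) (normalPart m κ φ z b)
    have h4 := spaceFormNorm_secondFundamentalForm_le hκ hφ z (toTangent z v)
    have hS := sinK_nonneg (κ := κ) (spaceFormDist_nonneg hκ o (φ z))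
    have h5 : spaceFormNorm κ (φ z) (normalPart m κ φ z b) ≤ sinK κ (extrinsicDist κ φ o z) := by
      refine abs_le_of_sq_le_sq' ?_ hS |>.2
      have h6 := spaceFormMetric_self_eq hφ z b
      change _ ≤ sinK κ (spaceFormDist κ o (φ z)) ^ 2
      rw [spaceFormNorm_sq hκ, sinK_spaceFormDist_sq hκ,
        ← spaceFormMetric_gradPotential_self hκ, ← hb]
      nlinarith [sq_nonneg ‖tangentPart m κ φ z b‖]
    have h7 : pullbackMetric κ Φ y₀ v v = ‖toTangent z v‖ ^ 2 := by
      rw [hΦ, hy₀, pullbackMetric_chartMap hφ, real_inner_self_eq_norm_sq]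
    have h8 : 1 - κ * potential κ o (φ z) = cosK κ (extrinsicDist κ φ o z) :=
      (cosK_spaceFormDist hκ o _).symm
    have h9 : 0 < ‖toTangent z v‖ ^ 2 := h7 ▸ hposG v hv
    have h10 : spaceFormNorm κ (φ z)
        (secondFundamentalForm m κ φ z (toTangent z v) (toTangent z v)) *
          spaceFormNorm κ (φ z) (normalPart m κ φ z b) ≤
        alphaNorm m κ φ z * ‖toTangent z v‖ ^ 2 * sinK κ (extrinsicDist κ φ o z) :=
      mul_le_mul h4 h5 (Real.sqrt_nonneg _) (mul_nonneg (alphaNorm_nonneg z) h9.le)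
    have h11 := neg_le_of_abs_le (h3.trans h10)
    have h12 := mul_lt_mul_of_pos_right hz h9
    rw [h7, h8]
    linarith
  refine ⟨fun τ => (extChartAt (𝓡 m) z).symm (y₀ - τ • W y₀), fun h0 τ => ?_,
    exists_dist_flow_le hκ hφ (contDiff_potential hκ o) z hW hgrad hLie⟩
  have hW0 : W y₀ = 0 := (toTangent z).injective ((hWb.trans h0).trans (map_zero _).symm)
  change (extChartAt (𝓡 m) z).symm (y₀ - τ • W y₀) = z
  rw [hW0, smul_zero, sub_zero, hy₀, extChartAt_to_inv]

/-- Where `S_κ(r) ‖α‖ < C_κ(r)`, the potential lies below the average of its values at the ends of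
any short minimal segment centred at the point. -/
lemma exists_potential_midpoint_lt [IsRiemannianManifold (𝓡 m) M] (hκ : κ ≤ 0)
    (hφ : IsIsometricImmersion m κ φ) (o : SpaceForm n) (z : M)
    (hz : sinK κ (extrinsicDist κ φ o z) * alphaNorm m κ φ z < cosK κ (extrinsicDist κ φ o z)) :
    ∃ h₀ > 0, ∀ x y, 0 < dist x z → dist x z < h₀ → dist y z = dist x z →
      dist x y = 2 * dist x z →
        2 * potential κ o (φ z) < potential κ o (φ x) + potential κ o (φ y) := by
  -- both ends of the segment are compared with the same flowed point `w τ`, to first order in `τ`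
  obtain ⟨w, -, h₀, hh₀, δ, hδ, C, hC, τ₀, hτ₀, hfl⟩ := exists_dist_potential_flow_le hκ hφ o z hz
  refine ⟨h₀, hh₀, fun x y hx0 hxh hyx hxy => ?_⟩
  have hx := hfl x hx0 hxh
  have hy := hfl y (hyx ▸ hx0) (hyx ▸ hxh)
  rw [hyx] at hy
  set h := dist x z with hh
  have hlim : ∀ τ ∈ Icc (0 : ℝ) τ₀,
      τ * (δ * h + (2 * potential κ o (φ z) - (potential κ o (φ x) + potential κ o (φ y))) / h) ≤
        τ ^ 2 * (C * (1 + 1 / h ^ 2) * h) := fun τ hτ => by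
    have h1 := hx τ hτ
    have h2 := hy τ hτ
    have h3 := dist_triangle_right x y (w τ)
    have e : C * τ ^ 2 * (1 + 1 / h ^ 2) / 2 * h = τ ^ 2 * (C * (1 + 1 / h ^ 2) * h) / 2 := by ring
    have e' : τ * (δ / 2 * h + (potential κ o (φ z) - potential κ o (φ x)) / h) +
        τ * (δ / 2 * h + (potential κ o (φ z) - potential κ o (φ y)) / h) =
        τ * (δ * h +
          (2 * potential κ o (φ z) - (potential κ o (φ x) + potential κ o (φ y))) / h) := by
      field_simp; ring
    rw [e] at h1 h2
    linarith
  have h4 := nonpos_of_mul_le_sq_mul hτ₀ hlim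
  by_contra! hcon
  have : 0 ≤ (2 * potential κ o (φ z) - (potential κ o (φ x) + potential κ o (φ y))) / h :=
    div_nonneg (by linarith) hx0.le
  have : 0 < δ * h := by positivity
  linarith

/-- Where `S_κ(r) ‖α‖ < C_κ(r)`, a critical point of the potential is a strict local minimum. -/
lemma exists_potential_lt_of_tangentPart_eq_zero [IsRiemannianManifold (𝓡 m) M] (hκ : κ ≤ 0)
    (hφ : IsIsometricImmersion m κ φ) (o : SpaceForm n) (z : M)
    (hz : sinK κ (extrinsicDist κ φ o z) * alphaNorm m κ φ z < cosK κ (extrinsicDist κ φ o z))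
    (hcrit : tangentPart m κ φ z (gradPotential κ o (φ z)) = 0) :
    ∃ h₀ > 0, ∀ x, 0 < dist x z → dist x z < h₀ →
      potential κ o (φ z) < potential κ o (φ x) := by
  -- at a critical point the flow is constant, so the first-order term must be nonpositive
  obtain ⟨w, hw, h₀, hh₀, δ, hδ, C, hC, τ₀, hτ₀, hfl⟩ := exists_dist_potential_flow_le hκ hφ o z hz
  refine ⟨h₀, hh₀, fun x hx0 hxh => ?_⟩
  have hx := hfl x hx0 hxh
  set h := dist x z with hh
  have h4 := nonpos_of_mul_le_sq_mul
    (a := δ / 2 * h + (potential κ o (φ z) - potential κ o (φ x)) / h)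
    (B := C * (1 + 1 / h ^ 2) / 2 * h) hτ₀ fun τ hτ => by
    have h1 := hx τ hτ
    rw [hw hcrit] at h1
    have e : C * τ ^ 2 * (1 + 1 / h ^ 2) / 2 * h = τ ^ 2 * (C * (1 + 1 / h ^ 2) / 2 * h) := by ring
    rw [e] at h1
    linarith
  by_contra! hcon
  have : 0 ≤ (potential κ o (φ z) - potential κ o (φ x)) / h := div_nonneg (by linarith) hx0.le
  have : 0 < δ / 2 * h := by positivity
  linarith

end Convexity

/-! ### The absence of critical points far out -/

section MaximumPrinciple

variable {X : Type*} [MetricSpace X]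

/-- A strict local minimum `p` of a function which is strictly convex outside the ball of radius `R`
about `x₀` cannot exceed the values on that ball: otherwise the maximum of the function over
the minimal segments from `p` to `x₀`, up to the ball, would be attained at an interior point. -/
lemma HasApproxBetween.false_of_strict_local_min (hX : HasApproxBetween X) [ProperSpace X]
    {f : X → ℝ} (hf : Continuous f) {x₀ p : X} {R : ℝ} (hR : 0 ≤ R)
    (hlt : ∀ z, dist z x₀ ≤ R → f z < f p)
    (hconv : ∀ z, R < dist z x₀ → ∃ h₀ > 0, ∀ x y, 0 < dist x z → dist x z < h₀ →
      dist y z = dist x z → dist x y = 2 * dist x z → 2 * f z < f x + f y)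
    (hmin : ∃ h₀ > 0, ∀ x, 0 < dist x p → dist x p < h₀ → f p < f x) : False := by
  have hpR : R < dist p x₀ := by
    by_contra! h
    exact lt_irrefl _ (hlt p h)
  set T : Set X := {z | dist p z + dist z x₀ = dist p x₀ ∧ R ≤ dist z x₀} with hT
  have hTc : IsCompact T := by
    refine (isCompact_closedBall p (dist p x₀)).of_isClosed_subset ?_ fun z hz => ?_
    · exact (isClosed_eq (f := fun z => dist p z + dist z x₀) (by fun_prop) continuous_const).inter
        (isClosed_le (g := fun z => dist z x₀) continuous_const (by fun_prop))
    · rw [Metric.mem_closedBall, dist_comm]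
      linarith [hz.1, dist_nonneg (x := z) (y := x₀)]
  have hpT : p ∈ T := ⟨by simp, hpR.le⟩
  obtain ⟨z, hz, hmax⟩ := hTc.exists_isMaxOn ⟨p, hpT⟩ hf.continuousOn
  -- `z` is neither on the ball nor equal to `p`, so it is interior to a minimal segment
  have hzR : R < dist z x₀ := by
    by_contra! h
    exact (hlt z h).not_ge (hmax hpT)
  have hzp : 0 < dist p z := by
    rw [dist_pos]
    rintro rfl
    obtain ⟨h₀, hh₀, hm⟩ := hmin
    have hh : 0 < min (h₀ / 2) (dist p x₀ - R) := lt_min (by positivity) (by linarith)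
    obtain ⟨x, hx1, hx2⟩ := hX.exists_between p x₀ (a := min (h₀ / 2) (dist p x₀ - R))
      (b := dist p x₀ - min (h₀ / 2) (dist p x₀ - R)) hh.le
      (by linarith [min_le_right (h₀ / 2) (dist p x₀ - R)]) (by ring)
    have hxT : x ∈ T := ⟨by rw [hx1, hx2]; ring, by
      rw [hx2]; linarith [min_le_right (h₀ / 2) (dist p x₀ - R)]⟩
    refine (hm x (by rw [dist_comm, hx1]; exact hh) ?_).not_ge (hmax hxT)
    rw [dist_comm, hx1]
    exact (min_le_left _ _).trans_lt (by linarith)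
  obtain ⟨h₀, hh₀, hc⟩ := hconv z hzR
  set h := min (h₀ / 2) (min (dist p z) (dist z x₀ - R)) with hh
  have hh0 : 0 < h := lt_min (by positivity) (lt_min hzp (by linarith))
  have hh1 : h < h₀ := (min_le_left _ _).trans_lt (by linarith)
  have hh2 : h ≤ dist p z := (min_le_right _ _).trans (min_le_left _ _)
  have hh3 : h ≤ dist z x₀ - R := (min_le_right _ _).trans (min_le_right _ _)
  obtain ⟨x, hx1, hx2⟩ := hX.exists_between p z (a := dist p z - h) (b := h) (by linarith) hh0.le
    (by ring)
  obtain ⟨y, hy1, hy2⟩ := hX.exists_between z x₀ (a := h) (b := dist z x₀ - h) hh0.le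
    (by linarith) (by ring)
  have hz1 : dist p z + dist z x₀ = dist p x₀ := hz.1
  -- `p`, `x`, `z`, `y`, `x₀` lie in this order on a minimal segment, `z` being the midpoint
  -- of `x` and `y`
  have e1 := dist_triangle p x x₀
  have e2 := dist_triangle x z x₀
  have e3 := dist_triangle p y x₀
  have e4 := dist_triangle p z y
  have e5 := dist_triangle x z y
  have e6 := dist_triangle4 p x y x₀
  have hxT : x ∈ T := ⟨by linarith, by linarith⟩
  have hyT : y ∈ T := ⟨by linarith, by linarith⟩
  have h1 := hc x y (by linarith) (by linarith) (by rw [dist_comm, hy1, hx2]) (by linarith)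
  have h2 : f x ≤ f z := hmax hxT
  have h3 : f y ≤ f z := hmax hyT
  linarith

end MaximumPrinciple

/-! ### The region of convexity -/

section Tamed

variable {m n : ℕ} {κ : ℝ} {M : Type*} [MetricSpace M] [ChartedSpace (EuclideanSpace ℝ (Fin m)) M]
  [RiemannianBundle (fun x : M => TangentSpace (𝓡 m) x)] {φ : M → SpaceForm n}

/-- An isometric immersion into Euclidean space is distance nonincreasing. -/
lemma norm_sub_le_dist_of_isIsometricImmersion [IsRiemannianManifold (𝓡 m) M]
    (hφ : IsIsometricImmersion m 0 φ) (x y : M) : ‖φ x - φ y‖ ≤ dist x y := by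
  refine le_of_forall_gt_imp_ge_of_dense fun r hr => ?_
  obtain ⟨γ, h0, h1, hγ, hL⟩ := exists_path_of_dist_lt (m := m) hr
  have hc : ContDiff ℝ 1 (φ ∘ γ) := by
    rw [← contMDiff_iff_contDiff]
    exact (hφ.contMDiff.of_le (by simp)).comp hγ
  have hs : ∀ t, ‖deriv (φ ∘ γ) t‖ = speed m γ t := fun t => by
    rw [speed_eq hφ (hγ.mdifferentiableAt one_ne_zero), spaceFormMetric_apply]
    simp
  have h2 : ∫ t in (0 : ℝ)..1, deriv (φ ∘ γ) t = φ y - φ x := by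
    rw [intervalIntegral.integral_deriv_eq_sub (fun t _ => hc.differentiable one_ne_zero t)
      ((hc.continuous_deriv le_rfl).intervalIntegrable _ _)]
    simp [h0, h1]
  have h3 := intervalIntegral.norm_integral_le_integral_norm (f := deriv (φ ∘ γ))
    (μ := MeasureTheory.volume) (zero_le_one (α := ℝ))
  rw [h2, norm_sub_rev] at h3
  simp only [hs] at h3
  rw [pathELength_eq_ofReal_integral_speed le_rfl hφ hγ zero_le_one] at hL
  exact h3.trans ((ENNReal.ofReal_lt_ofReal_iff (dist_nonneg.trans_lt hr)).1 hL).le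

/-- For `κ < 0`, `S_κ / C_κ` increases to `1 / √(-κ)`. -/
lemma eventually_mul_cosh_le_sinh {c k : ℝ} (hc : c < 1) (hk : 0 < k) :
    ∀ᶠ ρ in atTop, c * Real.cosh (k * ρ) ≤ Real.sinh (k * ρ) := by
  have h1 : Tendsto (fun ρ : ℝ => Real.exp (-(k * ρ))) atTop (𝓝 0) :=
    Real.tendsto_exp_neg_atTop_nhds_zero.comp (tendsto_id.const_mul_atTop hk)
  filter_upwards [h1.eventually_lt_const (sub_pos.2 hc)] with ρ hρ
  have h2 := Real.cosh_sub_sinh (k * ρ)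
  have h3 := Real.one_le_cosh (k * ρ)
  nlinarith

/-- If `a(M) < 1`, the extrinsic distance to any `o` satisfies `S_κ(r) ‖α‖ < C_κ(r)` outside a
compact set. -/
lemma exists_sinK_mul_alphaNorm_lt [IsRiemannianManifold (𝓡 m) M] [ProperSpace M] (hκ : κ ≤ 0)
    (hφ : IsIsometricImmersion m κ φ) (o : SpaceForm n) {x₀ : M}
    (ha : tamedInvariant m κ φ x₀ < 1) :
    ∃ R, 0 ≤ R ∧ ∀ x, R < dist x x₀ →
      sinK κ (extrinsicDist κ φ o x) * alphaNorm m κ φ x < cosK κ (extrinsicDist κ φ o x) := by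
  obtain ⟨c, hc1, hc2⟩ := exists_between ha
  have hev := eventually_lt_of_limsup_lt hc1
  rw [← Metric.cobounded_eq_cocompact] at hev
  obtain ⟨R₁, -, hR₁⟩ := (Metric.hasBasis_cobounded_compl_closedBall x₀).eventually_iff.1 hev
  have hc3 : c ≠ ⊤ := (hc2.trans_le le_top).ne
  set a := c.toReal with ha'
  have ha1 : a < 1 := by
    have := (ENNReal.toReal_lt_toReal hc3 ENNReal.one_ne_top).2 hc2
    simpa using this
  have ha0 : 0 ≤ a := ENNReal.toReal_nonneg
  have hR : ∀ x, R₁ < dist x x₀ →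
      sinK κ (dist x x₀) * alphaNorm m κ φ x ≤ a * cosK κ (dist x x₀) := fun x hx => by
    have h1 := (hR₁ (show x ∈ (Metric.closedBall x₀ R₁)ᶜ by simpa using hx)).le
    rw [← ENNReal.ofReal_toReal hc3, ENNReal.ofReal_le_ofReal_iff ENNReal.toReal_nonneg,
      dist_comm, div_mul_eq_mul_div, div_le_iff₀ (cosK_pos _ _)] at h1
    exact h1
  rcases hκ.lt_or_eq with hκ0 | rfl
  · have hk : 0 < √(-κ) := Real.sqrt_pos.2 (by linarith)
    have h1 := eventually_mul_cosh_le_sinh (c := (1 + a) / 2) (by linarith) hk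
    obtain ⟨R₂, hR₂⟩ := eventually_atTop.1 h1
    refine ⟨max (max R₁ R₂) 0, le_max_right _ _, fun x hx => ?_⟩
    have h2 := hR x ((le_max_left _ _).trans (le_max_left _ _) |>.trans_lt hx)
    have h3 := hR₂ (dist x x₀) ((le_max_right _ _).trans (le_max_left _ _) |>.trans hx.le)
    simp only [sinK, cosK_eq, if_pos hκ0] at h2 ⊢
    set C := Real.cosh (√(-κ) * dist x x₀) with hC
    have hC0 : 0 < C := Real.cosh_pos _
    have hα := alphaNorm_nonneg (m := m) (κ := κ) (φ := φ) x
    have h4 : alphaNorm m κ φ x / √(-κ) < 1 := by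
      have h5 : (1 + a) / 2 * C * (alphaNorm m κ φ x / √(-κ)) ≤ a * C := by
        calc _ ≤ Real.sinh (√(-κ) * dist x x₀) * (alphaNorm m κ φ x / √(-κ)) := by gcongr
          _ = Real.sinh (√(-κ) * dist x x₀) / √(-κ) * alphaNorm m κ φ x := by ring
          _ ≤ _ := h2
      by_contra! h6
      have : (1 + a) / 2 * C * 1 ≤ a * C := le_trans (by gcongr) h5
      nlinarith
    set s := √(-κ) * extrinsicDist κ φ o x with hs
    have hs0 : 0 ≤ s := mul_nonneg hk.le (spaceFormDist_nonneg hκ o _)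
    calc Real.sinh s / √(-κ) * alphaNorm m κ φ x = alphaNorm m κ φ x / √(-κ) * Real.sinh s := by
          ring
      _ ≤ 1 * Real.sinh s := by
          have := Real.sinh_nonneg_iff.2 hs0
          gcongr
      _ < Real.cosh s := by rw [one_mul]; exact Real.sinh_lt_cosh s
  · refine ⟨max (max R₁ (‖o - φ x₀‖ * a / (1 - a))) 0, le_max_right _ _, fun x hx => ?_⟩
    have h2 := hR x ((le_max_left _ _).trans (le_max_left _ _) |>.trans_lt hx)
    have h3 : ‖o - φ x₀‖ * a / (1 - a) < dist x x₀ :=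
      (le_max_right _ _).trans (le_max_left _ _) |>.trans_lt hx
    have h4 : 0 < dist x x₀ := (le_max_right _ _).trans_lt hx
    rw [div_lt_iff₀ (by linarith)] at h3
    simp only [sinK, cosK_eq, lt_irrefl, if_false, mul_one] at h2 ⊢
    have h5 : extrinsicDist 0 φ o x ≤ ‖o - φ x₀‖ + dist x x₀ := by
      have h6 : extrinsicDist 0 φ o x = ‖o - φ x‖ := by simp [extrinsicDist, spaceFormDist]
      rw [h6]
      have h7 := norm_sub_le_dist_of_isIsometricImmersion hφ x x₀
      have h8 := norm_sub_le_norm_sub_add_norm_sub o (φ x₀) (φ x)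
      rw [norm_sub_rev (φ x₀)] at h8
      linarith
    have hα := alphaNorm_nonneg (m := m) (κ := 0) (φ := φ) x
    have h9 := mul_le_mul_of_nonneg_right h5 hα
    have h10 : (‖o - φ x₀‖ + dist x x₀) * alphaNorm m 0 φ x * dist x x₀ < 1 * dist x x₀ := by
      have : (‖o - φ x₀‖ + dist x x₀) * (dist x x₀ * alphaNorm m 0 φ x) ≤
          (‖o - φ x₀‖ + dist x x₀) * a := by gcongr
      linarith
    exact h9.trans_lt (lt_of_mul_lt_mul_right h10 h4.le)

end Tamed

/-! ### Curvature of the extrinsic spheres -/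

theorem mainTheorem10 {m n : ℕ} {κ : ℝ} (hκ : κ ≤ 0)
    {M : Type*} [MetricSpace M] [ChartedSpace (EuclideanSpace ℝ (Fin m)) M]
    [IsManifold (𝓡 m) ∞ M]
    [RiemannianBundle (fun x : M => TangentSpace (𝓡 m) x)]
    [IsContMDiffRiemannianBundle (𝓡 m) ∞ (EuclideanSpace ℝ (Fin m))
      (fun x : M => TangentSpace (𝓡 m) x)]
    [IsRiemannianManifold (𝓡 m) M] [CompleteSpace M] [ConnectedSpace M]
    (φ : M → SpaceForm n) (hφ : IsIsometricImmersion m κ φ)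
    (o : SpaceForm n) (x₀ : M) (ha : tamedInvariant m κ φ x₀ < 1) :
    ∃ t₀ : ℝ, 0 < t₀ ∧
      ∀ K : Set M, IsCompact K → ∀ V : Set M, IsEnd K V → ∀ t : ℝ, t₀ < t →
        ∀ p ∈ frontier (extrinsicBall κ φ o t) ∩ V,
          gradExtrinsicDist m κ φ o p ≠ 0 ∧
          ∀ (U : Set (EuclideanSpace ℝ (Fin (m - 1))))
            (ψ : EuclideanSpace ℝ (Fin (m - 1)) → M),
            IsHypersurfaceParam m (frontier (extrinsicBall κ φ o t) ∩ V) U ψ →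
            ∀ y ∈ U, ψ y = p →
              ∀ u v : EuclideanSpace ℝ (Fin (m - 1)), LinearIndependent ℝ ![u, v] →
                sectionalCurvature (inducedMetric m ψ) y u v ≤
                    κ + alphaNorm m κ φ p ^ 2 +
                      (cosK κ t / sinK κ t +
                          spaceFormNorm κ (φ p) (normalGradDist m κ φ o p) * alphaNorm m κ φ p) ^ 2 /
                        ‖gradExtrinsicDist m κ φ o p‖ ^ 2 ∧
                κ - 2 * alphaNorm m κ φ p ^ 2 +
                      ((cosK κ t / sinK κ t) ^ 2 -
                          2 * spaceFormNorm κ (φ p) (normalGradDist m κ φ o p) * alphaNorm m κ φ p *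
                            (cosK κ t / sinK κ t)) /
                        ‖gradExtrinsicDist m κ φ o p‖ ^ 2 ≤
                  sectionalCurvature (inducedMetric m ψ) y u v := by
  have hloc : LocallyCompactSpace M := Manifold.locallyCompact_of_finiteDimensional (𝓡 m)
  have hX := hasApproxBetween_of_isRiemannianManifold m M
  have hprop : ProperSpace M := hX.properSpace
  obtain ⟨R, hR0, hR⟩ := exists_sinK_mul_alphaNorm_lt hκ hφ o ha
  have hr : Continuous (extrinsicDist κ φ o) :=
    (continuous_spaceFormDist hκ o).comp hφ.contMDiff.continuous
  obtain ⟨B, hB⟩ := (isCompact_closedBall x₀ R).bddAbove_image hr.continuousOn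
  -- for `t > B` the level set `r = t` avoids the ball outside which the potential is convex
  refine ⟨max 1 B, by positivity, fun K _ V _ t ht p hp => ?_⟩
  have ht0 : 0 < t := (one_pos.trans_le (le_max_left _ _)).trans ht
  have hS : ∀ q ∈ frontier (extrinsicBall κ φ o t) ∩ V, extrinsicDist κ φ o q = t :=
    fun q hq => frontier_lt_subset_eq hr continuous_const hq.1
  have hpt := hS p hp
  have hlt : ∀ z, dist z x₀ ≤ R → extrinsicDist κ φ o z < extrinsicDist κ φ o p := fun z hz => by
    rw [hpt]
    exact (hB (mem_image_of_mem _ hz)).trans_lt ((le_max_right _ _).trans_lt ht)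
  have hpR : R < dist p x₀ := by
    by_contra! h
    exact lt_irrefl _ (hlt p h)
  have hp0 : 0 < extrinsicDist κ φ o p := hpt ▸ ht0
  have hgrad : gradExtrinsicDist m κ φ o p ≠ 0 := fun h0 => by
    rw [gradExtrinsicDist_eq hκ hφ hp0] at h0
    have hcrit := (smul_eq_zero.1 h0).resolve_left (inv_ne_zero (sinK_pos hp0).ne')
    exact hX.false_of_strict_local_min (f := fun z => potential κ o (φ z))
      ((contDiff_potential hκ o).continuous.comp hφ.contMDiff.continuous) hR0
      (fun z hz => potential_lt_of_spaceFormDist_lt hκ (hlt z hz))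
      (fun z hz => exists_potential_midpoint_lt hκ hφ o z (hR z hz))
      (exists_potential_lt_of_tangentPart_eq_zero hκ hφ o p (hR p hpR) hcrit)
  refine ⟨hgrad, fun U ψ hψ y hy hyp u v huv => ?_⟩
  subst hyp
  refine sectionalCurvature_inducedMetric_bounds hκ hφ ht0 hS hψ hy hgrad ?_ huv
  rw [le_div_iff₀ (sinK_pos ht0), mul_comm, ← hpt]
  exact (hR _ hpR).le
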